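/- **Setting.** Let $(M,\mathcal T)$ be a connected closed triangulated surface, i.e. the connected quotient of a finite non-empty disjoint union of triangles by identifying their sides in pairs by homeomorphisms, with vertex set $V$, $|V|=N$, edge set $E$ and face set $F$; let $\chi(M)=|V|-|E|+|F|$. Let $\varepsilon:V\to\{0,1\}$ and $\eta:E\to\mathbb R$ satisfy the structure conditions $$\varepsilon_s\varepsilon_t+\eta_{st}>0\quad\text{for all }\{st\}\in E,\qquad \varepsilon_q\eta_{st}+\eta_{qs}\eta_{qt}\ge 0,\ \ \{q,s,t\}=\{i,j,k\},\quad\text{for all }\{ijk\}\in F .$$ Fix the Euclidean or the hyperbolic background geometry. For $f:V\to\mathbb R$ define edge lengths by $$l_{ij}=\sqrt{\varepsilon_ie^{2f_i}+\varepsilon_je^{2f_j}+2\eta_{ij}e^{f_i+f_j}}\ \ (\text{Euclidean}),\qquad l_{ij}=\cosh^{-1}\!\Big(\sqrt{(1+\varepsilon_ie^{2f_i})(1+\varepsilon_je^{2f_j})}+\eta_{ij}e^{f_i+f_j}\Big)\ \ (\text{hyperbolic}).$$ $f$ is a (nondegenerate) discrete conformal structure if all $l_{ij}$ are positive and satisfy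 the strict triangle inequalities in every face. Put $u_i=f_i$ in the Euclidean case; in the hyperbolic case put $u_i=f_i$ if $\varepsilon_i=0$ and $u_i=\frac12\log\Big|\frac{\sqrt{1+\varepsilon_ie^{2f_i}}-1}{\sqrt{1+\varepsilon_ie^{2f_i}}+1}\Big|$ if $\varepsilon_i=1$. Let $\Omega\subset\mathbb R^V$ be the set of the $u$ that come from discrete conformal structures; these $u$ are also called nondegenerate discrete conformal structures. For $u\in\Omega$ let $K_i=K_i(u)$ be $2\pi$ minus the sum of the inner angles at the vertex $i$ of the Euclidean (hyperbolic) triangles with edge lengths $l$, and let $\Delta=-\frac{\partial(K_1,\dots,K_N)}{\partial(u_1,\dots,u_N)}$. Solutions of the flows below are curves $u(t)\in\Omega$, and the constant curvature is $K^{c}=\frac{2\pi\chi(M)}{N}$ in the Euclidean and $K^{c}=0$ in the hyperbolic case. For $\bar u\in\Omega$ and a flow $\frac{du}{dt}=X(u)$ on $\Omega$, say that the flow *converges exponentially near $\bar u$* if there are $\delta,C,a>0$ such that for every $u_0\in\mathbb R^V$ with $\|u_0-\bar u\|<\delta$ the solution with $u(0)=u_0$ exists for all $t\ge0$, is unique (every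 solution on an interval $[0,T)$ with the same initial value agrees with it there), and satisfies $\|u(t)-u_\infty\|\le Ce^{-at}$ for all $t\ge 0$, where $u_\infty=\bar u$ in the hyperbolic case and $u_\infty=\bar u+c\,(1,\dots,1)$, $c=\frac1N\sum_{i}(u_{0,i}-\bar u_i)$, in the Euclidean case. (So $u_\infty=\bar u$ also in the Euclidean case if $u_0$ is normalized by $\sum_iu_{0,i}=\sum_i\bar u_i$.) **Theorem 1.3.** Consider the combinatorial Calabi flow $\frac{du_i}{dt}=\Delta K_i$. (a) If a solution on $[0,\infty)$ converges, as $t\to\infty$, to a nondegenerate discrete conformal structure $u^*\in\Omega$, then $u^*$ has constant curvature: $K_i(u^*)=K^c$ for all $i\in V$. (b) If $u^*\in\Omega$ has constant curvature $K_i(u^*)=K^c$ for all $i\in V$, then the combinatorial Calabi flow converges exponentially near $u^*$. **General version.** Let $\overline K:V\to\mathbb R$, with $\sum_{i}\overline K_i=2\pi\chi(M)$ in the Euclidean case. Consider the modified combinatorial Ricci flow $\frac{du_i}{dt}=\overline K_i-K_i$ and the modified combinatorial Calabi flow $\frac{du_i}{dt}=\Delta(K-\overline K)_i$. (a) If a solution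 of either flow on $[0,\infty)$ converges, as $t\to\infty$, to a nondegenerate discrete conformal structure $\bar u\in\Omega$, then $K(\bar u)=\overline K$. (b) If $\bar u\in\Omega$ satisfies $K(\bar u)=\overline K$, then each of the two flows converges exponentially near $\bar u$. -/

import Mathlib

/-- A connected closed triangulated surface with set of triangles `F`: the quotient of the disjoint
union of the triangles by identifying their sides in pairs.  The corners of each triangle are
numbered by `Fin 3`.  The *corner* `k` of the triangle `t` is written `(t, k)`.  The *side* `(t, k)`
is the side of `t` opposite to the corner `(t, k)`; it runs from the corner `(t, k + 1)` to the
corner `(t, k + 2)`.  The side `s` is glued to the side `mate s`; the gluing homeomorphism sends the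
start of `s` to the start of `mate s` if `aligned s` is true, and to the end of `mate s` otherwise.
Self-gluings of a triangle, loops, multiple edges and non-orientable surfaces are all allowed;
every simplicial triangulation of a connected closed surface arises in this way. -/
structure ClosedTriangulation (F : Type*) where
  mate : F × Fin 3 → F × Fin 3
  mate_mate : ∀ s, mate (mate s) = s
  mate_ne : ∀ s, mate s ≠ s
  aligned : F × Fin 3 → Bool
  aligned_mate : ∀ s, aligned (mate s) = aligned s
  /-- Any two triangles are joined by a chain of triangles glued along sides. -/
  connected : ∀ a b : F, Relation.ReflTransGen (fun x y => ∃ i j, mate (x, i) = (y, j)) a b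

namespace ClosedTriangulation

variable {F : Type*} (T : ClosedTriangulation F)

/-- The corner at which the side `s` starts. -/
def startCorner (s : F × Fin 3) : F × Fin 3 := (s.1, s.2 + 1)

/-- The corner at which the side `s` ends. -/
def endCorner (s : F × Fin 3) : F × Fin 3 := (s.1, s.2 + 2)

/-- The corners `c` and `d` are matched by one of the gluing homeomorphisms. -/
def CornerGlued (c d : F × Fin 3) : Prop :=
  ∃ s, (T.aligned s = true ∧
      ((c = startCorner s ∧ d = startCorner (T.mate s)) ∨
        (c = endCorner s ∧ d = endCorner (T.mate s)))) ∨
    (T.aligned s = false ∧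
      ((c = startCorner s ∧ d = endCorner (T.mate s)) ∨
        (c = endCorner s ∧ d = startCorner (T.mate s))))

/-- The vertices `V`: corners modulo the equivalence relation generated by the gluing. -/
def Vertex : Type _ := Quot T.CornerGlued

/-- The edges `E`: sides modulo the gluing. -/
def Edge : Type _ := Quot (fun s s' => T.mate s = s')

/-- The vertex at which a corner lies. -/
def vertex (c : F × Fin 3) : T.Vertex := Quot.mk _ c

/-- The edge on which a side lies. -/
def edge (s : F × Fin 3) : T.Edge := Quot.mk _ s

/-- The two endpoints of the side `s`. -/
def startVertex (s : F × Fin 3) : T.Vertex := T.vertex (startCorner s)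

def endVertex (s : F × Fin 3) : T.Vertex := T.vertex (endCorner s)

instance [Finite F] : Finite T.Vertex := Quot.finite _

instance [Finite F] : Finite T.Edge := Quot.finite _

noncomputable instance [Finite F] : Fintype T.Vertex := Fintype.ofFinite _

noncomputable instance [Finite F] : Fintype T.Edge := Fintype.ofFinite _

noncomputable instance : DecidableEq T.Vertex := Classical.decEq _

/-- The Euler characteristic `|V| - |E| + |F|`. -/
noncomputable def eulerChar [Fintype F] : ℝ :=
  (Fintype.card T.Vertex : ℝ) - Fintype.card T.Edge + Fintype.card F

end ClosedTriangulation

/-- The background geometries `𝔼²` and `ℍ²`. -/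
inductive Background where
  | euclidean
  | hyperbolic

namespace Background

/-- Length of an edge with weight `η`, whose endpoints have scheme coefficients `ε₁`, `ε₂` and
conformal factors `f₁`, `f₂`. -/
noncomputable def edgeLength (ε₁ ε₂ η f₁ f₂ : ℝ) : Background → ℝ
  | euclidean =>
      √(ε₁ * Real.exp (2 * f₁) + ε₂ * Real.exp (2 * f₂) + 2 * η * Real.exp (f₁ + f₂))
  | hyperbolic =>
      Real.arcosh (√((1 + ε₁ * Real.exp (2 * f₁)) * (1 + ε₂ * Real.exp (2 * f₂)))
        + η * Real.exp (f₁ + f₂))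

/-- The inner angle opposite to the side of length `a` in a triangle with side lengths `a`, `b`,
`c` (cosine law). -/
noncomputable def angle (a b c : ℝ) : Background → ℝ
  | euclidean => Real.arccos ((b ^ 2 + c ^ 2 - a ^ 2) / (2 * b * c))
  | hyperbolic =>
      Real.arccos ((Real.cosh b * Real.cosh c - Real.cosh a) / (Real.sinh b * Real.sinh c))

/-- The coordinate `u` of a conformal factor `f` at a vertex with scheme coefficient `ε`. -/
noncomputable def coord (ε f : ℝ) : Background → ℝ
  | euclidean => f
  | hyperbolic =>
      if ε = 0 then f
      else 1 / 2 * Real.log |(√(1 + ε * Real.exp (2 * f)) - 1) / (√(1 + ε * Real.exp (2 * f)) + 1)|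

/-- The conformal factor `f` with coordinate `u`, for `ε ∈ {0, 1}`; see `factor_coord`. -/
noncomputable def factor (ε u : ℝ) : Background → ℝ
  | euclidean => u
  | hyperbolic => if ε = 0 then u else -Real.log (-Real.sinh u)

theorem factor_coord (G : Background) {ε : ℝ} (hε : ε = 0 ∨ ε = 1) (f : ℝ) :
    G.factor ε (G.coord ε f) = f := by
  cases G with
  | euclidean => rfl
  | hyperbolic =>
    rcases hε with rfl | rfl
    · simp [factor, coord]
    · have hE : 0 < Real.exp f := Real.exp_pos f
      have hE2 : Real.exp (2 * f) = Real.exp f ^ 2 := by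
        rw [two_mul, Real.exp_add, sq]
      set C := √(1 + 1 * Real.exp (2 * f)) with hC
      have hCsq : C ^ 2 = 1 + Real.exp f ^ 2 := by
        rw [hC, Real.sq_sqrt (by positivity), hE2, one_mul]
      have hC0 : 0 ≤ C := Real.sqrt_nonneg _
      have hC1 : 1 < C := by nlinarith [sq_nonneg (C - 1)]
      have hq : 0 < (C - 1) / (C + 1) := div_pos (by linarith) (by linarith)
      simp only [factor, coord, one_ne_zero, if_false, ← hC]
      rw [abs_of_pos hq]
      set u := 1 / 2 * Real.log ((C - 1) / (C + 1)) with hu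
      have hw : Real.exp u ^ 2 = (C - 1) / (C + 1) := by
        rw [← Real.exp_nat_mul, hu]
        push_cast
        rw [show (2 : ℝ) * (1 / 2 * Real.log ((C - 1) / (C + 1)))
          = Real.log ((C - 1) / (C + 1)) by ring, Real.exp_log hq]
      have hwpos : 0 < Real.exp u := Real.exp_pos u
      have hwE : Real.exp u = Real.exp f / (C + 1) := by
        have h1 : Real.exp u ^ 2 = (Real.exp f / (C + 1)) ^ 2 := by
          rw [hw, div_pow, show Real.exp f ^ 2 = (C - 1) * (C + 1) by nlinarith]
          field_simp
        exact (sq_eq_sq₀ hwpos.le (by positivity)).1 h1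
      have hs : -Real.sinh u = (Real.exp f)⁻¹ := by
        rw [Real.sinh_eq, Real.exp_neg, hwE]
        have : C + 1 ≠ 0 := by linarith
        field_simp
        nlinarith
      rw [hs, Real.log_inv, Real.log_exp, neg_neg]

end Background

/-- A weighted triangulated surface: `ε` is the scheme coefficient and `η` the discrete conformal
structure coefficient. -/
structure WeightedTriangulation (F : Type*) extends ClosedTriangulation F where
  ε : toClosedTriangulation.Vertex → ℝ
  η : toClosedTriangulation.Edge → ℝ

namespace WeightedTriangulation

variable {F : Type*} (W : WeightedTriangulation F)

/-- The vertex set of the underlying triangulation. -/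
abbrev V : Type _ := W.toClosedTriangulation.Vertex

/-- `ε_s ε_t + η_{st} > 0` for every edge `{st}`. -/
def StructureCondition1 : Prop :=
  ∀ s : F × Fin 3, 0 < W.ε (W.startVertex s) * W.ε (W.endVertex s) + W.η (W.edge s)

/-- `ε_q η_{st} + η_{qs} η_{qt} ≥ 0` for every triangle and every corner `q` of it. -/
def StructureCondition2 : Prop :=
  ∀ (t : F) (k : Fin 3),
    0 ≤ W.ε (W.vertex (t, k)) * W.η (W.edge (t, k))
      + W.η (W.edge (t, k + 1)) * W.η (W.edge (t, k + 2))

/-- The length of (the edge on which lies) the side `s`. -/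
noncomputable def length (G : Background) (f : W.V → ℝ) (s : F × Fin 3) : ℝ :=
  G.edgeLength (W.ε (W.startVertex s)) (W.ε (W.endVertex s)) (W.η (W.edge s))
    (f (W.startVertex s)) (f (W.endVertex s))

/-- Glued sides have the same length, so `length` is a function on the edges. -/
theorem length_mate (G : Background) (f : W.V → ℝ) (s : F × Fin 3) :
    W.length G f (W.mate s) = W.length G f s := by
  have he : W.edge (W.mate s) = W.edge s :=
    (Quot.sound (r := fun s s' => W.mate s = s') (rfl : W.mate s = W.mate s)).symm
  have hv : (W.startVertex (W.mate s) = W.startVertex s ∧ W.endVertex (W.mate s) = W.endVertex s) ∨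
      (W.startVertex (W.mate s) = W.endVertex s ∧ W.endVertex (W.mate s) = W.startVertex s) := by
    cases h : W.aligned s
    · exact .inr ⟨(Quot.sound ⟨s, .inr ⟨h, .inr ⟨rfl, rfl⟩⟩⟩).symm,
        (Quot.sound ⟨s, .inr ⟨h, .inl ⟨rfl, rfl⟩⟩⟩).symm⟩
    · exact .inl ⟨(Quot.sound ⟨s, .inl ⟨h, .inl ⟨rfl, rfl⟩⟩⟩).symm,
        (Quot.sound ⟨s, .inl ⟨h, .inr ⟨rfl, rfl⟩⟩⟩).symm⟩
  unfold length
  rw [he]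
  rcases hv with ⟨a, b⟩ | ⟨a, b⟩ <;> rw [a, b]
  cases G <;> simp [Background.edgeLength, mul_comm, add_comm]

/-- `f` is a (nondegenerate) discrete conformal structure: the lengths are positive and satisfy the
strict triangle inequalities in every triangle. -/
def IsDCS (G : Background) (f : W.V → ℝ) : Prop :=
  (∀ s, 0 < W.length G f s) ∧
    ∀ (t : F) (k : Fin 3),
      W.length G f (t, k) < W.length G f (t, k + 1) + W.length G f (t, k + 2)

/-- The inner angle at the corner `c`. -/
noncomputable def cornerAngle (G : Background) (f : W.V → ℝ) (c : F × Fin 3) : ℝ :=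
  G.angle (W.length G f c) (W.length G f (c.1, c.2 + 1)) (W.length G f (c.1, c.2 + 2))

/-- The set of (nondegenerate) discrete conformal structures in the coordinates `u`. -/
def admissible (G : Background) : Set (W.V → ℝ) :=
  (fun (f : W.V → ℝ) i => G.coord (W.ε i) (f i)) '' {f | W.IsDCS G f}

section Curvature

variable [Fintype F]

/-- The combinatorial curvature `2π - ∑ θ` of `f`: the sum is over all corners at the vertex `i`. -/
noncomputable def factorCurvature (G : Background) (f : W.V → ℝ) (i : W.V) : ℝ :=
  2 * Real.pi - ∑ c : F × Fin 3 with W.vertex c = i, W.cornerAngle G f c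

/-- The combinatorial curvature `K` as a function of the coordinates `u`. -/
noncomputable def curvature (G : Background) (u : W.V → ℝ) : W.V → ℝ :=
  W.factorCurvature G (fun i => G.factor (W.ε i) (u i))

/-- The Jacobian matrix `∂(K_1, …, K_N)/∂(u_1, …, u_N)`. -/
noncomputable def curvatureJacobian (G : Background) (u : W.V → ℝ) : Matrix W.V W.V ℝ :=
  Matrix.of fun i j => fderiv ℝ (fun v => W.curvature G v i) u (Pi.single j 1)

/-- The combinatorial Laplace operator `Δ = -∂(K_1, …, K_N)/∂(u_1, …, u_N)` at `u`. -/
noncomputable def laplacian (G : Background) (u g : W.V → ℝ) : W.V → ℝ :=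
  Matrix.mulVec (-W.curvatureJacobian G u) g

/-- Right-hand side of the combinatorial Calabi flow `du_i/dt = Δ K_i`. -/
noncomputable def calabi (G : Background) (u : W.V → ℝ) : W.V → ℝ :=
  W.laplacian G u (W.curvature G u)

/-- Right-hand side of the modified combinatorial Ricci flow `du_i/dt = K̄_i - K_i`. -/
noncomputable def modifiedRicci (G : Background) (Kbar u : W.V → ℝ) : W.V → ℝ :=
  Kbar - W.curvature G u

/-- Right-hand side of the modified combinatorial Calabi flow `du_i/dt = Δ (K - K̄)_i`. -/
noncomputable def modifiedCalabi (G : Background) (Kbar u : W.V → ℝ) : W.V → ℝ :=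
  W.laplacian G u (W.curvature G u - Kbar)

/-- The value of constant curvature: the average `2πχ(M)/N` in the Euclidean, and `0` in the
hyperbolic background geometry. -/
noncomputable def constCurvature : Background → ℝ
  | .euclidean => 2 * Real.pi * W.eulerChar / Fintype.card W.V
  | .hyperbolic => 0

/-- `u` is a solution, on the time interval `I`, of the flow `du/dt = X(u)` of discrete conformal
structures. -/
def IsSolution (G : Background) (X : (W.V → ℝ) → W.V → ℝ) (I : Set ℝ) (u : ℝ → W.V → ℝ) : Prop :=
  (∀ t ∈ I, u t ∈ W.admissible G) ∧ IsIntegralCurveOn u (fun _ => X) I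

/-- If a solution of the flow `du/dt = X(u)` converges to a nondegenerate discrete conformal
structure, then this limit has curvature `Kbar`. -/
def LimitsHaveCurvature (G : Background) (X : (W.V → ℝ) → W.V → ℝ) (Kbar : W.V → ℝ) : Prop :=
  ∀ (u : ℝ → W.V → ℝ) (ubar : W.V → ℝ), W.IsSolution G X (Set.Ici 0) u →
    ubar ∈ W.admissible G → Filter.Tendsto u Filter.atTop (nhds ubar) →
      W.curvature G ubar = Kbar

/-- The limit of a flow line that starts at `u₀` near `ubar`: in the hyperbolic case `ubar`; in the
Euclidean case, where `∑ u_i` is preserved, the translate of `ubar` by a constant vector that has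
the same coordinate sum as `u₀`.  Thus it is `ubar` itself if `∑ u₀_i = ∑ ubar_i`. -/
noncomputable def flowLimit (ubar u₀ : W.V → ℝ) : Background → W.V → ℝ
  | .euclidean => fun i => ubar i + (∑ j, (u₀ j - ubar j)) / Fintype.card W.V
  | .hyperbolic => ubar

/-- For every initial value close enough to `ubar` the solution of `du/dt = X(u)` exists for all
time, is unique, and converges exponentially fast. -/
def ConvergesNear (G : Background) (X : (W.V → ℝ) → W.V → ℝ) (ubar : W.V → ℝ) : Prop :=
  ∃ δ > 0, ∃ C > 0, ∃ a > 0, ∀ u₀ : W.V → ℝ, ‖u₀ - ubar‖ < δ →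
    ∃ u : ℝ → W.V → ℝ, u 0 = u₀ ∧ W.IsSolution G X (Set.Ici 0) u ∧
      (∀ (T : ℝ) (v : ℝ → W.V → ℝ), v 0 = u₀ → W.IsSolution G X (Set.Ico 0 T) v →
        ∀ t ∈ Set.Ico 0 T, v t = u t) ∧
      ∀ t, 0 ≤ t → ‖u t - W.flowLimit ubar u₀ G‖ ≤ C * Real.exp (-a * t)

end Curvature

end WeightedTriangulation

/-! Everything rests on the Jacobian `J` of the curvature `K` with respect to `u`. On the admissible
set it is symmetric; it is positive definite in the hyperbolic case, and positive semidefinite with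
the constant vectors as kernel in the Euclidean case. At a point with `K = Kbar` the Ricci flow has
linearization `-J`. The Calabi flow has `-J²`, because the term with second derivatives of `K`
carries the factor `K - Kbar`. In the Euclidean case both flows preserve `∑ u i`, by Gauss–Bonnet
and by the vanishing column sums of `J`. On the tangent space of the invariant hyperplane both
linearizations are negative definite, so `exponential_stability` applies; scaling invariance moves a
general Euclidean initial value into the right hyperplane.

Conversely, the limit of a flow line is an equilibrium. For the Calabi flow this means `J (K - Kbar)
= 0`, and since Gauss–Bonnet makes `K - Kbar` sum to zero in the Euclidean case, it vanishes. The
unmodified Calabi flow is the modified one with constant target, because `J` kills that constant.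

The properties of `J` are checked triangle by triangle. The angle Jacobian of a triangle is given by
one weight per side, a positive multiple of a height that may be negative. In the Euclidean case the
form `∑ wₖ (xᵢ - xⱼ)²` is definite modulo constants because `w₁w₂ + w₂w₃ + w₃w₁ > 0`, which is
`conformal_det_pos`, and because the sum of the weights times the squared lengths is positive. In
the hyperbolic case the determinant is governed by a cubic in the heights, positive again by
`conformal_det_pos`. At most one height is nonpositive (`not_two_nonpos`). Lowering one height, with
the other two positive, until the cubic is nonpositive gives the remaining sign
(`hyperbolicForm_pos_of_neg`). -/

section ODE

/-! ### Exponential stability of equilibria and limits of flow lines. -/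

open Set Filter Topology Metric
open scoped NNReal

variable {ι : Type*} [Fintype ι]

/-- `ι → ℝ` carries the sup norm, whereas the energy estimate uses the sum of squares. This bound
and the next two pass between them, losing at most a factor `Fintype.card ι`. -/
theorem sq_norm_le_sum_sq (w : ι → ℝ) : ‖w‖ ^ 2 ≤ ∑ i, w i ^ 2 := by
  have h0 : 0 ≤ ∑ i, w i ^ 2 := Finset.sum_nonneg fun i _ => sq_nonneg _
  have h : ‖w‖ ≤ √(∑ i, w i ^ 2) := by
    refine (pi_norm_le_iff_of_nonneg (Real.sqrt_nonneg _)).2 fun i => ?_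
    rw [Real.norm_eq_abs]
    refine Real.abs_le_sqrt ?_
    exact Finset.single_le_sum (f := fun i => w i ^ 2) (fun i _ => sq_nonneg _) (Finset.mem_univ i)
  calc ‖w‖ ^ 2 ≤ (√(∑ i, w i ^ 2)) ^ 2 := by gcongr
    _ = _ := Real.sq_sqrt h0

theorem sum_mul_le_card_mul_norm (w z : ι → ℝ) :
    ∑ i, w i * z i ≤ Fintype.card ι * (‖w‖ * ‖z‖) := by
  have : ∀ i ∈ Finset.univ, w i * z i ≤ ‖w‖ * ‖z‖ := fun i _ => by
    have h1 := norm_le_pi_norm w i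
    have h2 := norm_le_pi_norm z i
    calc w i * z i ≤ ‖w i * z i‖ := Real.le_norm_self _
      _ = ‖w i‖ * ‖z i‖ := norm_mul _ _
      _ ≤ _ := by gcongr
  simpa using Finset.sum_le_card_nsmul _ _ _ this

theorem sum_sq_le_card_mul_norm (w : ι → ℝ) :
    ∑ i, w i ^ 2 ≤ Fintype.card ι * ‖w‖ ^ 2 := by
  simpa [sq] using sum_mul_le_card_mul_norm w w

/-- A quadratic form that is negative on the nonzero vectors of a hyperplane is bounded above there
by a negative multiple of the squared norm. -/
theorem exists_quadratic_le_neg_mul_norm_sq (φ : (ι → ℝ) →L[ℝ] ℝ) (A : (ι → ℝ) →L[ℝ] (ι → ℝ))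
    (hneg : ∀ w, φ w = 0 → w ≠ 0 → ∑ i, w i * A w i < 0) :
    ∃ m > 0, ∀ w, φ w = 0 → ∑ i, w i * A w i ≤ -m * ‖w‖ ^ 2 := by
  set S : Set (ι → ℝ) := sphere 0 1 ∩ {w | φ w = 0} with hS
  have hc : IsCompact S :=
    (isCompact_sphere 0 1).inter_right (isClosed_eq φ.continuous continuous_const)
  have hcont : Continuous fun w : ι → ℝ => ∑ i, w i * A w i := by fun_prop
  obtain ⟨m, hm, hle⟩ : ∃ m > 0, ∀ w ∈ S, ∑ i, w i * A w i ≤ -m := by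
    rcases S.eq_empty_or_nonempty with h | h
    · exact ⟨1, one_pos, by simp [h]⟩
    · obtain ⟨x, hx, hmax⟩ := hc.exists_isMaxOn h hcont.continuousOn
      refine ⟨-∑ i, x i * A x i, ?_, fun w hw => by simpa using hmax hw⟩
      have : x ≠ 0 := by
        rintro rfl
        simp [hS] at hx
      linarith [hneg x hx.2 this]
  refine ⟨m, hm, fun w hw => ?_⟩
  by_cases h0 : w = 0
  · simp [h0]
  · have hn : 0 < ‖w‖ := norm_pos_iff.2 h0
    have := hle (‖w‖⁻¹ • w) ⟨by simp [norm_smul, hn.ne'], by simp [hw]⟩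
    simp only [map_smul, Pi.smul_apply, smul_eq_mul] at this
    have h2 : ∑ i, ‖w‖⁻¹ * w i * (‖w‖⁻¹ * A w i) = (‖w‖ ^ 2)⁻¹ * ∑ i, w i * A w i := by
      rw [Finset.mul_sum]
      refine Finset.sum_congr rfl fun i _ => ?_
      rw [← inv_pow]
      ring
    rw [h2, inv_mul_le_iff₀ (by positivity)] at this
    linarith

theorem apply_eq_of_deriv_mem_ker {φ : (ι → ℝ) →L[ℝ] ℝ} {v v' : ℝ → ι → ℝ} {T : ℝ}
    (hc : ContinuousOn v (Icc 0 T)) (hd : ∀ t ∈ Ico 0 T, HasDerivWithinAt v (v' t) (Ici t) t)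
    (hφ : ∀ t ∈ Ico 0 T, φ (v' t) = 0) : ∀ t ∈ Icc 0 T, φ (v t) = φ (v 0) := by
  refine constant_of_has_deriv_right_zero (φ.continuous.comp_continuousOn hc) fun t ht => ?_
  have := φ.hasFDerivAt.comp_hasDerivWithinAt t (hd t ht)
  rwa [hφ t ht] at this

/-- If `∑ w i ^ 2` strictly decreases at a rate in a ball, curves that start close to the centre stay
in the ball and decay exponentially. -/
theorem sum_sq_le_of_decay {Y : (ι → ℝ) → ι → ℝ} {p : ι → ℝ} {φ : (ι → ℝ) →L[ℝ] ℝ} {r a T : ℝ}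
    (hr : 0 < r) (ha : 0 < a)
    (hY : ∀ w, φ w = 0 → ‖w‖ ≤ r → ∑ i, w i * Y (p + w) i ≤ -a * ∑ i, w i ^ 2)
    {v : ℝ → ι → ℝ} (hc : ContinuousOn v (Icc 0 T))
    (hd : ∀ t ∈ Ico 0 T, HasDerivWithinAt v (Y (v t)) (Ici t) t)
    (hφ : ∀ t ∈ Ico 0 T, φ (v t - p) = 0) (h0 : ∑ i, (v 0 - p) i ^ 2 ≤ r ^ 2) :
    ∀ t ∈ Icc 0 T, ∑ i, (v t - p) i ^ 2 ≤ r ^ 2 * Real.exp (-a * t) := by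
  have hf : ContinuousOn (fun t => ∑ i, (v t - p) i ^ 2) (Icc 0 T) := by
    refine continuousOn_finsetSum _ fun i _ => ?_
    exact ((continuousOn_pi.1 hc i).sub continuousOn_const).pow 2
  refine image_le_of_deriv_right_lt_deriv_boundary
    (f' := fun t => ∑ i, 2 * ((v t - p) i * Y (v t) i))
    (B' := fun t => r ^ 2 * (Real.exp (-a * t) * -a)) hf ?_ (by simpa using h0) ?_ ?_
  · intro t ht
    refine HasDerivWithinAt.fun_sum fun i _ => ?_
    have := (((hasDerivWithinAt_pi.1 (hd t ht)) i).sub_const (p i)).fun_pow 2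
    simpa [mul_assoc] using this
  · intro t
    have : HasDerivAt (fun t : ℝ => -a * t) (-a) t := by
      simpa using (hasDerivAt_id t).const_mul (-a)
    exact this.exp.const_mul _
  -- At a contact time the sum equals the barrier, hence is at most `r ^ 2`, and the curve is in the
  -- ball. There the sum has logarithmic derivative at most `-2 * a`, strictly below the rate `-a`
  -- of the barrier.
  · intro t ht hE
    have hB : 0 < r ^ 2 * Real.exp (-a * t) := by positivity
    have h1 : Real.exp (-a * t) ≤ 1 := Real.exp_le_one_iff.2 (by nlinarith [ht.1])
    have h2 : ‖v t - p‖ ≤ r := by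
      have := sq_norm_le_sum_sq (v t - p)
      rw [hE] at this
      exact abs_le_of_sq_le_sq' (by nlinarith [sq_nonneg r]) hr.le |>.2
    have h3 := hY (v t - p) (hφ t ht) h2
    rw [add_sub_cancel] at h3
    rw [hE] at h3
    rw [← Finset.mul_sum]
    nlinarith

/-- A bounded Lipschitz vector field is complete. -/
theorem exists_forall_hasDerivWithinAt_of_lipschitz {Y : (ι → ℝ) → ι → ℝ} {K : ℝ≥0} {M : ℝ}
    (hY : LipschitzWith K Y) (hM : ∀ u, ‖Y u‖ ≤ M) (u₀ : ι → ℝ) :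
    ∃ u : ℝ → ι → ℝ, u 0 = u₀ ∧ ∀ t ∈ Ici (0 : ℝ), HasDerivWithinAt u (Y (u t)) (Ici 0) t := by
  have hM0 : 0 ≤ M := (norm_nonneg _).trans (hM u₀)
  have ex : ∀ n : ℕ, ∃ α : ℝ → ι → ℝ, α 0 = u₀ ∧
      ∀ t ∈ Icc (0 : ℝ) n, HasDerivWithinAt α (Y (α t)) (Icc (0 : ℝ) n) t := fun n => by
    have hn : (0 : ℝ) ≤ n := n.cast_nonneg
    -- At speed at most `M` a curve moves by at most `M * n` in time `n`, so a ball of this radius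
    -- is never left. The `0` is the radius of the set of initial values.
    have hPL : IsPicardLindelof (fun _ => Y) (⟨0, left_mem_Icc.2 hn⟩ : Icc (0 : ℝ) n) u₀
        ⟨M * n, by positivity⟩ 0 ⟨M, hM0⟩ K :=
      IsPicardLindelof.of_time_independent (fun x _ => hM x) hY.lipschitzOnWith
        (by simp; exact le_rfl)
    exact hPL.exists_eq_forall_mem_Icc_hasDerivWithinAt₀
  choose α hα0 hα using ex
  have hαc : ∀ n, ContinuousOn (α n) (Icc (0 : ℝ) n) := fun n t ht =>
    (hα n t ht).continuousWithinAt
  have hαr : ∀ n : ℕ, ∀ t ∈ Ico (0 : ℝ) n, HasDerivWithinAt (α n) (Y (α n t)) (Ici t) t := by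
    intro n t ht
    exact (hα n t ⟨ht.1, ht.2.le⟩).mono_of_mem_nhdsWithin
      (mem_of_superset (Icc_mem_nhdsGE_of_mem ⟨le_rfl, ht.2⟩) (Icc_subset_Icc_left ht.1))
  have agree : ∀ m n : ℕ, m ≤ n → EqOn (α m) (α n) (Icc (0 : ℝ) m) := by
    intro m n hmn
    have hmn' : (m : ℝ) ≤ n := Nat.cast_le.2 hmn
    refine ODE_solution_unique_of_mem_Icc_right (v := fun _ => Y) (s := fun _ => univ) (K := K)
      (fun t _ => hY.lipschitzOnWith) (hαc m) (hαr m) (fun _ _ => trivial)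
      ((hαc n).mono (Icc_subset_Icc_right hmn')) (fun t ht => hαr n t ⟨ht.1, ht.2.trans_le hmn'⟩)
      (fun _ _ => trivial) ?_
    rw [hα0, hα0]
  have agree' : ∀ m n : ℕ, ∀ t : ℝ, 0 ≤ t → t ≤ m → t ≤ n → α m t = α n t := by
    intro m n t h0 h1 h2
    rcases le_total m n with h | h
    · exact agree m n h ⟨h0, h1⟩
    · exact (agree n m h ⟨h0, h2⟩).symm
  refine ⟨fun t => α ⌈t⌉₊ t, by simp [hα0], fun t ht => ?_⟩
  have ht0 : (0 : ℝ) ≤ t := ht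
  -- The extra unit makes `t < n`, so near `t` within `Ici 0` the glued curve coincides with the
  -- single solution `α n`.
  set n := ⌈t⌉₊ + 1 with hn
  have htn : t < n := by
    rw [hn]
    push_cast
    linarith [Nat.le_ceil t]
  have e : ∀ s ∈ Icc (0 : ℝ) n, α ⌈s⌉₊ s = α n s := fun s hs =>
    agree' _ _ s hs.1 (Nat.le_ceil s) hs.2
  have h1 : HasDerivWithinAt (α n) (Y (α n t)) (Ici 0) t :=
    (hα n t ⟨ht0, htn.le⟩).mono_of_mem_nhdsWithin (by
      rw [← Ici_inter_Iic]
      exact inter_mem self_mem_nhdsWithin (mem_nhdsWithin_of_mem_nhds (Iic_mem_nhds htn)))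
  rw [← e t ⟨ht0, htn.le⟩] at h1
  refine h1.congr_of_eventuallyEq ?_ (e t ⟨ht0, htn.le⟩)
  have : Iic (n : ℝ) ∈ 𝓝[Ici 0] t := mem_nhdsWithin_of_mem_nhds (Iic_mem_nhds htn)
  filter_upwards [this, self_mem_nhdsWithin] with s hs1 hs2
  exact e s ⟨hs2, hs1⟩

/-- The nearest-point map onto a closed ball of the sup norm. -/
noncomputable def clampBall (p : ι → ℝ) (r : ℝ) (u : ι → ℝ) : ι → ℝ :=
  fun i => max (p i - r) (min (p i + r) (u i))

theorem clampBall_mem {r : ℝ} (hr : 0 ≤ r) (p u : ι → ℝ) : clampBall p r u ∈ closedBall p r := by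
  rw [mem_closedBall, dist_pi_le_iff hr]
  intro i
  rw [Real.dist_eq, abs_le]
  unfold clampBall
  constructor
  · linarith [le_max_left (p i - r) (min (p i + r) (u i))]
  · have : max (p i - r) (min (p i + r) (u i)) ≤ p i + r :=
      max_le (by linarith) (min_le_left _ _)
    linarith

theorem clampBall_eq {r : ℝ} {p u : ι → ℝ} (hr : 0 ≤ r) (hu : u ∈ closedBall p r) :
    clampBall p r u = u := by
  funext i
  rw [mem_closedBall, dist_pi_le_iff hr] at hu
  have := abs_le.1 ((Real.dist_eq _ _) ▸ hu i)
  unfold clampBall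
  rw [min_eq_right (by linarith), max_eq_right (by linarith)]

theorem lipschitzWith_clampBall (p : ι → ℝ) (r : ℝ) : LipschitzWith 1 (clampBall p r) := by
  refine LipschitzWith.of_dist_le_mul fun u v => ?_
  rw [NNReal.coe_one, one_mul, dist_pi_le_iff dist_nonneg]
  intro i
  refine le_trans ?_ (dist_le_pi_dist u v i)
  have : LipschitzWith 1 fun x : ℝ => max (p i - r) (min (p i + r) x) :=
    (LipschitzWith.id.const_min _).const_max _
  simpa [clampBall] using this.dist_le_mul (u i) (v i)

/-- Exponential stability of an equilibrium `p` whose linearization is negative definite on the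
hyperplane `ker φ` tangent to the flow. -/
theorem exponential_stability {X : (ι → ℝ) → ι → ℝ} {Ω : Set (ι → ℝ)} {p : ι → ℝ}
    (φ : (ι → ℝ) →L[ℝ] ℝ) (hΩ : Ω ∈ 𝓝 p) (hX : ContDiffAt ℝ 1 X p) (hp : X p = 0)
    (hφ : ∀ u ∈ Ω, φ (X u) = 0)
    (hneg : ∀ w, φ w = 0 → w ≠ 0 → ∑ i, w i * fderiv ℝ X p w i < 0) :
    ∃ δ > 0, ∃ C > 0, ∃ a > 0, ∀ u₀, φ u₀ = φ p → ‖u₀ - p‖ < δ →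
      ∃ u : ℝ → ι → ℝ, u 0 = u₀ ∧ (∀ t ∈ Ici (0 : ℝ), u t ∈ Ω) ∧
        IsIntegralCurveOn u (fun _ => X) (Ici 0) ∧
        (∀ (T : ℝ) (v : ℝ → ι → ℝ), v 0 = u₀ → (∀ t ∈ Ico 0 T, v t ∈ Ω) →
          IsIntegralCurveOn v (fun _ => X) (Ico 0 T) → ∀ t ∈ Ico 0 T, v t = u t) ∧
        ∀ t, 0 ≤ t → ‖u t - p‖ ≤ C * Real.exp (-a * t) := by
  obtain ⟨m, hm, hle⟩ := exists_quadratic_le_neg_mul_norm_sq φ (fderiv ℝ X p) hneg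
  set N : ℝ := (Fintype.card ι : ℝ) with hN
  have hN0 : 0 ≤ N := Nat.cast_nonneg _
  obtain ⟨K, s, hs, hl⟩ := hX.exists_lipschitzOnWith
  have hd : HasFDerivAt X (fderiv ℝ X p) p := (hX.differentiableAt one_ne_zero).hasFDerivAt
  have hlin := hd.isLittleO.def (c := m / (2 * (N + 1))) (by positivity)
  obtain ⟨r, hr, hball⟩ : ∃ r > 0, closedBall p r ⊆ (Ω ∩ s) ∩ {x |
      ‖X x - X p - fderiv ℝ X p (x - p)‖ ≤ m / (2 * (N + 1)) * ‖x - p‖} :=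
    nhds_basis_closedBall.mem_iff.1 (inter_mem (inter_mem hΩ hs) hlin)
  -- The linear part contributes at most `-2 * a * (N + 1) * ‖w‖ ^ 2` and the remainder at most `a *
  -- N * ‖w‖ ^ 2`; the total stays below `-a * N * ‖w‖ ^ 2`, hence below `-a * ∑ i, w i ^ 2`.
  set a : ℝ := m / (2 * (N + 1)) with ha
  have ha0 : 0 < a := by positivity
  have hdecay : ∀ w, φ w = 0 → ‖w‖ ≤ r → ∑ i, w i * X (p + w) i ≤ -a * ∑ i, w i ^ 2 := by
    intro w hw hwr
    have hmem : p + w ∈ closedBall p r := by simpa using hwr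
    have h1 : ‖X (p + w) - fderiv ℝ X p w‖ ≤ a * ‖w‖ := by
      have := (hball hmem).2
      simpa [hp] using this
    have h2 : ∑ i, w i * X (p + w) i =
        ∑ i, w i * fderiv ℝ X p w i + ∑ i, w i * (X (p + w) - fderiv ℝ X p w) i := by
      rw [← Finset.sum_add_distrib]
      refine Finset.sum_congr rfl fun i _ => ?_
      rw [Pi.sub_apply]
      ring
    have h3 := sum_mul_le_card_mul_norm w (X (p + w) - fderiv ℝ X p w)
    have h4 := hle w hw
    have h5 := sum_sq_le_card_mul_norm w
    rw [← hN] at h3 h5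
    have h6 : N * (‖w‖ * ‖X (p + w) - fderiv ℝ X p w‖) ≤ N * (‖w‖ * (a * ‖w‖)) := by gcongr
    have h7 : a * ∑ i, w i ^ 2 ≤ a * (N * ‖w‖ ^ 2) := by gcongr
    have h8 : m = a * (2 * (N + 1)) := by rw [ha]; field_simp
    have h9 : 0 ≤ a * ‖w‖ ^ 2 := by positivity
    rw [h2]
    have h10 : -m * ‖w‖ ^ 2 = -(2 * (a * (N * ‖w‖ ^ 2))) - 2 * (a * ‖w‖ ^ 2) := by
      rw [h8]; ring
    nlinarith
  have hsol : ∀ (Y : (ι → ℝ) → ι → ℝ), (∀ u ∈ closedBall p r, Y u = X u) →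
      ∀ w, φ w = 0 → ‖w‖ ≤ r → ∑ i, w i * Y (p + w) i ≤ -a * ∑ i, w i ^ 2 := by
    intro Y hY w hw hwr
    rw [hY (p + w) (by simpa using hwr)]
    exact hdecay w hw hwr
  have hnorm : ∀ (w : ι → ℝ) (t : ℝ), ∑ i, w i ^ 2 ≤ r ^ 2 * Real.exp (-a * t) →
      ‖w‖ ≤ r * Real.exp (-(a / 2) * t) := by
    intro w t h
    refine abs_le_of_sq_le_sq' ?_ (by positivity) |>.2
    refine (sq_norm_le_sum_sq w).trans (h.trans_eq ?_)
    rw [mul_pow, ← Real.exp_nat_mul]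
    congr 2
    push_cast
    ring
  -- The radius `r / (N + 1)` in the sup norm forces the initial sum of squares below `r ^ 2`. The
  -- rate is halved because the norm is bounded by the square root of the sum of squares.
  refine ⟨r / (N + 1), by positivity, r, hr, a / 2, by positivity, fun u₀ hu₀ hδ => ?_⟩
  have hE0 : ∑ i, (u₀ - p) i ^ 2 ≤ r ^ 2 := by
    have h1 : ‖u₀ - p‖ ^ 2 ≤ (r / (N + 1)) ^ 2 := by gcongr
    calc ∑ i, (u₀ - p) i ^ 2 ≤ N * ‖u₀ - p‖ ^ 2 := sum_sq_le_card_mul_norm _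
      _ ≤ N * (r / (N + 1)) ^ 2 := by gcongr
      _ = r ^ 2 * (N / (N + 1) ^ 2) := by field_simp
      _ ≤ r ^ 2 * 1 := by
        gcongr
        rw [div_le_one (by positivity)]
        nlinarith
      _ = r ^ 2 := mul_one _
  -- A global bounded Lipschitz extension of `X` from the ball. All its values are values of `X` on
  -- the ball, so `φ` is still preserved; the energy estimate keeps its solution in the ball, where
  -- it solves the original equation.
  set Y : (ι → ℝ) → ι → ℝ := fun u => X (clampBall p r u) with hYdef
  have hYX : ∀ u ∈ closedBall p r, Y u = X u := fun u hu => by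
    rw [hYdef]
    simp only [clampBall_eq hr.le hu]
  have hlb : LipschitzOnWith K X (closedBall p r) := hl.mono fun x hx => (hball hx).1.2
  have hYl : LipschitzWith K Y := by
    have := hlb.comp (lipschitzWith_clampBall p r).lipschitzOnWith (s := univ)
      (fun u _ => clampBall_mem hr.le p u)
    rw [mul_one, lipschitzOnWith_univ] at this
    exact this
  have hYM : ∀ u, ‖Y u‖ ≤ K * r := fun u => by
    have h1 := hlb.dist_le_mul _ (clampBall_mem hr.le p u) p (mem_closedBall_self hr.le)
    rw [hp, dist_zero_right] at h1
    refine h1.trans ?_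
    gcongr
    exact clampBall_mem hr.le p u
  obtain ⟨u, hu0, hu⟩ := exists_forall_hasDerivWithinAt_of_lipschitz hYl hYM u₀
  have huc : ContinuousOn u (Ici 0) := fun t ht => (hu t ht).continuousWithinAt
  have hur : ∀ t ∈ Ici (0 : ℝ), HasDerivWithinAt u (Y (u t)) (Ici t) t := fun t ht =>
    (hu t ht).mono (Ici_subset_Ici.2 ht)
  have huE : ∀ t, 0 ≤ t → ∑ i, (u t - p) i ^ 2 ≤ r ^ 2 * Real.exp (-a * t) := by
    intro t ht
    have hker : ∀ s ∈ Icc 0 t, φ (u s) = φ (u 0) :=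
      apply_eq_of_deriv_mem_ker (huc.mono Icc_subset_Ici_self) (fun s hs => hur s hs.1)
        fun s _ => hφ _ (hball (clampBall_mem hr.le p _)).1.1
    refine sum_sq_le_of_decay (Y := Y) hr ha0 (hsol Y hYX) (huc.mono Icc_subset_Ici_self)
      (fun s hs => hur s hs.1) (fun s hs => ?_) (by rwa [hu0]) t ⟨ht, le_rfl⟩
    rw [map_sub, hker s ⟨hs.1, hs.2.le⟩, hu0, hu₀, sub_self]
  have hexp : ∀ t, 0 ≤ t → r * Real.exp (-(a / 2) * t) ≤ r := fun t ht => by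
    have : Real.exp (-(a / 2) * t) ≤ 1 := Real.exp_le_one_iff.2 (by nlinarith)
    nlinarith
  have humem : ∀ t, 0 ≤ t → u t ∈ closedBall p r := fun t ht => by
    rw [mem_closedBall_iff_norm]
    exact (hnorm _ t (huE t ht)).trans (hexp t ht)
  refine ⟨u, hu0, fun t ht => (hball (humem t ht)).1.1, fun t ht => ?_, ?_,
    fun t ht => hnorm _ t (huE t ht)⟩
  · have := hu t ht
    rwa [hYX _ (humem t ht)] at this
  -- A competitor only has to stay in `Ω`: there `φ` is preserved, so the energy estimate confines
  -- it to the ball, where `X` is Lipschitz.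
  · intro T v hv0 hvΩ hv t ht
    have hsub : Icc 0 t ⊆ Ico 0 T := fun s hs => ⟨hs.1, hs.2.trans_lt ht.2⟩
    have hvc : ContinuousOn v (Icc 0 t) := hv.continuousOn.mono hsub
    have hvr : ∀ s ∈ Ico 0 t, HasDerivWithinAt v (X (v s)) (Ici s) s := fun s hs =>
      (hv s (hsub ⟨hs.1, hs.2.le⟩)).mono_of_mem_nhdsWithin
        (mem_of_superset (Ico_mem_nhdsGE (hs.2.trans ht.2)) (Ico_subset_Ico_left hs.1))
    have hker : ∀ s ∈ Icc 0 t, φ (v s) = φ (v 0) :=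
      apply_eq_of_deriv_mem_ker hvc hvr fun s hs => hφ _ (hvΩ s (hsub ⟨hs.1, hs.2.le⟩))
    have hvE := sum_sq_le_of_decay (Y := X) hr ha0 hdecay hvc hvr (fun s hs => by
      rw [map_sub, hker s ⟨hs.1, hs.2.le⟩, hv0, hu₀, sub_self]) (by rwa [hv0])
    have hvmem : ∀ s ∈ Icc 0 t, v s ∈ closedBall p r := fun s hs => by
      rw [mem_closedBall_iff_norm]
      exact (hnorm _ s (hvE s hs)).trans (hexp s hs.1)
    refine ODE_solution_unique_of_mem_Icc_right (v := fun _ => X) (s := fun _ => closedBall p r)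
      (K := K) (fun _ _ => hlb) hvc hvr (fun s hs => hvmem s ⟨hs.1, hs.2.le⟩)
      (huc.mono Icc_subset_Ici_self) (fun s hs => ?_) (fun s hs => humem s hs.1)
      (by rw [hv0, hu0]) ⟨ht.1, le_rfl⟩
    have := hur s hs.1
    rwa [hYX _ (humem s hs.1)] at this

/-- The limit of a flow line is an equilibrium. -/
theorem eq_zero_of_tendsto_of_isIntegralCurveOn {X : (ι → ℝ) → ι → ℝ} {p : ι → ℝ}
    (hX : ContinuousAt X p) {u : ℝ → ι → ℝ} (hu : IsIntegralCurveOn u (fun _ => X) (Ici 0))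
    (hlim : Tendsto u atTop (𝓝 p)) : X p = 0 := by
  funext i
  have hXi : Tendsto (fun t => X (u t) i) atTop (𝓝 (X p i)) :=
    ((continuous_apply i).tendsto _).comp (hX.tendsto.comp hlim)
  have hui : Tendsto (fun t => u t i) atTop (𝓝 (p i)) :=
    ((continuous_apply i).tendsto _).comp hlim
  have hshift : Tendsto (fun t : ℝ => u (t + 1) i - u t i) atTop (𝓝 0) := by
    simpa using (hui.comp (tendsto_atTop_add_const_right atTop 1 tendsto_id)).sub hui
  -- Each coordinate changes by an amount tending to zero over `[t, t + 1]`, while by the mean value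
  -- theorem this change is a value of the field along the curve.
  have hmv : ∀ t : ℝ, 0 ≤ t → ∃ s ∈ Ioo t (t + 1), X (u s) i = u (t + 1) i - u t i := by
    intro t ht
    have hder : ∀ s ∈ Ioo t (t + 1), HasDerivAt (fun s => u s i) (X (u s) i) s := fun s hs =>
      hasDerivAt_pi.1 ((hu s (ht.trans hs.1.le)).hasDerivAt
        (Ici_mem_nhds (ht.trans_lt hs.1))) i
    obtain ⟨s, hs, h⟩ := exists_hasDerivAt_eq_slope (fun s => u s i) (fun s => X (u s) i)
      (lt_add_one t) ((continuousOn_pi.1 hu.continuousOn i).mono fun s hs => ht.trans hs.1) hder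
    exact ⟨s, hs, by simpa using h⟩
  choose! s hs hsX using hmv
  have hst : Tendsto s atTop atTop := tendsto_atTop_mono' _
    ((eventually_ge_atTop 0).mono fun t ht => (hs t ht).1.le) tendsto_id
  refine tendsto_nhds_unique ((hXi.comp hst).congr' ?_) hshift
  filter_upwards [eventually_ge_atTop 0] with t ht using hsX t ht

end ODE

/-! ### Polynomial inequalities behind the definiteness for one triangle. -/

section TriangleAlgebra

/-- The expression that controls the determinant of the Jacobian of the angles of a triangle. -/
theorem conformal_det_pos {ε₁ ε₂ ε₃ η₁ η₂ η₃ τ₁ τ₂ τ₃ : ℝ}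
    (hε₁ : ε₁ = 0 ∨ ε₁ = 1) (hε₂ : ε₂ = 0 ∨ ε₂ = 1) (hε₃ : ε₃ = 0 ∨ ε₃ = 1)
    (he₁ : 0 < ε₂ * ε₃ + η₁) (he₂ : 0 < ε₃ * ε₁ + η₂) (he₃ : 0 < ε₁ * ε₂ + η₃)
    (hγ₁ : 0 ≤ ε₁ * η₁ + η₂ * η₃) (hγ₂ : 0 ≤ ε₂ * η₂ + η₃ * η₁) (hγ₃ : 0 ≤ ε₃ * η₃ + η₁ * η₂)
    (h₁ : 0 < τ₁) (h₂ : 0 < τ₂) (h₃ : 0 < τ₃) :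
    0 < 2 * (ε₁ * ε₂ * ε₃ + η₁ * η₂ * η₃) * (τ₁ * τ₂ * τ₃)
      + (ε₁ * η₁ + η₂ * η₃) * τ₁ * (ε₂ * τ₂ ^ 2 + ε₃ * τ₃ ^ 2)
      + (ε₂ * η₂ + η₃ * η₁) * τ₂ * (ε₃ * τ₃ ^ 2 + ε₁ * τ₁ ^ 2)
      + (ε₃ * η₃ + η₁ * η₂) * τ₃ * (ε₁ * τ₁ ^ 2 + ε₂ * τ₂ ^ 2) := by
  have hP : 0 < τ₁ * τ₂ * τ₃ := by positivity
  set γ₁ := ε₁ * η₁ + η₂ * η₃ with hg₁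
  set γ₂ := ε₂ * η₂ + η₃ * η₁ with hg₂
  set γ₃ := ε₃ * η₃ + η₁ * η₂ with hg₃
  have m₁ : 0 ≤ γ₁ * τ₁ := mul_nonneg hγ₁ h₁.le
  have m₂ : 0 ≤ γ₂ * τ₂ := mul_nonneg hγ₂ h₂.le
  have m₃ : 0 ≤ γ₃ * τ₃ := mul_nonneg hγ₃ h₃.le
  have q₁ := sq_nonneg (τ₂ - τ₃)
  have q₂ := sq_nonneg (τ₃ - τ₁)
  have q₃ := sq_nonneg (τ₁ - τ₂)
  have s₁ := mul_nonneg m₁ (sq_nonneg τ₂)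
  have s₁' := mul_nonneg m₁ (sq_nonneg τ₃)
  have s₂ := mul_nonneg m₂ (sq_nonneg τ₃)
  have s₂' := mul_nonneg m₂ (sq_nonneg τ₁)
  have s₃ := mul_nonneg m₃ (sq_nonneg τ₁)
  have s₃' := mul_nonneg m₃ (sq_nonneg τ₂)
  have t₁ := mul_nonneg m₁ q₁
  have t₂ := mul_nonneg m₂ q₂
  have t₃ := mul_nonneg m₃ q₃
  -- Since `τ₂ ^ 2 + τ₃ ^ 2 ≥ 2 * τ₂ * τ₃` and cyclically, in every case the expression is at least
  -- `2 * τ₁ * τ₂ * τ₃` times the product of the three positive quantities in `he₁`, `he₂`, `he₃`.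
  rcases hε₁ with rfl | rfl <;> rcases hε₂ with rfl | rfl <;> rcases hε₃ with rfl | rfl <;>
    simp only [zero_mul, mul_zero, one_mul, mul_one, zero_add, add_zero] at *
  · have := mul_pos (mul_pos (mul_pos he₁ he₂) he₃) hP
    linarith
  · have := mul_pos (mul_pos (mul_pos he₁ he₂) he₃) hP
    linarith
  · have := mul_pos (mul_pos (mul_pos he₁ he₂) he₃) hP
    linarith
  · have := mul_pos (mul_pos (mul_pos he₁ he₂) he₃) hP
    rw [hg₁] at t₁ ⊢
    linarith
  · have := mul_pos (mul_pos (mul_pos he₁ he₂) he₃) hP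
    linarith
  · have := mul_pos (mul_pos (mul_pos he₁ he₂) he₃) hP
    rw [hg₂] at t₂ ⊢
    linarith
  · have := mul_pos (mul_pos (mul_pos he₁ he₂) he₃) hP
    rw [hg₃] at t₃ ⊢
    linarith
  · have := mul_pos (mul_pos (mul_pos he₁ he₂) he₃) hP
    rw [hg₁] at t₁ ⊢
    rw [hg₂] at t₂ ⊢
    rw [hg₃] at t₃ ⊢
    linarith

/-- If `a * b = 0` the first inequality is the claim; if `a * b = 1` then `n > -1` and `n ^ 2 ≥ 1`.
-/
theorem pos_of_cofactor_nonpos {a b n : ℝ} (ha : a = 0 ∨ a = 1) (hb : b = 0 ∨ b = 1)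
    (h : 0 < a * b + n) (hn : a * b - n ^ 2 ≤ 0) : 0 < n := by
  rcases ha with rfl | rfl <;> rcases hb with rfl | rfl <;> nlinarith

/-- At most one of the distances from the radical centre to the sides is nonpositive. -/
theorem not_two_nonpos {ε₁ ε₂ ε₃ η₁ η₂ η₃ K₁ K₂ K₃ : ℝ}
    (hε₁ : ε₁ = 0 ∨ ε₁ = 1) (hε₂ : ε₂ = 0 ∨ ε₂ = 1) (hε₃ : ε₃ = 0 ∨ ε₃ = 1)
    (he₁ : 0 < ε₂ * ε₃ + η₁) (he₂ : 0 < ε₃ * ε₁ + η₂) (he₃ : 0 < ε₁ * ε₂ + η₃)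
    (hγ₁ : 0 ≤ ε₁ * η₁ + η₂ * η₃) (hγ₂ : 0 ≤ ε₂ * η₂ + η₃ * η₁) (hγ₃ : 0 ≤ ε₃ * η₃ + η₁ * η₂)
    (h₁ : 0 < K₁) (h₂ : 0 < K₂) (h₃ : 0 < K₃) {H₁ H₂ H₃ D : ℝ}
    (hH₁ : H₁ = (ε₂ * ε₃ - η₁ ^ 2) * K₁ + (ε₃ * η₃ + η₁ * η₂) * K₂ + (ε₂ * η₂ + η₃ * η₁) * K₃)
    (hH₂ : H₂ = (ε₃ * ε₁ - η₂ ^ 2) * K₂ + (ε₁ * η₁ + η₂ * η₃) * K₃ + (ε₃ * η₃ + η₁ * η₂) * K₁)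
    (hH₃ : H₃ = (ε₁ * ε₂ - η₃ ^ 2) * K₃ + (ε₂ * η₂ + η₃ * η₁) * K₁ + (ε₁ * η₁ + η₂ * η₃) * K₂)
    (hD : D = ε₁ * ε₂ * ε₃ - 2 * (η₁ * η₂ * η₃) - ε₁ * η₁ ^ 2 - ε₂ * η₂ ^ 2 - ε₃ * η₃ ^ 2)
    (hs : 0 ≤ D → 0 < K₁ * H₁ + K₂ * H₂ + K₃ * H₃) (n₁ : H₁ ≤ 0) (n₂ : H₂ ≤ 0) : False := by
  -- Let `A` be the symmetric matrix with diagonal `ε₁, ε₂, ε₃` and off-diagonal entries `-η₃, -η₂,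
  -- -η₁` in the places 12, 13, 23. Then `D = det A` and `H = adj(A) K`, with the `γ`s as
  -- off-diagonal cofactors. Hence `A H = D K`, whose first row is `row₁`.
  set γ₁ := ε₁ * η₁ + η₂ * η₃ with hg₁
  set γ₂ := ε₂ * η₂ + η₃ * η₁ with hg₂
  set γ₃ := ε₃ * η₃ + η₁ * η₂ with hg₃
  have g23 := mul_nonneg hγ₂ h₃.le
  have g32 := mul_nonneg hγ₃ h₂.le
  have g31 := mul_nonneg hγ₃ h₁.le
  have g13 := mul_nonneg hγ₁ h₃.le
  -- the two relevant cofactors are nonpositive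
  have a₁ : ε₂ * ε₃ - η₁ ^ 2 ≤ 0 := by
    by_contra! h
    have := mul_pos h h₁
    linarith
  have a₂ : ε₃ * ε₁ - η₂ ^ 2 ≤ 0 := by
    by_contra! h
    have := mul_pos h h₂
    linarith
  have hη₁ : 0 < η₁ := pos_of_cofactor_nonpos hε₂ hε₃ he₁ a₁
  have hη₂ : 0 < η₂ := pos_of_cofactor_nonpos hε₃ hε₁ he₂ a₂
  have b₁ : γ₃ * K₂ ≤ -(ε₂ * ε₃ - η₁ ^ 2) * K₁ := by linarith
  have b₂ : γ₃ * K₁ ≤ -(ε₃ * ε₁ - η₂ ^ 2) * K₂ := by linarith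
  have row₁ : ε₁ * H₁ - η₃ * H₂ - η₂ * H₃ = D * K₁ := by
    rw [hH₁, hH₂, hH₃, hD]; ring
  rcases hε₃ with rfl | rfl
  -- For `ε₃ = 0` one has `γ₃ = η₁ * η₂`, and `b₁`, `b₂` become opposite inequalities between `η₁ *
  -- K₁` and `η₂ * K₂`. Equality leaves no room for `γ₁` and `γ₂`, whose vanishing contradicts
  -- `he₃`.
  · simp only [zero_mul, mul_zero, zero_sub, neg_neg, zero_add, sub_zero, neg_neg] at *
    rw [hg₃] at b₁ b₂
    have c₁ : η₂ * K₂ ≤ η₁ * K₁ := by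
      refine le_of_mul_le_mul_left ?_ hη₁
      linarith
    have c₂ : η₁ * K₁ ≤ η₂ * K₂ := by
      refine le_of_mul_le_mul_left ?_ hη₂
      linarith
    have c : η₂ * K₂ = η₁ * K₁ := le_antisymm c₁ c₂
    have z₁ : γ₁ * K₃ ≤ 0 := by
      have : γ₃ * K₁ = η₂ ^ 2 * K₂ := by rw [hg₃]; linear_combination -η₂ * c
      linarith
    have z₂ : γ₂ * K₃ ≤ 0 := by
      have : γ₃ * K₂ = η₁ ^ 2 * K₁ := by rw [hg₃]; linear_combination η₁ * c
      linarith
    have z₁' : γ₁ = 0 := le_antisymm (nonpos_of_mul_nonpos_left z₁ h₃) hγ₁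
    have z₂' : γ₂ = 0 := le_antisymm (nonpos_of_mul_nonpos_left z₂ h₃) hγ₂
    rw [hg₁] at z₁'
    rw [hg₂] at z₂'
    rcases lt_or_ge η₃ 0 with hn | hn
    · have i₁ : ε₁ = 1 := hε₁.resolve_left fun h => by
        rw [h, zero_mul] at he₃
        linarith only [he₃, hn]
      have i₂ : ε₂ = 1 := hε₂.resolve_left fun h => by
        rw [h, mul_zero] at he₃
        linarith only [he₃, hn]
      rw [i₁, i₂] at he₃
      rw [i₁] at z₁'
      rw [i₂] at z₂'
      have : 0 < (η₁ + η₂) * (1 * 1 + η₃) := mul_pos (by linarith only [hη₁, hη₂]) he₃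
      linarith only [this, z₁', z₂']
    · have i₁ : 0 ≤ ε₁ * η₁ := by
        rcases hε₁ with h | h <;> rw [h] <;> linarith only [hη₁]
      have i₂ : η₂ * η₃ = 0 :=
        le_antisymm (by linarith only [i₁, z₁']) (mul_nonneg hη₂.le hn)
      have i₃ : η₃ = 0 := (mul_eq_zero.1 i₂).resolve_left hη₂.ne'
      have i₄ : ε₁ = 0 := (mul_eq_zero.1 (by linarith only [i₂, z₁'] : ε₁ * η₁ = 0)).resolve_right
        hη₁.ne'
      rw [i₃, i₄] at he₃
      simp at he₃
  · simp only [one_mul, mul_one] at *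
    -- For `ε₃ = 1`, `D` is the 2×2 minor of the adjugate on the indices 1, 2; multiplying `b₁` and
    -- `b₂` together shows that it is nonnegative.
    have hD0 : 0 ≤ D := by
      have e : D = (ε₂ - η₁ ^ 2) * (ε₁ - η₂ ^ 2) - γ₃ ^ 2 := by rw [hD, hg₃]; ring
      have : γ₃ ^ 2 * K₂ ≤ (ε₂ - η₁ ^ 2) * (ε₁ - η₂ ^ 2) * K₂ := by
        have i₁ := mul_le_mul_of_nonneg_left b₁ hγ₃
        have i₂ := mul_le_mul_of_nonneg_left b₂ (neg_nonneg.2 a₁)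
        linarith only [i₁, i₂]
      rw [e]
      linarith only [le_of_mul_le_mul_right this h₂]
    have hs' := hs hD0
    have H₃pos : 0 < H₃ := by
      by_contra! h
      have k₁ := mul_nonneg h₁.le (neg_nonneg.2 n₁)
      have k₂ := mul_nonneg h₂.le (neg_nonneg.2 n₂)
      have k₃ := mul_nonneg h₃.le (neg_nonneg.2 h)
      linarith only [k₁, k₂, k₃, hs']
    rcases lt_or_ge η₃ 0 with hn | hn
    · have k₀ : ε₁ * H₁ ≤ 0 := by
        rcases hε₁ with h | h <;> rw [h] <;> linarith only [n₁]
      have k₁ := mul_pos hη₂ H₃pos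
      have k₂ := mul_nonneg_of_nonpos_of_nonpos hn.le n₂
      have k₃ := mul_nonneg hD0 h₁.le
      linarith only [k₀, k₁, k₂, k₃, row₁]
    -- For `η₃ ≥ 0` every summand of `D` in `i₄` is nonpositive, so all of them vanish; this forces
    -- `η₃ = 0`, then `ε₂ = 1`, then `η₂ = 0`.
    · have i₁ : ε₁ * (ε₂ - η₁ ^ 2) ≤ 0 := by
        rcases hε₁ with h | h <;> rw [h] <;> linarith
      have i₂ : 0 ≤ ε₂ * η₂ ^ 2 := by
        rcases hε₂ with h | h <;> rw [h] <;> linarith [sq_nonneg η₂]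
      have i₃ : 0 ≤ η₁ * η₂ * η₃ := mul_nonneg (mul_pos hη₁ hη₂).le hn
      have i₄ : D = ε₁ * (ε₂ - η₁ ^ 2) - 2 * (η₁ * η₂ * η₃) - ε₂ * η₂ ^ 2 - η₃ ^ 2 := by
        rw [hD]; ring
      have i₅ : η₃ = 0 := by
        rw [← pow_eq_zero_iff two_ne_zero]
        exact le_antisymm (by linarith) (sq_nonneg _)
      have i₆ : ε₂ = 1 := by
        rcases hε₂ with h | h
        · rw [h, i₅] at he₃
          simp at he₃
        · exact h
      rw [i₆, one_mul] at i₄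
      linarith [pow_pos hη₂ 2, sq_nonneg η₃]

/-- Definiteness of a form `∑ wₖ (xᵢ - xⱼ)²` modulo constants. -/
theorem euclidean_weights_add_pos {w₁ w₂ w₃ a b c : ℝ} (ha : 0 < a)
    (hA : 0 < 2 * a * b + 2 * b * c + 2 * c * a - a ^ 2 - b ^ 2 - c ^ 2)
    (hs : 0 < w₁ * a + w₂ * b + w₃ * c) (hW : 0 < w₁ * w₂ + w₂ * w₃ + w₃ * w₁) (hc : 0 < c) :
    0 < w₁ + w₂ := by
  -- A binary form whose discriminant is the negative of `hA`. Adding `c * (w₁ * w₂ + w₂ * w₃ + w₃ *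
  -- w₁)` to it gives `(w₁ + w₂) * (w₁ * a + w₂ * b + w₃ * c)`.
  have h : 0 ≤ a * w₁ ^ 2 + (a + b - c) * w₁ * w₂ + b * w₂ ^ 2 := by
    have : 0 ≤ 4 * a * (a * w₁ ^ 2 + (a + b - c) * w₁ * w₂ + b * w₂ ^ 2) := by
      nlinarith [sq_nonneg (2 * a * w₁ + (a + b - c) * w₂), mul_nonneg hA.le (sq_nonneg w₂)]
    exact nonneg_of_mul_nonneg_right this (by linarith)
  have : 0 < (w₁ + w₂) * (w₁ * a + w₂ * b + w₃ * c) := by nlinarith [mul_pos hc hW]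
  exact pos_of_mul_pos_left this hs.le

/-- Completing the square in the differences `x₁ - x₃`, `x₂ - x₃`: the determinant of this binary
form is `w₁ * w₂ + w₂ * w₃ + w₃ * w₁`. -/
theorem euclidean_form_nonneg {w₁ w₂ w₃ : ℝ} (h : 0 < w₂ + w₃)
    (hW : 0 < w₁ * w₂ + w₂ * w₃ + w₃ * w₁) (x₁ x₂ x₃ : ℝ) :
    0 ≤ w₁ * (x₂ - x₃) ^ 2 + w₂ * (x₃ - x₁) ^ 2 + w₃ * (x₁ - x₂) ^ 2 ∧
    (w₁ * (x₂ - x₃) ^ 2 + w₂ * (x₃ - x₁) ^ 2 + w₃ * (x₁ - x₂) ^ 2 = 0 → x₁ = x₂ ∧ x₂ = x₃) := by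
  have e : (w₂ + w₃) * (w₁ * (x₂ - x₃) ^ 2 + w₂ * (x₃ - x₁) ^ 2 + w₃ * (x₁ - x₂) ^ 2)
      = ((w₂ + w₃) * (x₁ - x₃) - w₃ * (x₂ - x₃)) ^ 2
        + (w₁ * w₂ + w₂ * w₃ + w₃ * w₁) * (x₂ - x₃) ^ 2 := by ring
  have n₂ := mul_nonneg hW.le (sq_nonneg (x₂ - x₃))
  have n₁ := sq_nonneg ((w₂ + w₃) * (x₁ - x₃) - w₃ * (x₂ - x₃))
  refine ⟨nonneg_of_mul_nonneg_right (by rw [e]; positivity) h, fun h0 => ?_⟩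
  rw [h0, mul_zero] at e
  have z₂ : (w₁ * w₂ + w₂ * w₃ + w₃ * w₁) * (x₂ - x₃) ^ 2 = 0 := by linarith
  have z₁ : ((w₂ + w₃) * (x₁ - x₃) - w₃ * (x₂ - x₃)) ^ 2 = 0 := by linarith
  have y₂ : x₂ - x₃ = 0 := by
    rcases mul_eq_zero.1 z₂ with h | h
    · exact absurd h hW.ne'
    · exact pow_eq_zero_iff two_ne_zero |>.1 h
  rw [y₂] at z₁
  have y₁ : x₁ - x₃ = 0 := by
    have := pow_eq_zero_iff two_ne_zero |>.1 z₁
    rw [mul_zero, sub_zero] at this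
    exact (mul_eq_zero.1 this).resolve_left h.ne'
  constructor <;> linarith

theorem edge_form_pos {c x y : ℝ} (hc : 1 < c) (h : x ≠ 0 ∨ y ≠ 0) :
    0 < c * (x ^ 2 + y ^ 2) - 2 * (x * y) := by
  have : 0 < x ^ 2 + y ^ 2 := by
    rcases h with h | h
    · have := pow_pos (abs_pos.2 h) 2
      rw [sq_abs] at this
      nlinarith [sq_nonneg y]
    · have := pow_pos (abs_pos.2 h) 2
      rw [sq_abs] at this
      nlinarith [sq_nonneg x]
  nlinarith [sq_nonneg (x - y)]

theorem edge_form_nonneg {c : ℝ} (hc : 1 < c) (x y : ℝ) :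
    0 ≤ c * (x ^ 2 + y ^ 2) - 2 * (x * y) := by
  nlinarith [sq_nonneg (x - y), sq_nonneg x, sq_nonneg y]

/-- The quadratic form of the angle Jacobian of a hyperbolic triangle with weights `v`. -/
def hyperbolicForm (c₁ c₂ c₃ v₁ v₂ v₃ x₁ x₂ x₃ : ℝ) : ℝ :=
  v₁ * (c₁ * (x₂ ^ 2 + x₃ ^ 2) - 2 * (x₂ * x₃)) + v₂ * (c₂ * (x₃ ^ 2 + x₁ ^ 2) - 2 * (x₃ * x₁))
    + v₃ * (c₃ * (x₁ ^ 2 + x₂ ^ 2) - 2 * (x₁ * x₂))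

/-- The determinant of `hyperbolicForm` is proportional to this cubic form in `yₖ = vₖ (cₖ² - 1)`. -/
def hyperbolicCubic (c₁ c₂ c₃ y₁ y₂ y₃ : ℝ) : ℝ :=
  (c₃ ^ 2 - 1) * (c₂ * y₁ ^ 2 * y₂ + c₁ * y₂ ^ 2 * y₁)
    + (c₂ ^ 2 - 1) * (c₃ * y₁ ^ 2 * y₃ + c₁ * y₃ ^ 2 * y₁)
    + (c₁ ^ 2 - 1) * (c₃ * y₂ ^ 2 * y₃ + c₂ * y₃ ^ 2 * y₂)
    + 2 * (c₁ * c₂ * c₃ - 1) * (y₁ * y₂ * y₃)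

/-- Each side contributes a form that is definite in the variables of its two endpoints; two sides
of positive weight already involve all three vertices. -/
theorem hyperbolicForm_pos_of_nonneg {c₁ c₂ c₃ v₁ v₂ v₃ : ℝ} (h₁ : 1 < c₁) (h₂ : 1 < c₂)
    (h₃ : 1 < c₃) (hv₁ : 0 < v₁) (hv₂ : 0 < v₂) (hv₃ : 0 ≤ v₃) {x₁ x₂ x₃ : ℝ}
    (hx : x₁ ≠ 0 ∨ x₂ ≠ 0 ∨ x₃ ≠ 0) : 0 < hyperbolicForm c₁ c₂ c₃ v₁ v₂ v₃ x₁ x₂ x₃ := by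
  have n₁ := mul_nonneg hv₁.le (edge_form_nonneg h₁ x₂ x₃)
  have n₂ := mul_nonneg hv₂.le (edge_form_nonneg h₂ x₃ x₁)
  have n₃ := mul_nonneg hv₃ (edge_form_nonneg h₃ x₁ x₂)
  unfold hyperbolicForm
  by_cases h : x₂ ≠ 0 ∨ x₃ ≠ 0
  · have := mul_pos hv₁ (edge_form_pos h₁ h)
    linarith
  · have := mul_pos hv₂ (edge_form_pos h₂ (x := x₃) (y := x₁) (by tauto))
    linarith

/-- In a region bounded by a line through two vertices the cubic is nonpositive. -/
theorem hyperbolicCubic_nonpos {c₁ c₂ c₃ y₁ y₂ y₃ : ℝ} (h₁ : 1 < c₁) (h₂ : 1 < c₂)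
    (hA : 0 < 1 + 2 * (c₁ * c₂ * c₃) - c₁ ^ 2 - c₂ ^ 2 - c₃ ^ 2) (p₁ : 0 < y₁) (p₂ : 0 < y₂)
    (hC₁ : y₁ + c₃ * y₂ + c₂ * y₃ = 0) (hC₂ : 0 ≤ c₃ * y₁ + y₂ + c₁ * y₃) :
    hyperbolicCubic c₁ c₂ c₃ y₁ y₂ y₃ ≤ 0 := by
  have c₂pos : 0 < c₂ := by linarith
  have e₂ : (c₂ * c₃ - c₁) * y₁ - (c₁ * c₃ - c₂) * y₂ = c₂ * (c₃ * y₁ + y₂ + c₁ * y₃) := by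
    linear_combination (-c₁) * hC₁
  have e₃ : (c₂ ^ 2 - 1) * y₁ + (c₁ * c₂ - c₃) * y₂ = c₂ * (c₂ * y₁ + c₁ * y₂ + y₃) := by
    linear_combination (-1) * hC₁
  have hC₂' : 0 ≤ (c₂ * c₃ - c₁) * y₁ - (c₁ * c₃ - c₂) * y₂ := by
    rw [e₂]; positivity
  have s₂ : 0 < c₂ ^ 2 - 1 := by nlinarith
  have hC₃' : 0 ≤ (c₂ ^ 2 - 1) * y₁ + (c₁ * c₂ - c₃) * y₂ := by
    rcases le_or_gt c₃ (c₁ * c₂) with h | h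
    · have := mul_nonneg (sub_nonneg.2 h) p₂.le
      have := mul_pos s₂ p₁
      linarith
    -- Multiplied by `c₂ * c₃ - c₁`, the goal becomes `c₂ ^ 2 - 1` times `hC₂'` plus `c₂ * y₂` times
    -- the Gram determinant in `hA`.
    · have k : 0 < c₂ * c₃ - c₁ := by nlinarith
      refine nonneg_of_mul_nonneg_right (b := (c₂ ^ 2 - 1) * y₁ + (c₁ * c₂ - c₃) * y₂) ?_ k
      have := mul_nonneg s₂.le hC₂'
      have := mul_pos (mul_pos hA c₂pos) p₂
      nlinarith
  have hC₃ : 0 ≤ c₂ * y₁ + c₁ * y₂ + y₃ := by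
    rw [e₃] at hC₃'
    exact nonneg_of_mul_nonneg_right hC₃' c₂pos
  have key : hyperbolicCubic c₁ c₂ c₃ y₁ y₂ y₃
      = -((c₃ * y₁ + y₂ + c₁ * y₃) * (c₂ * y₁ + c₁ * y₂ + y₃) * y₁) := by
    have h : y₁ = -(c₃ * y₂ + c₂ * y₃) := by linarith
    unfold hyperbolicCubic
    rw [h]
    ring
  rw [key]
  have := mul_nonneg (mul_nonneg hC₂ hC₃) p₁.le
  linarith

/-- A symmetric 2×2 matrix of positive determinant is definite. `htr` is its trace pairing with the
positive definite matrix with rows `(c, 1)` and `(1, c)`, which would be negative if the matrix were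
negative definite. -/
theorem pos_of_det_pos_of_trace_pos {a b d c : ℝ} (hc : 1 < c) (hdet : 0 < a * d - b ^ 2)
    (htr : 0 < c * (a + d) + 2 * b) : 0 < a := by
  by_contra! ha
  have hb := sq_nonneg b
  have hd : d < 0 := by
    by_contra! h
    have := mul_nonneg_of_nonpos_of_nonpos ha (neg_nonpos.2 h)
    linarith
  have h4 : (2 * b) ^ 2 < (-(a + d)) ^ 2 := by linarith [sq_nonneg (a - d)]
  have h5 : 2 * b < -(a + d) := lt_of_pow_lt_pow_left₀ 2 (by linarith) h4
  have h6 : 0 < (c - 1) * -(a + d) := mul_pos (by linarith) (by linarith)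
  linarith

/-- The third weight may be negative. Eliminating `x₃` leaves a 2×2 Schur complement whose
determinant has the sign of the cubic. Its sign of definiteness is read off from the derivative of
the cubic in `y₃`. -/
theorem hyperbolicForm_pos_of_neg {c₁ c₂ c₃ v₁ v₂ v₃ y₁ y₂ y₃ : ℝ} (h₁ : 1 < c₁) (h₂ : 1 < c₂)
    (h₃ : 1 < c₃) (hA : 0 < 1 + 2 * (c₁ * c₂ * c₃) - c₁ ^ 2 - c₂ ^ 2 - c₃ ^ 2)
    (hy₁ : y₁ = v₁ * (c₁ ^ 2 - 1)) (hy₂ : y₂ = v₂ * (c₂ ^ 2 - 1)) (hy₃ : y₃ = v₃ * (c₃ ^ 2 - 1))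
    (p₁ : 0 < y₁) (p₂ : 0 < y₂)
    (hC₁ : 0 < y₁ + c₃ * y₂ + c₂ * y₃) (hC₂ : 0 < c₃ * y₁ + y₂ + c₁ * y₃)
    (hΦ : 0 < hyperbolicCubic c₁ c₂ c₃ y₁ y₂ y₃) {x₁ x₂ x₃ : ℝ}
    (hx : x₁ ≠ 0 ∨ x₂ ≠ 0 ∨ x₃ ≠ 0) : 0 < hyperbolicForm c₁ c₂ c₃ v₁ v₂ v₃ x₁ x₂ x₃ := by
  have c₁pos : 0 < c₁ := by linarith
  have c₂pos : 0 < c₂ := by linarith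
  have s₁ : 0 < c₁ ^ 2 - 1 := by nlinarith
  have s₂ : 0 < c₂ ^ 2 - 1 := by nlinarith
  have s₃ : 0 < c₃ ^ 2 - 1 := by nlinarith
  -- the cubic becomes nonpositive when `y₃` decreases
  obtain ⟨t, ht, hle⟩ : ∃ t > 0, hyperbolicCubic c₁ c₂ c₃ y₁ y₂ (y₃ - t) ≤ 0 := by
    -- `t` is the first amount of decrease of `y₃` at which one of the linear forms in `hC₁`, `hC₂`
    -- vanishes.
    rcases le_total ((y₁ + c₃ * y₂ + c₂ * y₃) / c₂) ((c₃ * y₁ + y₂ + c₁ * y₃) / c₁) with h | h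
    · refine ⟨(y₁ + c₃ * y₂ + c₂ * y₃) / c₂, by positivity,
        hyperbolicCubic_nonpos h₁ h₂ hA p₁ p₂ (by field_simp; ring) ?_⟩
      rw [le_div_iff₀ c₁pos] at h
      linarith
    · have sym : ∀ z, hyperbolicCubic c₁ c₂ c₃ y₁ y₂ z = hyperbolicCubic c₂ c₁ c₃ y₂ y₁ z :=
        fun z => by unfold hyperbolicCubic; ring
      refine ⟨(c₃ * y₁ + y₂ + c₁ * y₃) / c₁, by positivity, ?_⟩
      rw [sym]
      refine hyperbolicCubic_nonpos h₂ h₁ (by linarith) p₂ p₁ (by field_simp; ring) ?_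
      rw [le_div_iff₀ c₂pos] at h
      linarith
  have a0 : 0 < (c₂ ^ 2 - 1) * (c₁ * y₁) + (c₁ ^ 2 - 1) * (c₂ * y₂) := by positivity
  -- This is the derivative of the cubic in `y₃`. The cubic is a convex quadratic in `y₃`, positive
  -- at `y₃` and nonpositive at `y₃ - t`, so it is increasing at `y₃`.
  have hd : 0 < c₃ * ((c₂ ^ 2 - 1) * y₁ ^ 2 + (c₁ ^ 2 - 1) * y₂ ^ 2)
      + 2 * (c₁ * c₂ * c₃ - 1) * (y₁ * y₂)
      + 2 * y₃ * ((c₂ ^ 2 - 1) * (c₁ * y₁) + (c₁ ^ 2 - 1) * (c₂ * y₂)) := by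
    have e : hyperbolicCubic c₁ c₂ c₃ y₁ y₂ y₃ - hyperbolicCubic c₁ c₂ c₃ y₁ y₂ (y₃ - t)
      = t * (c₃ * ((c₂ ^ 2 - 1) * y₁ ^ 2 + (c₁ ^ 2 - 1) * y₂ ^ 2)
      + 2 * (c₁ * c₂ * c₃ - 1) * (y₁ * y₂)
      + 2 * y₃ * ((c₂ ^ 2 - 1) * (c₁ * y₁) + (c₁ ^ 2 - 1) * (c₂ * y₂)))
      - t ^ 2 * ((c₂ ^ 2 - 1) * (c₁ * y₁) + (c₁ ^ 2 - 1) * (c₂ * y₂)) := by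
      unfold hyperbolicCubic
      ring
    have : 0 < t ^ 2 * ((c₂ ^ 2 - 1) * (c₁ * y₁) + (c₁ ^ 2 - 1) * (c₂ * y₂)) := by positivity
    exact pos_of_mul_pos_right (a := t) (by linarith) ht.le
  have v₁pos : 0 < v₁ := pos_of_mul_pos_left (hy₁ ▸ p₁) s₁.le
  have v₂pos : 0 < v₂ := pos_of_mul_pos_left (hy₂ ▸ p₂) s₂.le
  set p := c₁ * v₁ + c₂ * v₂ with hp
  have ppos : 0 < p := by positivity
  set S₁₁ := p * (c₂ * v₂ + c₃ * v₃) - v₂ ^ 2 with hS₁₁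
  set S₂₂ := p * (c₁ * v₁ + c₃ * v₃) - v₁ ^ 2 with hS₂₂
  set S₁₂ := -(v₃ * p + v₁ * v₂) with hS₁₂
  -- The weighted trace of the Schur complement is a positive multiple of the derivative in `hd`,
  -- which explains the coefficient `c₃`.
  have htr : 0 < c₃ * (S₁₁ + S₂₂) + 2 * S₁₂ := by
    have e : (c₁ ^ 2 - 1) * (c₂ ^ 2 - 1) * (c₃ * (S₁₁ + S₂₂) + 2 * S₁₂)
      = c₃ * ((c₂ ^ 2 - 1) * y₁ ^ 2 + (c₁ ^ 2 - 1) * y₂ ^ 2)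
      + 2 * (c₁ * c₂ * c₃ - 1) * (y₁ * y₂)
      + 2 * y₃ * ((c₂ ^ 2 - 1) * (c₁ * y₁) + (c₁ ^ 2 - 1) * (c₂ * y₂)) := by
      rw [hS₁₁, hS₂₂, hS₁₂, hp, hy₁, hy₂, hy₃]
      ring
    exact pos_of_mul_pos_right (a := (c₁ ^ 2 - 1) * (c₂ ^ 2 - 1)) (by rw [e]; exact hd)
      (by positivity)
  have hdet : 0 < S₁₁ * S₂₂ - S₁₂ ^ 2 := by
    have e : (c₁ ^ 2 - 1) * (c₂ ^ 2 - 1) * (c₃ ^ 2 - 1) * (S₁₁ * S₂₂ - S₁₂ ^ 2)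
      = p * hyperbolicCubic c₁ c₂ c₃ y₁ y₂ y₃ := by
      rw [hS₁₁, hS₂₂, hS₁₂, hp, hy₁, hy₂, hy₃]
      unfold hyperbolicCubic
      ring
    exact pos_of_mul_pos_right (a := (c₁ ^ 2 - 1) * (c₂ ^ 2 - 1) * (c₃ ^ 2 - 1))
      (by rw [e]; positivity) (by positivity)
  have hS : 0 < S₁₁ :=
    pos_of_det_pos_of_trace_pos h₃ hdet htr
  have hform : p * hyperbolicForm c₁ c₂ c₃ v₁ v₂ v₃ x₁ x₂ x₃
      = (p * x₃ - (v₁ * x₂ + v₂ * x₁)) ^ 2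
        + (S₁₁ * x₁ ^ 2 + 2 * S₁₂ * x₁ * x₂ + S₂₂ * x₂ ^ 2) := by
    rw [hS₁₁, hS₂₂, hS₁₂, hp]
    unfold hyperbolicForm
    ring
  have hform₂ : S₁₁ * (S₁₁ * x₁ ^ 2 + 2 * S₁₂ * x₁ * x₂ + S₂₂ * x₂ ^ 2)
      = (S₁₁ * x₁ + S₁₂ * x₂) ^ 2 + (S₁₁ * S₂₂ - S₁₂ ^ 2) * x₂ ^ 2 := by ring
  have hdet_mul : ∀ z ≠ 0, 0 < (S₁₁ * S₂₂ - S₁₂ ^ 2) * z ^ 2 := fun z hz =>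
    mul_pos hdet (by positivity)
  refine pos_of_mul_pos_right (a := p) ?_ ppos.le
  rw [hform]
  by_cases hx₂ : x₂ = 0
  · by_cases hx₁ : x₁ = 0
    · have hx₃ : x₃ ≠ 0 := by tauto
      rw [hx₁, hx₂]
      have : 0 < (p * x₃) ^ 2 := by positivity
      linarith only [this]
    · rw [hx₂]
      have : 0 < S₁₁ * x₁ ^ 2 := by positivity
      linarith only [this, sq_nonneg (p * x₃ - (v₁ * 0 + v₂ * x₁))]
  · have : 0 < S₁₁ * x₁ ^ 2 + 2 * S₁₂ * x₁ * x₂ + S₂₂ * x₂ ^ 2 := by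
      refine pos_of_mul_pos_right (a := S₁₁) ?_ hS.le
      rw [hform₂]
      have := hdet_mul x₂ hx₂
      positivity
    positivity

theorem hyperbolicForm_rotate (c₁ c₂ c₃ v₁ v₂ v₃ x₁ x₂ x₃ : ℝ) :
    hyperbolicForm c₁ c₂ c₃ v₁ v₂ v₃ x₁ x₂ x₃ = hyperbolicForm c₂ c₃ c₁ v₂ v₃ v₁ x₂ x₃ x₁ := by
  unfold hyperbolicForm
  ring

theorem hyperbolicCubic_rotate (c₁ c₂ c₃ y₁ y₂ y₃ : ℝ) :
    hyperbolicCubic c₁ c₂ c₃ y₁ y₂ y₃ = hyperbolicCubic c₂ c₃ c₁ y₂ y₃ y₁ := by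
  unfold hyperbolicCubic
  ring

end TriangleAlgebra

/-! ### Derivatives of the angles of one triangle. -/

section AngleDerivative

variable {E : Type*} [NormedAddCommGroup E] [NormedSpace ℝ E]

theorem abs_div_sqrt_lt_one {P D : ℝ} (hD : 0 < D) (hA : 0 < D - P ^ 2) : |P / √D| < 1 := by
  rw [abs_div, abs_of_pos (Real.sqrt_pos.2 hD), div_lt_one (Real.sqrt_pos.2 hD)]
  exact Real.lt_sqrt_of_sq_lt (by rw [sq_abs]; linarith)

/-- With the cosine written as `P / √D`, the derivative has the denominator `√(D - P ^ 2)`. For the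
angles of a triangle `D - P ^ 2` is `heron` or `hyperbolicGram`, the same for all three corners. -/
theorem hasFDerivAt_arccos_div_sqrt {P D : E → ℝ} {P' D' : E →L[ℝ] ℝ} {x : E}
    (hP : HasFDerivAt P P' x) (hD : HasFDerivAt D D' x) (hD0 : 0 < D x)
    (hA : 0 < D x - P x ^ 2) :
    HasFDerivAt (fun y => Real.arccos (P y / √(D y)))
      (-((√(D x - P x ^ 2))⁻¹ • (P' - (P x / (2 * D x)) • D'))) x := by
  have hlt := abs_lt.1 (abs_div_sqrt_lt_one hD0 hA)
  have hs : 0 < √(D x) := Real.sqrt_pos.2 hD0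
  have h1 : HasFDerivAt (fun y => P y / √(D y)) _ x :=
    (hP.mul ((hasDerivAt_inv hs.ne').comp_hasFDerivAt x (hD.sqrt hD0.ne'))).congr_of_eventuallyEq
      (.of_forall fun y => div_eq_mul_inv _ _)
  have h2 := (Real.hasDerivAt_arccos hlt.1.ne' hlt.2.ne).comp_hasFDerivAt x h1
  refine h2.congr_fderiv ?_
  have e : √(1 - (P x / √(D x)) ^ 2) = √(D x - P x ^ 2) / √(D x) := by
    rw [← Real.sqrt_div' _ hD0.le, div_pow, Real.sq_sqrt hD0.le]
    congr 1
    field_simp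
  have hA' : 0 < √(D x - P x ^ 2) := Real.sqrt_pos.2 hA
  have hsq : √(D x) ^ 2 = D x := Real.sq_sqrt hD0.le
  ext y
  simp only [smul_apply, sub_apply, add_apply, neg_apply, smul_eq_mul, Function.comp_apply]
  rw [e]
  set s := √(D x) with hsdef
  rw [← hsq]
  field_simp
  ring

theorem contDiffAt_arccos_div_sqrt {P D : E → ℝ} {x : E} {n : WithTop ℕ∞}
    (hP : ContDiffAt ℝ n P x) (hD : ContDiffAt ℝ n D x) (hD0 : 0 < D x)
    (hA : 0 < D x - P x ^ 2) : ContDiffAt ℝ n (fun y => Real.arccos (P y / √(D y))) x := by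
  have hlt := abs_lt.1 (abs_div_sqrt_lt_one hD0 hA)
  exact ContDiffAt.comp (g := Real.arccos) x (Real.contDiffAt_arccos hlt.1.ne' hlt.2.ne)
    (hP.div (hD.sqrt hD0.ne') (Real.sqrt_ne_zero'.2 hD0))

/-- `4` times the squared area of a Euclidean triangle with squared side lengths `a`, `b`, `c`. -/
noncomputable def heron (a b c : ℝ) : ℝ := (2 * a * b + 2 * b * c + 2 * c * a - a ^ 2 - b ^ 2 - c ^ 2) / 4

/-- The Gram determinant of the vertices of a hyperbolic triangle whose sides have the hyperbolic
cosines `a`, `b`, `c`. -/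
def hyperbolicGram (a b c : ℝ) : ℝ := 1 + 2 * (a * b * c) - a ^ 2 - b ^ 2 - c ^ 2

theorem heron_rotate (a b c : ℝ) : heron a b c = heron b c a := by unfold heron; ring

theorem hyperbolicGram_rotate (a b c : ℝ) : hyperbolicGram a b c = hyperbolicGram b c a := by
  unfold hyperbolicGram; ring

/-- Proportional to the distance of the radical centre from the first side of a Euclidean triangle
with squared side lengths `a`, `b`, `c` and squared radii `p`, `q`, `r`. -/
noncomputable def euclideanHeight (a b c p q r : ℝ) : ℝ :=
  (2 * a * (c + q - p) - (a + q - r) * (c + a - b)) / 4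

/-- The hyperbolic analogue of `euclideanHeight`, in terms of hyperbolic cosines. -/
def hyperbolicHeight (a b c p q r : ℝ) : ℝ :=
  (a * b - c) * q + (a * c - b) * r - (a ^ 2 - 1) * p

/-- The derivative of the angle at one end of the first side with respect to the coordinate at the
other end. One weight serves both ends of a side, which makes the Jacobian symmetric; the same holds
for `hyperbolicWeight`. -/
noncomputable def euclideanWeight (a b c p q r : ℝ) : ℝ :=
  euclideanHeight a b c p q r / (a * √(heron a b c))

noncomputable def hyperbolicWeight (a b c p q r : ℝ) : ℝ :=
  hyperbolicHeight a b c p q r / ((a ^ 2 - 1) * √(hyperbolicGram a b c))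

/-- The coefficients in `h₁`, `h₂`, `h₃` result from eliminating `η` in favour of the squared
length. That only differences `l₂ - l₁`, `l₃ - l₁` survive reflects scaling invariance. -/
theorem hasFDerivAt_euclidean_angle {Q₁ Q₂ Q₃ : E → ℝ} {l₁ l₂ l₃ : E →L[ℝ] ℝ} {x : E}
    {a b c p q r : ℝ} (ha : Q₁ x = a) (hb : Q₂ x = b) (hc : Q₃ x = c)
    (h₁ : HasFDerivAt Q₁ ((a + q - r) • l₂ + (a + r - q) • l₃) x)
    (h₂ : HasFDerivAt Q₂ ((b + r - p) • l₃ + (b + p - r) • l₁) x)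
    (h₃ : HasFDerivAt Q₃ ((c + p - q) • l₁ + (c + q - p) • l₂) x)
    (b0 : 0 < b) (c0 : 0 < c) (hA : 0 < heron a b c) :
    HasFDerivAt (fun y => Real.arccos ((Q₂ y + Q₃ y - Q₁ y) / 2 / √(Q₂ y * Q₃ y)))
      (euclideanWeight c a b r p q • (l₂ - l₁) + euclideanWeight b c a q r p • (l₃ - l₁)) x := by
  have e : b * c - ((b + c - a) / 2) ^ 2 = heron a b c := by unfold heron; ring
  have hP : HasFDerivAt (fun y => (Q₂ y + Q₃ y - Q₁ y) / 2) _ x :=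
    (((h₂.add h₃).sub h₁).mul_const (2 : ℝ)⁻¹).congr_of_eventuallyEq
      (.of_forall fun y => div_eq_mul_inv _ _)
  have hD : HasFDerivAt (fun y => Q₂ y * Q₃ y) _ x := h₂.mul h₃
  have hD0 : 0 < Q₂ x * Q₃ x := by rw [hb, hc]; positivity
  refine (hasFDerivAt_arccos_div_sqrt hP hD hD0 (by rw [ha, hb, hc, e]; exact hA)).congr_fderiv ?_
  have g : heron b c a = heron a b c := (heron_rotate a b c).symm
  have hs : 0 < √(heron a b c) := Real.sqrt_pos.2 hA
  ext y
  simp only [euclideanWeight, euclideanHeight, heron_rotate c a b, g, e, ha, hb, hc,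
    smul_apply, sub_apply,
    add_apply, neg_apply, smul_eq_mul]
  set s := √(heron a b c)
  field_simp
  ring

theorem hasFDerivAt_hyperbolic_angle {X₁ X₂ X₃ : E → ℝ} {l₁ l₂ l₃ : E →L[ℝ] ℝ} {x : E}
    {a b c p q r : ℝ} (ha : X₁ x = a) (hb : X₂ x = b) (hc : X₃ x = c)
    (h₁ : HasFDerivAt X₁ ((q * a - r) • l₂ + (r * a - q) • l₃) x)
    (h₂ : HasFDerivAt X₂ ((r * b - p) • l₃ + (p * b - r) • l₁) x)
    (h₃ : HasFDerivAt X₃ ((p * c - q) • l₁ + (q * c - p) • l₂) x)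
    (b0 : 1 < b) (c0 : 1 < c) (hA : 0 < hyperbolicGram a b c) :
    HasFDerivAt (fun y => Real.arccos ((X₂ y * X₃ y - X₁ y) / √((X₂ y ^ 2 - 1) * (X₃ y ^ 2 - 1))))
      (hyperbolicWeight c a b r p q • (l₂ - c • l₁) +
        hyperbolicWeight b c a q r p • (l₃ - b • l₁)) x := by
  have e : (b ^ 2 - 1) * (c ^ 2 - 1) - (b * c - a) ^ 2 = hyperbolicGram a b c := by
    unfold hyperbolicGram; ring
  have sb : 0 < b ^ 2 - 1 := by nlinarith
  have sc : 0 < c ^ 2 - 1 := by nlinarith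
  have hP : HasFDerivAt (fun y => X₂ y * X₃ y - X₁ y) _ x := (h₂.mul h₃).sub h₁
  have hD : HasFDerivAt (fun y => (X₂ y ^ 2 - 1) * (X₃ y ^ 2 - 1)) _ x :=
    ((h₂.pow 2).sub_const 1).mul ((h₃.pow 2).sub_const 1)
  have hD0 : 0 < (X₂ x ^ 2 - 1) * (X₃ x ^ 2 - 1) := by rw [hb, hc]; positivity
  refine (hasFDerivAt_arccos_div_sqrt hP hD hD0 (by rw [ha, hb, hc, e]; exact hA)).congr_fderiv ?_
  have g : hyperbolicGram b c a = hyperbolicGram a b c := (hyperbolicGram_rotate a b c).symm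
  have hs : 0 < √(hyperbolicGram a b c) := Real.sqrt_pos.2 hA
  ext y
  simp only [hyperbolicWeight, hyperbolicHeight, hyperbolicGram_rotate c a b, g, e,
    ha, hb, hc, smul_apply, sub_apply,
    add_apply, neg_apply, smul_eq_mul]
  set s := √(hyperbolicGram a b c)
  field_simp
  ring

end AngleDerivative

/-! ### Definiteness of the angle Jacobian of one triangle. -/

section TriangleDefiniteness

variable {ε₁ ε₂ ε₃ η₁ η₂ η₃ r₁ r₂ r₃ : ℝ}

theorem euclidean_weights_form_nonneg
    (hε₁ : ε₁ = 0 ∨ ε₁ = 1) (hε₂ : ε₂ = 0 ∨ ε₂ = 1) (hε₃ : ε₃ = 0 ∨ ε₃ = 1)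
    (he₁ : 0 < ε₂ * ε₃ + η₁) (he₂ : 0 < ε₃ * ε₁ + η₂) (he₃ : 0 < ε₁ * ε₂ + η₃)
    (hγ₁ : 0 ≤ ε₁ * η₁ + η₂ * η₃) (hγ₂ : 0 ≤ ε₂ * η₂ + η₃ * η₁) (hγ₃ : 0 ≤ ε₃ * η₃ + η₁ * η₂)
    (h₁ : 0 < r₁) (h₂ : 0 < r₂) (h₃ : 0 < r₃) {a b c p q r w₁ w₂ w₃ : ℝ}
    (hp : p = ε₁ * r₁ ^ 2) (hq : q = ε₂ * r₂ ^ 2) (hr : r = ε₃ * r₃ ^ 2)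
    (ha : a = q + r + 2 * η₁ * (r₂ * r₃)) (hb : b = r + p + 2 * η₂ * (r₃ * r₁))
    (hc : c = p + q + 2 * η₃ * (r₁ * r₂)) (a0 : 0 < a) (b0 : 0 < b) (c0 : 0 < c)
    (hA : 0 < heron a b c)
    (hw₁ : w₁ = euclideanWeight a b c p q r) (hw₂ : w₂ = euclideanWeight b c a q r p)
    (hw₃ : w₃ = euclideanWeight c a b r p q) (x₁ x₂ x₃ : ℝ) :
    0 ≤ w₁ * (x₂ - x₃) ^ 2 + w₂ * (x₃ - x₁) ^ 2 + w₃ * (x₁ - x₂) ^ 2 ∧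
    (w₁ * (x₂ - x₃) ^ 2 + w₂ * (x₃ - x₁) ^ 2 + w₃ * (x₁ - x₂) ^ 2 = 0 → x₁ = x₂ ∧ x₂ = x₃) := by
  set s := √(heron a b c) with hs
  have s0 : 0 < s := Real.sqrt_pos.2 hA
  have ssq : s ^ 2 = heron a b c := Real.sq_sqrt hA.le
  have e₁ : w₁ = euclideanHeight a b c p q r / (a * s) := hw₁
  have e₂ : w₂ = euclideanHeight b c a q r p / (b * s) := by
    rw [hw₂, euclideanWeight, ← heron_rotate]
  have e₃ : w₃ = euclideanHeight c a b r p q / (c * s) := by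
    rw [hw₃, euclideanWeight, heron_rotate]
  -- The three heights add up to `heron a b c`: the radical centre cuts the triangle into three
  -- triangles of signed area.
  have hsum : 0 < w₁ * a + w₂ * b + w₃ * c := by
    have : w₁ * a + w₂ * b + w₃ * c = s := by
      have h : euclideanHeight a b c p q r + euclideanHeight b c a q r p
        + euclideanHeight c a b r p q = s ^ 2 := by
        rw [ssq]; unfold euclideanHeight heron; ring
      rw [e₁, e₂, e₃]
      field_simp
      linarith
    rw [this]; exact s0
  have hW : 0 < w₁ * w₂ + w₂ * w₃ + w₃ * w₁ := by
    have T := conformal_det_pos hε₁ hε₂ hε₃ he₁ he₂ he₃ hγ₁ hγ₂ hγ₃ h₁ h₂ h₃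
    have h : euclideanHeight a b c p q r * euclideanHeight b c a q r p * c
        + euclideanHeight b c a q r p * euclideanHeight c a b r p q * a
        + euclideanHeight c a b r p q * euclideanHeight a b c p q r * b
        = r₁ * r₂ * r₃ * heron a b c * (2 * (ε₁ * ε₂ * ε₃ + η₁ * η₂ * η₃) * (r₁ * r₂ * r₃)
      + (ε₁ * η₁ + η₂ * η₃) * r₁ * (ε₂ * r₂ ^ 2 + ε₃ * r₃ ^ 2)
      + (ε₂ * η₂ + η₃ * η₁) * r₂ * (ε₃ * r₃ ^ 2 + ε₁ * r₁ ^ 2)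
      + (ε₃ * η₃ + η₁ * η₂) * r₃ * (ε₁ * r₁ ^ 2 + ε₂ * r₂ ^ 2)) := by
      rw [ha, hb, hc, hp, hq, hr]
      unfold euclideanHeight heron
      ring
    have e : w₁ * w₂ + w₂ * w₃ + w₃ * w₁ =
        (euclideanHeight a b c p q r * euclideanHeight b c a q r p * c
        + euclideanHeight b c a q r p * euclideanHeight c a b r p q * a
        + euclideanHeight c a b r p q * euclideanHeight a b c p q r * b) / (a * b * c * s ^ 2) := by
      rw [e₁, e₂, e₃]
      field_simp
    rw [e, h]
    exact div_pos (mul_pos (by positivity) T) (by positivity)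
  -- The roles are rotated, so that the lemma yields `0 < w₂ + w₃`.
  refine euclidean_form_nonneg (euclidean_weights_add_pos (w₃ := w₁) (a := b) (b := c) (c := a) b0 ?_
    (by linarith) (by linarith) a0) hW x₁ x₂ x₃
  unfold heron at hA
  linarith

/-- At most one `yₖ` is nonpositive. If one is negative, it is rotated into the third place for
`hyperbolicForm_pos_of_neg`; otherwise two weights are positive and the third is nonnegative. -/
theorem hyperbolicForm_pos_of_cubic_pos {a b c v₁ v₂ v₃ y₁ y₂ y₃ : ℝ}
    (a1 : 1 < a) (b1 : 1 < b) (c1 : 1 < c) (hA : 0 < hyperbolicGram a b c)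
    (z₁ : y₁ = v₁ * (a ^ 2 - 1)) (z₂ : y₂ = v₂ * (b ^ 2 - 1)) (z₃ : y₃ = v₃ * (c ^ 2 - 1))
    (M₁' : 0 < y₁ + c * y₂ + b * y₃) (M₂' : 0 < c * y₁ + y₂ + a * y₃)
    (M₃' : 0 < b * y₁ + a * y₂ + y₃) (hΦ : 0 < hyperbolicCubic a b c y₁ y₂ y₃)
    (i₁₂ : y₁ ≤ 0 → y₂ ≤ 0 → False) (i₂₃ : y₂ ≤ 0 → y₃ ≤ 0 → False)
    (i₃₁ : y₃ ≤ 0 → y₁ ≤ 0 → False) {x₁ x₂ x₃ : ℝ}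
    (hx : x₁ ≠ 0 ∨ x₂ ≠ 0 ∨ x₃ ≠ 0) : 0 < hyperbolicForm a b c v₁ v₂ v₃ x₁ x₂ x₃ := by
  have sa : 0 < a ^ 2 - 1 := by nlinarith only [a1]
  have sb : 0 < b ^ 2 - 1 := by nlinarith only [b1]
  have sc : 0 < c ^ 2 - 1 := by nlinarith only [c1]
  have hx₁ : x₂ ≠ 0 ∨ x₃ ≠ 0 ∨ x₁ ≠ 0 := by tauto
  have hx₂ : x₃ ≠ 0 ∨ x₁ ≠ 0 ∨ x₂ ≠ 0 := by tauto
  have G₁ : 0 < 1 + 2 * (a * b * c) - a ^ 2 - b ^ 2 - c ^ 2 := hA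
  rcases lt_or_ge y₁ 0 with n₁ | n₁
  · have p₂ : 0 < y₂ := not_le.1 fun h => i₁₂ n₁.le h
    have p₃ : 0 < y₃ := not_le.1 fun h => i₃₁ h n₁.le
    rw [hyperbolicForm_rotate]
    rw [hyperbolicCubic_rotate] at hΦ
    exact hyperbolicForm_pos_of_neg b1 c1 a1 (by linarith only [G₁]) z₂ z₃ z₁ p₂ p₃
      (by linarith only [M₂']) (by linarith only [M₃']) hΦ hx₁
  rcases lt_or_ge y₂ 0 with n₂ | n₂
  · have p₁ : 0 < y₁ := not_le.1 fun h => i₁₂ h n₂.le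
    have p₃ : 0 < y₃ := not_le.1 fun h => i₂₃ n₂.le h
    rw [hyperbolicForm_rotate, hyperbolicForm_rotate]
    rw [hyperbolicCubic_rotate, hyperbolicCubic_rotate] at hΦ
    exact hyperbolicForm_pos_of_neg c1 a1 b1 (by linarith only [G₁]) z₃ z₁ z₂ p₃ p₁
      (by linarith only [M₃']) (by linarith only [M₁']) hΦ hx₂
  rcases lt_or_ge y₃ 0 with n₃ | n₃
  · have p₁ : 0 < y₁ := not_le.1 fun h => i₃₁ n₃.le h
    have p₂ : 0 < y₂ := not_le.1 fun h => i₂₃ h n₃.le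
    exact hyperbolicForm_pos_of_neg a1 b1 c1 G₁ z₁ z₂ z₃ p₁ p₂ M₁' M₂' hΦ hx
  have P : ∀ {y v t : ℝ}, y = v * t → 0 < t → 0 < y → 0 < v := fun h ht hy =>
    pos_of_mul_pos_left (h ▸ hy) ht.le
  have N : ∀ {y v t : ℝ}, y = v * t → 0 < t → 0 ≤ y → 0 ≤ v := fun h ht hy =>
    nonneg_of_mul_nonneg_left (h ▸ hy) ht
  rcases n₁.eq_or_lt with q₁ | q₁
  · have p₂ : 0 < y₂ := not_le.1 fun h => i₁₂ q₁.symm.le h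
    have p₃ : 0 < y₃ := not_le.1 fun h => i₃₁ h q₁.symm.le
    rw [hyperbolicForm_rotate]
    exact hyperbolicForm_pos_of_nonneg b1 c1 a1 (P z₂ sb p₂) (P z₃ sc p₃) (N z₁ sa n₁)
      hx₁
  rcases n₂.eq_or_lt with q₂ | q₂
  · have p₃ : 0 < y₃ := not_le.1 fun h => i₂₃ q₂.symm.le h
    rw [hyperbolicForm_rotate, hyperbolicForm_rotate]
    exact hyperbolicForm_pos_of_nonneg c1 a1 b1 (P z₃ sc p₃) (P z₁ sa q₁) (N z₂ sb n₂)
      hx₂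
  exact hyperbolicForm_pos_of_nonneg a1 b1 c1 (P z₁ sa q₁) (P z₂ sb q₂) (N z₃ sc n₃) hx

theorem hyperbolic_weights_form_pos {C₁ C₂ C₃ : ℝ}
    (hε₁ : ε₁ = 0 ∨ ε₁ = 1) (hε₂ : ε₂ = 0 ∨ ε₂ = 1) (hε₃ : ε₃ = 0 ∨ ε₃ = 1)
    (he₁ : 0 < ε₂ * ε₃ + η₁) (he₂ : 0 < ε₃ * ε₁ + η₂) (he₃ : 0 < ε₁ * ε₂ + η₃)
    (hγ₁ : 0 ≤ ε₁ * η₁ + η₂ * η₃) (hγ₂ : 0 ≤ ε₂ * η₂ + η₃ * η₁) (hγ₃ : 0 ≤ ε₃ * η₃ + η₁ * η₂)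
    (h₁ : 0 < r₁) (h₂ : 0 < r₂) (h₃ : 0 < r₃) (k₁ : 0 < C₁) (k₂ : 0 < C₂) (k₃ : 0 < C₃)
    (m₁ : C₁ ^ 2 - ε₁ * r₁ ^ 2 = 1) (m₂ : C₂ ^ 2 - ε₂ * r₂ ^ 2 = 1) (m₃ : C₃ ^ 2 - ε₃ * r₃ ^ 2 = 1)
    {a b c w₁ w₂ w₃ : ℝ} (ha : a = C₂ * C₃ + η₁ * (r₂ * r₃)) (hb : b = C₃ * C₁ + η₂ * (r₃ * r₁))
    (hc : c = C₁ * C₂ + η₃ * (r₁ * r₂)) (a1 : 1 < a) (b1 : 1 < b) (c1 : 1 < c)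
    (hA : 0 < hyperbolicGram a b c)
    (hw₁ : w₁ = hyperbolicWeight a b c C₁ C₂ C₃) (hw₂ : w₂ = hyperbolicWeight b c a C₂ C₃ C₁)
    (hw₃ : w₃ = hyperbolicWeight c a b C₃ C₁ C₂) {x₁ x₂ x₃ : ℝ}
    (hx : x₁ ≠ 0 ∨ x₂ ≠ 0 ∨ x₃ ≠ 0) : 0 < hyperbolicForm a b c w₁ w₂ w₃ x₁ x₂ x₃ := by
  set s := √(hyperbolicGram a b c) with hs
  have s0 : 0 < s := Real.sqrt_pos.2 hA
  have sa : 0 < a ^ 2 - 1 := by nlinarith only [a1]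
  have sb : 0 < b ^ 2 - 1 := by nlinarith only [b1]
  have sc : 0 < c ^ 2 - 1 := by nlinarith only [c1]
  set y₁ := hyperbolicHeight a b c C₁ C₂ C₃ with hy₁
  set y₂ := hyperbolicHeight b c a C₂ C₃ C₁ with hy₂
  set y₃ := hyperbolicHeight c a b C₃ C₁ C₂ with hy₃
  set v₁ := y₁ / (a ^ 2 - 1) with hv₁
  set v₂ := y₂ / (b ^ 2 - 1) with hv₂
  set v₃ := y₃ / (c ^ 2 - 1) with hv₃
  have e₁ : w₁ = v₁ / s := by rw [hw₁, hyperbolicWeight, hv₁, div_div]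
  have e₂ : w₂ = v₂ / s := by
    rw [hw₂, hyperbolicWeight, ← hyperbolicGram_rotate, hv₂, div_div]
  have e₃ : w₃ = v₃ / s := by
    rw [hw₃, hyperbolicWeight, hyperbolicGram_rotate, hv₃, div_div]
  have hform : hyperbolicForm a b c w₁ w₂ w₃ x₁ x₂ x₃
      = hyperbolicForm a b c v₁ v₂ v₃ x₁ x₂ x₃ / s := by
    rw [e₁, e₂, e₃]; unfold hyperbolicForm; ring
  rw [hform]
  refine div_pos ?_ s0
  -- the cubic is positive
  have hΦ : 0 < hyperbolicCubic a b c y₁ y₂ y₃ := by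
    -- The variables are `rᵢ / Cᵢ`: after `n₁`–`n₃'` the cubic is the expression of
    -- `conformal_det_pos` in these quotients, up to positive factors.
    have T := conformal_det_pos hε₁ hε₂ hε₃ he₁ he₂ he₃ hγ₁ hγ₂ hγ₃ (div_pos h₁ k₁)
      (div_pos h₂ k₂) (div_pos h₃ k₃)
    have n₁ : C₂ * a - C₃ = r₂ * (ε₂ * r₂ * C₃ + η₁ * r₃ * C₂) := by
      rw [ha]; linear_combination C₃ * m₂
    have n₂ : C₃ * b - C₁ = r₃ * (ε₃ * r₃ * C₁ + η₂ * r₁ * C₃) := by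
      rw [hb]; linear_combination C₁ * m₃
    have n₃ : C₁ * c - C₂ = r₁ * (ε₁ * r₁ * C₂ + η₃ * r₂ * C₁) := by
      rw [hc]; linear_combination C₂ * m₁
    have n₁' : C₃ * a - C₂ = r₃ * (ε₃ * r₃ * C₂ + η₁ * r₂ * C₃) := by
      rw [ha]; linear_combination C₂ * m₃
    have n₂' : C₁ * b - C₃ = r₁ * (ε₁ * r₁ * C₃ + η₂ * r₃ * C₁) := by
      rw [hb]; linear_combination C₃ * m₁
    have n₃' : C₂ * c - C₁ = r₂ * (ε₂ * r₂ * C₁ + η₃ * r₁ * C₂) := by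
      rw [hc]; linear_combination C₁ * m₂
    have h : hyperbolicCubic a b c y₁ y₂ y₃ = hyperbolicGram a b c ^ 2 *
        ((C₂ * a - C₃) * (C₃ * b - C₁) * (C₁ * c - C₂)
          + (C₃ * a - C₂) * (C₁ * b - C₃) * (C₂ * c - C₁)) := by
      rw [hy₁, hy₂, hy₃]
      unfold hyperbolicCubic hyperbolicHeight hyperbolicGram
      ring
    rw [h, n₁, n₂, n₃, n₁', n₂', n₃']
    refine mul_pos (by positivity) ?_
    have : 0 < r₁ * r₂ * r₃ * (C₁ * C₂ * C₃) ^ 2 := by positivity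
    refine (mul_pos this T).trans_eq ?_
    field_simp
    ring
  -- inverting the definition of the heights
  have M₁ : y₁ + c * y₂ + b * y₃ = hyperbolicGram a b c * C₁ := by
    rw [hy₁, hy₂, hy₃]; unfold hyperbolicHeight hyperbolicGram; ring
  have M₂ : c * y₁ + y₂ + a * y₃ = hyperbolicGram a b c * C₂ := by
    rw [hy₁, hy₂, hy₃]; unfold hyperbolicHeight hyperbolicGram; ring
  have M₃ : b * y₁ + a * y₂ + y₃ = hyperbolicGram a b c * C₃ := by
    rw [hy₁, hy₂, hy₃]; unfold hyperbolicHeight hyperbolicGram; ring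
  have M₁' : 0 < y₁ + c * y₂ + b * y₃ := by rw [M₁]; positivity
  have M₂' : 0 < c * y₁ + y₂ + a * y₃ := by rw [M₂]; positivity
  have M₃' : 0 < b * y₁ + a * y₂ + y₃ := by rw [M₃]; positivity
  -- at most one height is nonpositive
  set K₁ := r₂ * r₃ * C₁ with hK₁
  set K₂ := r₃ * r₁ * C₂ with hK₂
  set K₃ := r₁ * r₂ * C₃ with hK₃
  have K₁0 : 0 < K₁ := by positivity
  have K₂0 : 0 < K₂ := by positivity
  have K₃0 : 0 < K₃ := by positivity
  set H₁ := (ε₂ * ε₃ - η₁ ^ 2) * K₁ + (ε₃ * η₃ + η₁ * η₂) * K₂ + (ε₂ * η₂ + η₃ * η₁) * K₃ with hH₁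
  set H₂ := (ε₃ * ε₁ - η₂ ^ 2) * K₂ + (ε₁ * η₁ + η₂ * η₃) * K₃ + (ε₃ * η₃ + η₁ * η₂) * K₁ with hH₂
  set H₃ := (ε₁ * ε₂ - η₃ ^ 2) * K₃ + (ε₂ * η₂ + η₃ * η₁) * K₁ + (ε₁ * η₁ + η₂ * η₃) * K₂ with hH₃
  set D := ε₁ * ε₂ * ε₃ - 2 * (η₁ * η₂ * η₃) - ε₁ * η₁ ^ 2 - ε₂ * η₂ ^ 2 - ε₃ * η₃ ^ 2 with hD
  -- The Gram matrix of the vertices is `C Cᵀ - R A R` with `R = diag(r₁, r₂, r₃)` and `A` as in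
  -- `not_two_nonpos`. The heights form the vector `adj(C Cᵀ - R A R) C`, which equals `adj(R A R)
  -- C`. Replacing each `1` by `Cᵢ ^ 2 - εᵢ * rᵢ ^ 2` turns this into a polynomial identity.
  have f₁ : y₁ = r₂ * r₃ * H₁ := by
    have : y₁ = (a * b - c * (C₃ ^ 2 - ε₃ * r₃ ^ 2)) * C₂ + (a * c - b * (C₂ ^ 2 - ε₂ * r₂ ^ 2)) * C₃
        - (a ^ 2 - (C₂ ^ 2 - ε₂ * r₂ ^ 2) * (C₃ ^ 2 - ε₃ * r₃ ^ 2)) * C₁ := by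
      rw [m₂, m₃, hy₁]; unfold hyperbolicHeight; ring
    rw [this, ha, hb, hc, hH₁, hK₁, hK₂, hK₃]
    ring
  have f₂ : y₂ = r₃ * r₁ * H₂ := by
    have : y₂ = (b * c - a * (C₁ ^ 2 - ε₁ * r₁ ^ 2)) * C₃ + (b * a - c * (C₃ ^ 2 - ε₃ * r₃ ^ 2)) * C₁
        - (b ^ 2 - (C₃ ^ 2 - ε₃ * r₃ ^ 2) * (C₁ ^ 2 - ε₁ * r₁ ^ 2)) * C₂ := by
      rw [m₃, m₁, hy₂]; unfold hyperbolicHeight; ring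
    rw [this, ha, hb, hc, hH₂, hK₁, hK₂, hK₃]
    ring
  have f₃ : y₃ = r₁ * r₂ * H₃ := by
    have : y₃ = (c * a - b * (C₂ ^ 2 - ε₂ * r₂ ^ 2)) * C₁ + (c * b - a * (C₁ ^ 2 - ε₁ * r₁ ^ 2)) * C₂
        - (c ^ 2 - (C₁ ^ 2 - ε₁ * r₁ ^ 2) * (C₂ ^ 2 - ε₂ * r₂ ^ 2)) * C₃ := by
      rw [m₁, m₂, hy₃]; unfold hyperbolicHeight; ring
    rw [this, ha, hb, hc, hH₃, hK₁, hK₂, hK₃]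
    ring
  -- The matrix determinant lemma for the same rank-one perturbation.
  have gram : hyperbolicGram a b c
      = K₁ * H₁ + K₂ * H₂ + K₃ * H₃ - (r₁ * r₂ * r₃) ^ 2 * D := by
    have : hyperbolicGram a b c = (C₁ ^ 2 - ε₁ * r₁ ^ 2) * (C₂ ^ 2 - ε₂ * r₂ ^ 2)
        * (C₃ ^ 2 - ε₃ * r₃ ^ 2) + 2 * (a * b * c) - (C₁ ^ 2 - ε₁ * r₁ ^ 2) * a ^ 2
        - (C₂ ^ 2 - ε₂ * r₂ ^ 2) * b ^ 2 - (C₃ ^ 2 - ε₃ * r₃ ^ 2) * c ^ 2 := by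
      rw [m₁, m₂, m₃]; unfold hyperbolicGram; ring
    rw [this, ha, hb, hc, hH₁, hH₂, hH₃, hK₁, hK₂, hK₃, hD]
    ring
  have hsum : 0 ≤ D → 0 < K₁ * H₁ + K₂ * H₂ + K₃ * H₃ := fun h => by
    have := mul_nonneg (sq_nonneg (r₁ * r₂ * r₃)) h
    linarith only [this, gram, hA]
  have r23 : 0 < r₂ * r₃ := by positivity
  have r31 : 0 < r₃ * r₁ := by positivity
  have r12 : 0 < r₁ * r₂ := by positivity
  have i₁₂ : y₁ ≤ 0 → y₂ ≤ 0 → False := fun u v =>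
    not_two_nonpos hε₁ hε₂ hε₃ he₁ he₂ he₃ hγ₁ hγ₂ hγ₃ K₁0 K₂0 K₃0 hH₁ hH₂ hH₃ hD hsum
      (nonpos_of_mul_nonpos_right (f₁ ▸ u) r23) (nonpos_of_mul_nonpos_right (f₂ ▸ v) r31)
  have i₂₃ : y₂ ≤ 0 → y₃ ≤ 0 → False := fun u v =>
    not_two_nonpos hε₂ hε₃ hε₁ he₂ he₃ he₁ hγ₂ hγ₃ hγ₁ K₂0 K₃0 K₁0 hH₂ hH₃ hH₁
      (D := D) (by rw [hD]; ring) (fun h => by linarith only [hsum h])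
      (nonpos_of_mul_nonpos_right (f₂ ▸ u) r31) (nonpos_of_mul_nonpos_right (f₃ ▸ v) r12)
  have i₃₁ : y₃ ≤ 0 → y₁ ≤ 0 → False := fun u v =>
    not_two_nonpos hε₃ hε₁ hε₂ he₃ he₁ he₂ hγ₃ hγ₁ hγ₂ K₃0 K₁0 K₂0 hH₃ hH₁ hH₂
      (D := D) (by rw [hD]; ring) (fun h => by linarith only [hsum h])
      (nonpos_of_mul_nonpos_right (f₃ ▸ u) r12) (nonpos_of_mul_nonpos_right (f₁ ▸ v) r23)
  exact hyperbolicForm_pos_of_cubic_pos a1 b1 c1 hA (by rw [hv₁]; field_simp)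
    (by rw [hv₂]; field_simp) (by rw [hv₃]; field_simp) M₁' M₂' M₃' hΦ i₁₂ i₂₃ i₃₁ hx

end TriangleDefiniteness

/-! ### The coordinates `u`, positivity of lengths, and openness of the admissible set. -/

section Coordinates

open Topology

namespace Background

/-- The range of the coordinate `u`. -/
def coordDomain (ε : ℝ) : Background → Set ℝ
  | euclidean => Set.univ
  | hyperbolic => {u | ε = 1 → u < 0}

theorem isOpen_coordDomain (ε : ℝ) (G : Background) : IsOpen (G.coordDomain ε) := by
  cases G with
  | euclidean => exact isOpen_univ
  | hyperbolic =>
    by_cases h : ε = 1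
    · simpa [coordDomain, h] using! isOpen_Iio (a := (0 : ℝ))
    · simp [coordDomain, h]

theorem coord_mem_coordDomain (G : Background) (ε f : ℝ) : G.coord ε f ∈ G.coordDomain ε := by
  cases G with
  | euclidean => trivial
  | hyperbolic =>
    rintro rfl
    have hE : 0 < Real.exp (2 * f) := Real.exp_pos _
    have hC : 1 < √(1 + 1 * Real.exp (2 * f)) := by
      rw [Real.lt_sqrt (by norm_num)]
      linarith
    simp only [coord, one_ne_zero, if_false]
    set C := √(1 + 1 * Real.exp (2 * f))
    have h0 : 0 < (C - 1) / (C + 1) := div_pos (by linarith) (by linarith)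
    rw [abs_of_pos h0]
    have : Real.log ((C - 1) / (C + 1)) < 0 :=
      Real.log_neg h0 ((div_lt_one (by linarith)).2 (by linarith))
    linarith

theorem exp_factor_hyperbolic_one {u : ℝ} (hu : u < 0) :
    Real.exp (hyperbolic.factor 1 u) = (-Real.sinh u)⁻¹ := by
  have : 0 < -Real.sinh u := neg_pos.2 (Real.sinh_neg_iff.2 hu)
  simp only [factor, one_ne_zero, if_false]
  rw [Real.exp_neg, Real.exp_log this]

theorem sqrt_one_add_sq_exp_factor {u : ℝ} (hu : u < 0) :
    √(1 + 1 * Real.exp (hyperbolic.factor 1 u) ^ 2) = Real.cosh u * (-Real.sinh u)⁻¹ := by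
  have hs : 0 < -Real.sinh u := neg_pos.2 (Real.sinh_neg_iff.2 hu)
  rw [exp_factor_hyperbolic_one hu, Real.sqrt_eq_iff_mul_self_eq_of_pos
    (mul_pos (Real.cosh_pos u) (inv_pos.2 hs))]
  have hs' : Real.sinh u ≠ 0 := (neg_pos.1 hs).ne
  field_simp
  rw [Real.cosh_sq u]

theorem coord_factor {ε : ℝ} (hε : ε = 0 ∨ ε = 1) (G : Background) {u : ℝ}
    (hu : u ∈ G.coordDomain ε) : G.coord ε (G.factor ε u) = u := by
  cases G with
  | euclidean => rfl
  | hyperbolic =>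
    rcases hε with rfl | rfl
    · simp [factor, coord]
    · have hu0 : u < 0 := hu rfl
      have hs : 0 < -Real.sinh u := neg_pos.2 (Real.sinh_neg_iff.2 hu0)
      have h2 : Real.exp (2 * hyperbolic.factor 1 u) = Real.exp (hyperbolic.factor 1 u) ^ 2 := by
        rw [two_mul, Real.exp_add, sq]
      have hs' : Real.sinh u ≠ 0 := (neg_pos.1 hs).ne
      simp only [coord, one_ne_zero, if_false]
      rw [h2, sqrt_one_add_sq_exp_factor hu0]
      have e : (Real.cosh u * (-Real.sinh u)⁻¹ - 1) / (Real.cosh u * (-Real.sinh u)⁻¹ + 1)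
          = Real.exp (2 * u) := by
        have h3 : Real.cosh u * (-Real.sinh u)⁻¹ - 1 = Real.exp u * (-Real.sinh u)⁻¹ := by
          rw [← Real.cosh_add_sinh]; field_simp; ring
        have h4 : Real.cosh u * (-Real.sinh u)⁻¹ + 1 = Real.exp (-u) * (-Real.sinh u)⁻¹ := by
          rw [← Real.cosh_sub_sinh]; field_simp; ring
        rw [h3, h4, mul_div_mul_right _ _ (inv_pos.2 hs).ne', ← Real.exp_sub]
        ring_nf
      rw [e, abs_of_pos (Real.exp_pos _), Real.log_exp]
      ring

theorem contDiffAt_factor {ε : ℝ} (hε : ε = 0 ∨ ε = 1) (G : Background) {u : ℝ}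
    (hu : u ∈ G.coordDomain ε) {n : WithTop ℕ∞} : ContDiffAt ℝ n (fun u => G.factor ε u) u := by
  cases G with
  | euclidean => exact contDiffAt_id
  | hyperbolic =>
    rcases hε with rfl | rfl
    · simpa [factor] using! contDiffAt_id
    · have hs : 0 < -Real.sinh u := neg_pos.2 (Real.sinh_neg_iff.2 (hu rfl))
      simp only [factor, one_ne_zero, if_false]
      exact (Real.contDiff_sinh.contDiffAt.neg.log hs.ne').neg

theorem hasDerivAt_exp_factor_euclidean (ε u : ℝ) :
    HasDerivAt (fun u => Real.exp (euclidean.factor ε u)) (Real.exp (euclidean.factor ε u)) u :=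
  Real.hasDerivAt_exp u

/-- For `ρ = exp f` this is `dρ/du = ρ * √(1 + ε * ρ ^ 2)`. It explains the choice of `u`: with it
the derivatives in `hasFDerivAt_coshLength` involve only hyperbolic cosines, and the angle Jacobian
becomes symmetric. -/
theorem hasDerivAt_exp_factor_hyperbolic {ε : ℝ} (hε : ε = 0 ∨ ε = 1) {u : ℝ}
    (hu : u ∈ hyperbolic.coordDomain ε) :
    HasDerivAt (fun u => Real.exp (hyperbolic.factor ε u))
      (Real.exp (hyperbolic.factor ε u) * √(1 + ε * Real.exp (hyperbolic.factor ε u) ^ 2)) u := by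
  rcases hε with rfl | rfl
  · simpa [factor] using Real.hasDerivAt_exp u
  · have hu0 : u < 0 := hu rfl
    have hs : 0 < -Real.sinh u := neg_pos.2 (Real.sinh_neg_iff.2 hu0)
    rw [sqrt_one_add_sq_exp_factor hu0, exp_factor_hyperbolic_one hu0]
    have h := ((Real.hasDerivAt_sinh u).neg).inv hs.ne'
    refine (h.congr_of_eventuallyEq ?_).congr_deriv ?_
    · filter_upwards [Iio_mem_nhds hu0] with v hv
      exact exp_factor_hyperbolic_one hv
    · simp only [Pi.neg_apply]
      field_simp

end Background

namespace WeightedTriangulation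

open Background

variable {F : Type*} (W : WeightedTriangulation F)

/-- The exponential of the conformal factor, as a function of the coordinates. -/
noncomputable def radius (G : Background) (u : W.V → ℝ) (i : W.V) : ℝ :=
  Real.exp (G.factor (W.ε i) (u i))

/-- The squared length of a side in terms of the radii, in the Euclidean background geometry. -/
noncomputable def sqLength (ρ : W.V → ℝ) (s : F × Fin 3) : ℝ :=
  W.ε (W.startVertex s) * ρ (W.startVertex s) ^ 2 + W.ε (W.endVertex s) * ρ (W.endVertex s) ^ 2
    + 2 * W.η (W.edge s) * (ρ (W.startVertex s) * ρ (W.endVertex s))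

/-- The hyperbolic cosine of a radius, for scheme coefficient `1`. -/
noncomputable def coshRadius (ρ : W.V → ℝ) (i : W.V) : ℝ := √(1 + W.ε i * ρ i ^ 2)

/-- The hyperbolic cosine of the length of a side in terms of the radii, in the hyperbolic
background geometry. -/
noncomputable def coshLength (ρ : W.V → ℝ) (s : F × Fin 3) : ℝ :=
  W.coshRadius ρ (W.startVertex s) * W.coshRadius ρ (W.endVertex s)
    + W.η (W.edge s) * (ρ (W.startVertex s) * ρ (W.endVertex s))

variable {W}

theorem one_le_coshRadius (hε : ∀ i, W.ε i = 0 ∨ W.ε i = 1) (ρ : W.V → ℝ) (i : W.V) :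
    1 ≤ W.coshRadius ρ i := by
  rw [coshRadius, Real.one_le_sqrt]
  rcases hε i with h | h <;> rw [h]
  · simp
  · linarith [sq_nonneg (ρ i)]

theorem coshRadius_sq (hε : ∀ i, W.ε i = 0 ∨ W.ε i = 1) (ρ : W.V → ℝ) (i : W.V) :
    W.coshRadius ρ i ^ 2 - W.ε i * ρ i ^ 2 = 1 := by
  rw [coshRadius, Real.sq_sqrt]
  · ring
  · rcases hε i with h | h <;> rw [h]
    · simp
    · linarith [sq_nonneg (ρ i)]

/-- With both coefficients `1` it equals `(a - b) ^ 2 + 2 * (1 + η) * a * b`; otherwise `η > 0`.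
Lengths are thus positive even where the triangle inequalities fail. -/
theorem sqLength_pos (hε : ∀ i, W.ε i = 0 ∨ W.ε i = 1) (h1 : W.StructureCondition1) {ρ : W.V → ℝ}
    (hρ : ∀ i, 0 < ρ i) (s : F × Fin 3) : 0 < W.sqLength ρ s := by
  have h := h1 s
  have ha := hρ (W.startVertex s)
  have hb := hρ (W.endVertex s)
  unfold sqLength
  set a := ρ (W.startVertex s)
  set b := ρ (W.endVertex s)
  have hab := mul_pos h (mul_pos ha hb)
  rcases hε (W.startVertex s) with h2 | h2 <;> rcases hε (W.endVertex s) with h3 | h3 <;>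
    rw [h2, h3] at hab ⊢ <;> nlinarith [sq_nonneg (a - b), sq_nonneg a, sq_nonneg b]

theorem one_lt_coshLength (hε : ∀ i, W.ε i = 0 ∨ W.ε i = 1) (h1 : W.StructureCondition1)
    {ρ : W.V → ℝ} (hρ : ∀ i, 0 < ρ i) (s : F × Fin 3) : 1 < W.coshLength ρ s := by
  have h := h1 s
  have ha := hρ (W.startVertex s)
  have hb := hρ (W.endVertex s)
  have ca := one_le_coshRadius hε ρ (W.startVertex s)
  have cb := one_le_coshRadius hε ρ (W.endVertex s)
  have sa := coshRadius_sq hε ρ (W.startVertex s)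
  have sb := coshRadius_sq hε ρ (W.endVertex s)
  unfold coshLength
  set a := ρ (W.startVertex s)
  set b := ρ (W.endVertex s)
  set A := W.coshRadius ρ (W.startVertex s)
  set B := W.coshRadius ρ (W.endVertex s)
  have hab := mul_pos h (mul_pos ha hb)
  -- When both coefficients are `1` this is the Cauchy–Schwarz inequality `(1 + a * b) ^ 2 ≤ (1 + a
  -- ^ 2) * (1 + b ^ 2)`.
  have key : 1 + W.ε (W.startVertex s) * W.ε (W.endVertex s) * (a * b) ≤ A * B := by
    rcases hε (W.startVertex s) with h2 | h2
    · rw [h2]; nlinarith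
    · rcases hε (W.endVertex s) with h3 | h3
      · rw [h3]; nlinarith
      · rw [h2] at sa ⊢
        rw [h3] at sb ⊢
        refine abs_le_of_sq_le_sq' ?_ (by positivity) |>.2
        have : (A * B) ^ 2 = (1 + a ^ 2) * (1 + b ^ 2) := by
          rw [mul_pow, ← show A ^ 2 = 1 + a ^ 2 by linarith, ← show B ^ 2 = 1 + b ^ 2 by linarith]
        rw [this]
        nlinarith [sq_nonneg (a - b)]
  nlinarith

theorem radius_pos (G : Background) (u : W.V → ℝ) (i : W.V) : 0 < W.radius G u i := Real.exp_pos _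

theorem length_euclidean (u : W.V → ℝ) (s : F × Fin 3) :
    W.length euclidean (fun i => euclidean.factor (W.ε i) (u i)) s
      = √(W.sqLength (W.radius euclidean u) s) := by
  have e : ∀ x : ℝ, Real.exp (2 * x) = Real.exp x ^ 2 := fun x => by rw [two_mul, Real.exp_add, sq]
  simp only [length, edgeLength, sqLength, radius, e, Real.exp_add]

theorem length_hyperbolic (hε : ∀ i, W.ε i = 0 ∨ W.ε i = 1) (u : W.V → ℝ) (s : F × Fin 3) :
    W.length hyperbolic (fun i => hyperbolic.factor (W.ε i) (u i)) s
      = Real.arcosh (W.coshLength (W.radius hyperbolic u) s) := by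
  have e : ∀ x : ℝ, Real.exp (2 * x) = Real.exp x ^ 2 := fun x => by rw [two_mul, Real.exp_add, sq]
  have p : 0 ≤ 1 + W.ε (W.startVertex s) * W.radius hyperbolic u (W.startVertex s) ^ 2 := by
    rcases hε (W.startVertex s) with h | h <;> rw [h] <;> positivity
  simp only [length, edgeLength, coshLength, coshRadius, e, Real.exp_add, ← Real.sqrt_mul p]
  rfl

theorem fin_three_add (k : Fin 3) :
    k + 1 + 1 = k + 2 ∧ k + 1 + 2 = k ∧ k + 2 + 1 = k ∧ k + 2 + 2 = k + 1 := by
  revert k; decide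

/-- The angle in a Euclidean triangle in terms of squared side lengths. -/
theorem cornerAngle_euclidean (hε : ∀ i, W.ε i = 0 ∨ W.ε i = 1) (h1 : W.StructureCondition1)
    (u : W.V → ℝ) (t : F) (k : Fin 3) :
    W.cornerAngle euclidean (fun i => euclidean.factor (W.ε i) (u i)) (t, k)
      = Real.arccos ((W.sqLength (W.radius euclidean u) (t, k + 1)
          + W.sqLength (W.radius euclidean u) (t, k + 2)
          - W.sqLength (W.radius euclidean u) (t, k)) / 2 /
          √(W.sqLength (W.radius euclidean u) (t, k + 1)
            * W.sqLength (W.radius euclidean u) (t, k + 2))) := by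
  have hp := fun s => (sqLength_pos hε h1 (radius_pos (W := W) euclidean u) s).le
  simp only [cornerAngle, angle, length_euclidean, Real.sq_sqrt (hp _), Real.sqrt_mul (hp _)]
  rw [div_div, mul_assoc]

/-- The angle in a hyperbolic triangle in terms of the hyperbolic cosines of side lengths. -/
theorem cornerAngle_hyperbolic (hε : ∀ i, W.ε i = 0 ∨ W.ε i = 1) (h1 : W.StructureCondition1)
    (u : W.V → ℝ) (t : F) (k : Fin 3) :
    W.cornerAngle hyperbolic (fun i => hyperbolic.factor (W.ε i) (u i)) (t, k)
      = Real.arccos ((W.coshLength (W.radius hyperbolic u) (t, k + 1)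
          * W.coshLength (W.radius hyperbolic u) (t, k + 2)
          - W.coshLength (W.radius hyperbolic u) (t, k)) /
          √((W.coshLength (W.radius hyperbolic u) (t, k + 1) ^ 2 - 1)
            * (W.coshLength (W.radius hyperbolic u) (t, k + 2) ^ 2 - 1))) := by
  have hp := fun s => one_lt_coshLength hε h1 (radius_pos (W := W) hyperbolic u) s
  have hs : ∀ s, 0 ≤ W.coshLength (W.radius hyperbolic u) s ^ 2 - 1 := fun s => by
    nlinarith [hp s]
  simp only [cornerAngle, angle, length_hyperbolic hε, Real.cosh_arcosh (hp _).le,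
    Real.sinh_arcosh (hp _).le, Real.sqrt_mul (hs _)]

/-- The admissible coordinates. -/
theorem mem_admissible_iff (hε : ∀ i, W.ε i = 0 ∨ W.ε i = 1) (G : Background) (u : W.V → ℝ) :
    u ∈ W.admissible G ↔ (∀ i, u i ∈ G.coordDomain (W.ε i)) ∧
      W.IsDCS G (fun i => G.factor (W.ε i) (u i)) := by
  constructor
  · rintro ⟨f, hf, rfl⟩
    refine ⟨fun i => coord_mem_coordDomain _ _ _, ?_⟩
    simpa [factor_coord G (hε _)] using hf
  · rintro ⟨h, h'⟩
    exact ⟨_, h', funext fun i => coord_factor (hε i) G (h i)⟩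

theorem heron_pos_of_mem_admissible (hε : ∀ i, W.ε i = 0 ∨ W.ε i = 1)
    (h1 : W.StructureCondition1) {u : W.V → ℝ} (hu : u ∈ W.admissible euclidean) (t : F)
    (k : Fin 3) : 0 < heron (W.sqLength (W.radius euclidean u) (t, k))
      (W.sqLength (W.radius euclidean u) (t, k + 1))
      (W.sqLength (W.radius euclidean u) (t, k + 2)) := by
  obtain ⟨-, -, htri⟩ := (mem_admissible_iff hε _ _).1 hu
  have hp := fun s => sqLength_pos hε h1 (radius_pos (W := W) euclidean u) s
  obtain ⟨e₁, e₂, e₃, e₄⟩ := fin_three_add k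
  have t₁ := htri t k
  have t₂ := htri t (k + 1)
  have t₃ := htri t (k + 2)
  simp only [length_euclidean, e₁, e₂, e₃, e₄] at t₁ t₂ t₃
  have p₁ := Real.sqrt_pos.2 (hp (t, k))
  have p₂ := Real.sqrt_pos.2 (hp (t, k + 1))
  have p₃ := Real.sqrt_pos.2 (hp (t, k + 2))
  have q₁ := Real.sq_sqrt (hp (t, k)).le
  have q₂ := Real.sq_sqrt (hp (t, k + 1)).le
  have q₃ := Real.sq_sqrt (hp (t, k + 2)).le
  rw [← q₁, ← q₂, ← q₃]
  generalize √(W.sqLength (W.radius euclidean u) (t, k)) = a at *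
  generalize √(W.sqLength (W.radius euclidean u) (t, k + 1)) = b at *
  generalize √(W.sqLength (W.radius euclidean u) (t, k + 2)) = c at *
  have : heron (a ^ 2) (b ^ 2) (c ^ 2) = (a + b + c) * (b + c - a) * ((c + a - b) * (a + b - c)) / 4
    := by unfold heron; ring
  rw [this]
  have m₁ : 0 < b + c - a := by linarith
  have m₂ : 0 < c + a - b := by linarith
  have m₃ : 0 < a + b - c := by linarith
  positivity

/-- The hyperbolic counterpart of Heron's factorization: both factors are positive exactly under the
strict triangle inequalities. -/
theorem hyperbolicGram_cosh (a b c : ℝ) :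
    hyperbolicGram (Real.cosh a) (Real.cosh b) (Real.cosh c)
      = (Real.cosh (b + c) - Real.cosh a) * (Real.cosh a - Real.cosh (b - c)) := by
  rw [Real.cosh_add, Real.cosh_sub]
  have hb := Real.sinh_sq b
  have hc := Real.sinh_sq c
  unfold hyperbolicGram
  linear_combination (-Real.sinh c ^ 2) * hb - (Real.cosh b ^ 2 - 1) * hc

theorem hyperbolicGram_pos_of_mem_admissible (hε : ∀ i, W.ε i = 0 ∨ W.ε i = 1)
    (h1 : W.StructureCondition1) {u : W.V → ℝ} (hu : u ∈ W.admissible hyperbolic) (t : F)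
    (k : Fin 3) : 0 < hyperbolicGram (W.coshLength (W.radius hyperbolic u) (t, k))
      (W.coshLength (W.radius hyperbolic u) (t, k + 1))
      (W.coshLength (W.radius hyperbolic u) (t, k + 2)) := by
  obtain ⟨-, -, htri⟩ := (mem_admissible_iff hε _ _).1 hu
  have hp := fun s => one_lt_coshLength hε h1 (radius_pos (W := W) hyperbolic u) s
  obtain ⟨e₁, e₂, e₃, e₄⟩ := fin_three_add k
  have t₁ := htri t k
  have t₂ := htri t (k + 1)
  have t₃ := htri t (k + 2)
  simp only [length_hyperbolic hε, e₁, e₂, e₃, e₄] at t₁ t₂ t₃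
  have p₁ := Real.arcosh_pos (hp (t, k))
  have p₂ := Real.arcosh_pos (hp (t, k + 1))
  have p₃ := Real.arcosh_pos (hp (t, k + 2))
  rw [← Real.cosh_arcosh (hp (t, k)).le, ← Real.cosh_arcosh (hp (t, k + 1)).le,
    ← Real.cosh_arcosh (hp (t, k + 2)).le, hyperbolicGram_cosh]
  refine mul_pos (sub_pos.2 ?_) (sub_pos.2 ?_)
  · rw [Real.cosh_lt_cosh, abs_of_pos p₁, abs_of_pos (by linarith)]
    exact t₁
  · rw [Real.cosh_lt_cosh, abs_of_pos p₁, abs_lt]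
    constructor <;> linarith

theorem isOpen_admissible [Finite F] (hε : ∀ i, W.ε i = 0 ∨ W.ε i = 1)
    (h1 : W.StructureCondition1) {G : Background} {u : W.V → ℝ} (hu : u ∈ W.admissible G) :
    W.admissible G ∈ 𝓝 u := by
  obtain ⟨hdom, hpos, htri⟩ := (mem_admissible_iff hε _ _).1 hu
  have hd : ∀ᶠ v in 𝓝 u, ∀ i, v i ∈ G.coordDomain (W.ε i) := Filter.eventually_all.2 fun i =>
    (continuous_apply i).continuousAt.eventually_mem ((isOpen_coordDomain _ G).mem_nhds (hdom i))
  have hr : ∀ i, ContinuousAt (fun v => W.radius G v i) u := fun i =>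
    (ContinuousAt.comp (f := fun v : W.V → ℝ => v i) (g := fun x => G.factor (W.ε i) x)
      (contDiffAt_factor (hε i) G (hdom i) (n := 0)).continuousAt
      (continuous_apply i).continuousAt).rexp
  have hl : ∀ s, ContinuousAt (fun v : W.V → ℝ =>
      W.length G (fun i => G.factor (W.ε i) (v i)) s) u := by
    intro s
    cases G with
    | euclidean =>
      simp only [length_euclidean]
      refine ContinuousAt.sqrt ?_
      unfold sqLength
      have := hr (W.startVertex s)
      have := hr (W.endVertex s)
      fun_prop
    | hyperbolic =>
      simp only [length_hyperbolic hε]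
      have hX : ContinuousAt (fun v => W.coshLength (W.radius hyperbolic v) s) u := by
        unfold coshLength coshRadius
        have := hr (W.startVertex s)
        have := hr (W.endVertex s)
        fun_prop
      exact ContinuousAt.comp (g := Real.arcosh) (Real.differentiableAt_arcosh
        (one_lt_coshLength hε h1 (radius_pos hyperbolic u) s)).continuousAt hX
  have h2 : ∀ᶠ v in 𝓝 u, ∀ s, 0 < W.length G (fun i => G.factor (W.ε i) (v i)) s :=
    Filter.eventually_all.2 fun s => (hl s).eventually (lt_mem_nhds (hpos s))
  have h3 : ∀ᶠ v in 𝓝 u, ∀ t k, W.length G (fun i => G.factor (W.ε i) (v i)) (t, k)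
      < W.length G (fun i => G.factor (W.ε i) (v i)) (t, k + 1)
        + W.length G (fun i => G.factor (W.ε i) (v i)) (t, k + 2) :=
    Filter.eventually_all.2 fun t => Filter.eventually_all.2 fun k =>
      (hl _).eventually_lt ((hl _).add (hl _)) (htri t k)
  filter_upwards [hd, h2, h3] with v a b c
  exact (mem_admissible_iff hε _ _).2 ⟨a, b, c⟩

end WeightedTriangulation

end Coordinates

/-! ### Smoothness of the angles and their derivatives on the triangulated surface. -/

section Angles

open Topology

namespace WeightedTriangulation

open Background

variable {F : Type*} {W : WeightedTriangulation F}

/-- The coordinate `u i` as a linear functional. -/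
noncomputable def evalAt (i : W.V) : (W.V → ℝ) →L[ℝ] ℝ := ContinuousLinearMap.proj i

@[simp] theorem evalAt_apply (i : W.V) (x : W.V → ℝ) : evalAt i x = x i := rfl

theorem StructureCondition1.vertex (h1 : W.StructureCondition1) (t : F) (k : Fin 3) :
    0 < W.ε (W.vertex (t, k + 1)) * W.ε (W.vertex (t, k + 2)) + W.η (W.edge (t, k)) := h1 (t, k)

variable [Finite F]

theorem contDiffAt_radius (hε : ∀ i, W.ε i = 0 ∨ W.ε i = 1) {G : Background} {u : W.V → ℝ}
    (hu : u ∈ W.admissible G) {n : WithTop ℕ∞} (i : W.V) :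
    ContDiffAt ℝ n (fun v => W.radius G v i) u := by
  have hdom := ((mem_admissible_iff hε _ _).1 hu).1
  exact (ContDiffAt.comp (f := fun v : W.V → ℝ => v i) (g := fun x => G.factor (W.ε i) x) u
    (contDiffAt_factor (hε i) G (hdom i)) (contDiff_apply ℝ ℝ i).contDiffAt).exp

theorem contDiffAt_sqLength (hε : ∀ i, W.ε i = 0 ∨ W.ε i = 1) {G : Background} {u : W.V → ℝ}
    (hu : u ∈ W.admissible G) {n : WithTop ℕ∞} (s : F × Fin 3) :
    ContDiffAt ℝ n (fun v => W.sqLength (W.radius G v) s) u := by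
  have ha := contDiffAt_radius hε hu (n := n) (W.startVertex s)
  have hb := contDiffAt_radius hε hu (n := n) (W.endVertex s)
  unfold sqLength
  fun_prop

theorem contDiffAt_coshLength (hε : ∀ i, W.ε i = 0 ∨ W.ε i = 1) {G : Background} {u : W.V → ℝ}
    (hu : u ∈ W.admissible G) {n : WithTop ℕ∞} (s : F × Fin 3) :
    ContDiffAt ℝ n (fun v => W.coshLength (W.radius G v) s) u := by
  have hr := fun i => contDiffAt_radius hε hu (n := n) i
  have hc : ∀ i, ContDiffAt ℝ n (fun v => W.coshRadius (W.radius G v) i) u := fun i => by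
    unfold coshRadius
    refine (contDiffAt_const.add (contDiffAt_const.mul ((hr i).pow 2))).sqrt ?_
    rcases hε i with h | h <;> rw [h] <;> positivity
  exact ((hc _).mul (hc _)).add (contDiffAt_const.mul ((hr _).mul (hr _)))

theorem contDiffAt_cornerAngle (hε : ∀ i, W.ε i = 0 ∨ W.ε i = 1) (h1 : W.StructureCondition1)
    {G : Background} {u : W.V → ℝ} (hu : u ∈ W.admissible G) {n : WithTop ℕ∞} (c : F × Fin 3) :
    ContDiffAt ℝ n (fun v : W.V → ℝ => W.cornerAngle G (fun i => G.factor (W.ε i) (v i)) c) u := by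
  obtain ⟨t, k⟩ := c
  cases G with
  | euclidean =>
    simp only [cornerAngle_euclidean hε h1]
    have h := fun s => contDiffAt_sqLength hε hu (n := n) s
    have hp := fun s => sqLength_pos hε h1 (radius_pos (W := W) euclidean u) s
    refine contDiffAt_arccos_div_sqrt ((((h _).add (h _)).sub (h _)).div_const 2)
      ((h _).mul (h _)) (mul_pos (hp _) (hp _)) ?_
    refine (heron_pos_of_mem_admissible hε h1 hu t k).trans_eq ?_
    unfold heron
    ring
  | hyperbolic =>
    simp only [cornerAngle_hyperbolic hε h1]
    have h := fun s => contDiffAt_coshLength hε hu (n := n) s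
    have hp := fun s => one_lt_coshLength hε h1 (radius_pos (W := W) hyperbolic u) s
    have hs : ∀ s, 0 < W.coshLength (W.radius hyperbolic u) s ^ 2 - 1 := fun s => by
      nlinarith [hp s]
    refine contDiffAt_arccos_div_sqrt (((h _).mul (h _)).sub (h _))
      ((((h _).pow 2).sub contDiffAt_const).mul (((h _).pow 2).sub contDiffAt_const))
      (mul_pos (hs _) (hs _)) ?_
    refine (hyperbolicGram_pos_of_mem_admissible hε h1 hu t k).trans_eq ?_
    unfold hyperbolicGram
    ring

/-- Abstracting the squared radii as `p` puts the derivative in the form that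
`hasFDerivAt_euclidean_angle` takes, with the indices still symbolic in `k`. -/
theorem hasFDerivAt_sqLength {u : W.V → ℝ} (t : F) (k : Fin 3) {p : Fin 3 → ℝ}
    (hp : ∀ j, p j = W.ε (W.vertex (t, j)) * W.radius euclidean u (W.vertex (t, j)) ^ 2) :
    HasFDerivAt (fun v => W.sqLength (W.radius euclidean v) (t, k))
      ((W.sqLength (W.radius euclidean u) (t, k) + p (k + 1) - p (k + 2))
          • evalAt (W.vertex (t, k + 1))
        + (W.sqLength (W.radius euclidean u) (t, k) + p (k + 2) - p (k + 1))
          • evalAt (W.vertex (t, k + 2))) u := by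
  have hr : ∀ i, HasFDerivAt (fun v => W.radius euclidean v i)
      (W.radius euclidean u i • evalAt i) u := fun i =>
    (hasDerivAt_exp_factor_euclidean (W.ε i) (u i)).comp_hasFDerivAt (f := fun v : W.V → ℝ => v i)
      u (evalAt i).hasFDerivAt
  have ha := hr (W.vertex (t, k + 1))
  have hb := hr (W.vertex (t, k + 2))
  refine (((ha.pow 2).const_mul (W.ε (W.vertex (t, k + 1)))).add
    ((hb.pow 2).const_mul (W.ε (W.vertex (t, k + 2)))) |>.add
    ((ha.mul hb).const_mul (2 * W.η (W.edge (t, k))))).congr_fderiv ?_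
  have e : W.sqLength (W.radius euclidean u) (t, k) = p (k + 1) + p (k + 2)
      + 2 * W.η (W.edge (t, k)) * (W.radius euclidean u (W.vertex (t, k + 1))
        * W.radius euclidean u (W.vertex (t, k + 2))) := by rw [hp, hp]; rfl
  rw [e, hp, hp]
  ext y
  simp only [add_apply, smul_apply, smul_eq_mul, nsmul_eq_mul, evalAt_apply]
  push_cast
  ring

theorem hasFDerivAt_coshLength (hε : ∀ i, W.ε i = 0 ∨ W.ε i = 1) {u : W.V → ℝ}
    (hu : u ∈ W.admissible hyperbolic) (t : F) (k : Fin 3) {p : Fin 3 → ℝ}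
    (hp : ∀ j, p j = W.coshRadius (W.radius hyperbolic u) (W.vertex (t, j))) :
    HasFDerivAt (fun v => W.coshLength (W.radius hyperbolic v) (t, k))
      ((p (k + 1) * W.coshLength (W.radius hyperbolic u) (t, k) - p (k + 2))
          • evalAt (W.vertex (t, k + 1))
        + (p (k + 2) * W.coshLength (W.radius hyperbolic u) (t, k) - p (k + 1))
          • evalAt (W.vertex (t, k + 2))) u := by
  have hdom := ((mem_admissible_iff hε _ _).1 hu).1
  have hr : ∀ i, HasFDerivAt (fun v => W.radius hyperbolic v i)
      ((W.radius hyperbolic u i * W.coshRadius (W.radius hyperbolic u) i) • evalAt i) u := fun i =>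
    (hasDerivAt_exp_factor_hyperbolic (hε i) (hdom i)).comp_hasFDerivAt
      (f := fun v : W.V → ℝ => v i) u (evalAt i).hasFDerivAt
  have hc0 : ∀ i, 0 < W.coshRadius (W.radius hyperbolic u) i := fun i =>
    one_pos.trans_le (one_le_coshRadius hε _ i)
  have hc : ∀ i, HasFDerivAt (fun v => W.coshRadius (W.radius hyperbolic v) i)
      ((W.ε i * W.radius hyperbolic u i ^ 2) • evalAt i) u := fun i => by
    have h0 : 1 + W.ε i * W.radius hyperbolic u i ^ 2 ≠ 0 := (Real.sqrt_pos.1 (hc0 i)).ne'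
    refine (((((hr i).pow 2).const_mul (W.ε i)).const_add 1).sqrt h0).congr_fderiv ?_
    ext y
    have := (hc0 i).ne'
    unfold coshRadius at *
    simp only [smul_apply, smul_eq_mul, nsmul_eq_mul, evalAt_apply]
    field_simp
    push_cast
    ring
  have ha := hr (W.vertex (t, k + 1))
  have hb := hr (W.vertex (t, k + 2))
  have sa := coshRadius_sq hε (W.radius hyperbolic u) (W.vertex (t, k + 1))
  have sb := coshRadius_sq hε (W.radius hyperbolic u) (W.vertex (t, k + 2))
  refine (((hc (W.vertex (t, k + 1))).mul (hc (W.vertex (t, k + 2)))).add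
    ((ha.mul hb).const_mul (W.η (W.edge (t, k))))).congr_fderiv ?_
  have e : W.coshLength (W.radius hyperbolic u) (t, k) = p (k + 1) * p (k + 2)
      + W.η (W.edge (t, k)) * (W.radius hyperbolic u (W.vertex (t, k + 1))
        * W.radius hyperbolic u (W.vertex (t, k + 2))) := by rw [hp, hp]; rfl
  rw [← hp] at sa sb
  rw [e, ← hp, ← hp]
  ext y
  simp only [add_apply, smul_apply, smul_eq_mul, evalAt_apply]
  linear_combination (-p (k + 2) * y (W.vertex (t, k + 1))) * sa
    + (-p (k + 1) * y (W.vertex (t, k + 2))) * sb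

/-- The derivatives of the angles of a triangle, and the definiteness of the associated quadratic
form. -/
theorem exists_angle_weights (hε : ∀ i, W.ε i = 0 ∨ W.ε i = 1) (h1 : W.StructureCondition1)
    (h2 : W.StructureCondition2) {G : Background} {u : W.V → ℝ} (hu : u ∈ W.admissible G) (t : F) :
    ∃ c w : Fin 3 → ℝ,
      (∀ k, HasFDerivAt
        (fun v : W.V → ℝ => W.cornerAngle G (fun i => G.factor (W.ε i) (v i)) (t, k))
        (w (k + 2) • (evalAt (W.vertex (t, k + 1)) - c (k + 2) • evalAt (W.vertex (t, k)))
          + w (k + 1) • (evalAt (W.vertex (t, k + 2)) - c (k + 1) • evalAt (W.vertex (t, k)))) u) ∧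
      (G = euclidean → (∀ k, c k = 1) ∧ ∀ x : Fin 3 → ℝ,
        0 ≤ hyperbolicForm (c 0) (c 1) (c 2) (w 0) (w 1) (w 2) (x 0) (x 1) (x 2) ∧
        (hyperbolicForm (c 0) (c 1) (c 2) (w 0) (w 1) (w 2) (x 0) (x 1) (x 2) = 0 →
          x 0 = x 1 ∧ x 1 = x 2)) ∧
      (G = hyperbolic → ∀ x : Fin 3 → ℝ, x ≠ 0 →
        0 < hyperbolicForm (c 0) (c 1) (c 2) (w 0) (w 1) (w 2) (x 0) (x 1) (x 2)) := by
  cases G with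
  | euclidean =>
    set Q : Fin 3 → ℝ := fun k => W.sqLength (W.radius euclidean u) (t, k) with hQ
    set p : Fin 3 → ℝ := fun j =>
      W.ε (W.vertex (t, j)) * W.radius euclidean u (W.vertex (t, j)) ^ 2 with hp
    have hQ0 : ∀ k, 0 < Q k := fun k => sqLength_pos hε h1 (radius_pos (W := W) euclidean u) _
    refine ⟨fun _ => 1, fun k => euclideanWeight (Q k) (Q (k + 1)) (Q (k + 2)) (p k) (p (k + 1))
      (p (k + 2)), fun k => ?_, fun _ => ⟨fun _ => rfl, fun x => ?_⟩, nofun⟩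
    · obtain ⟨e₁, e₂, e₃, e₄⟩ := fin_three_add k
      simp only [cornerAngle_euclidean hε h1]
      have d := fun j => hasFDerivAt_sqLength (u := u) t j (p := p) (fun _ => rfl)
      have d₂ := d (k + 1)
      have d₃ := d (k + 2)
      simp only [e₁, e₂, e₃, e₄] at d₂ d₃ ⊢
      have := hasFDerivAt_euclidean_angle rfl rfl rfl (d k) d₂ d₃ (hQ0 (k + 1)) (hQ0 (k + 2))
        (heron_pos_of_mem_admissible hε h1 hu t k)
      simpa only [one_smul] using this
    · have g := fun k => h1.vertex t k
      have g' := fun k => h2 t k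
      have := euclidean_weights_form_nonneg (hε (W.vertex (t, 0))) (hε (W.vertex (t, 1)))
        (hε (W.vertex (t, 2))) (g 0) (g 1) (g 2) (g' 0) (g' 1) (g' 2)
        (radius_pos euclidean u _) (radius_pos euclidean u _) (radius_pos euclidean u _)
        (p := p 0) (q := p 1) (r := p 2) rfl rfl rfl (a := Q 0) (b := Q 1) (c := Q 2) rfl rfl rfl
        (hQ0 0) (hQ0 1) (hQ0 2) (heron_pos_of_mem_admissible hε h1 hu t 0) rfl rfl rfl
        (x 0) (x 1) (x 2)
      refine (iff_of_eq ?_).2 this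
      have e : ∀ w₁ w₂ w₃ x₁ x₂ x₃ : ℝ, hyperbolicForm 1 1 1 w₁ w₂ w₃ x₁ x₂ x₃
          = w₁ * (x₂ - x₃) ^ 2 + w₂ * (x₃ - x₁) ^ 2 + w₃ * (x₁ - x₂) ^ 2 := fun _ _ _ _ _ _ => by
        unfold hyperbolicForm; ring
      rw [e]
      rfl
  | hyperbolic =>
    set X : Fin 3 → ℝ := fun k => W.coshLength (W.radius hyperbolic u) (t, k) with hX
    set p : Fin 3 → ℝ := fun j => W.coshRadius (W.radius hyperbolic u) (W.vertex (t, j)) with hp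
    have hX0 : ∀ k, 1 < X k := fun k => one_lt_coshLength hε h1 (radius_pos (W := W) hyperbolic u) _
    refine ⟨X, fun k => hyperbolicWeight (X k) (X (k + 1)) (X (k + 2)) (p k) (p (k + 1))
      (p (k + 2)), fun k => ?_, nofun, fun _ x hx => ?_⟩
    · obtain ⟨e₁, e₂, e₃, e₄⟩ := fin_three_add k
      simp only [cornerAngle_hyperbolic hε h1]
      have d := fun j => hasFDerivAt_coshLength hε hu t j (p := p) (fun _ => rfl)
      have d₂ := d (k + 1)
      have d₃ := d (k + 2)
      simp only [e₁, e₂, e₃, e₄] at d₂ d₃ ⊢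
      exact hasFDerivAt_hyperbolic_angle rfl rfl rfl (d k) d₂ d₃ (hX0 (k + 1)) (hX0 (k + 2))
        (hyperbolicGram_pos_of_mem_admissible hε h1 hu t k)
    · have g := fun k => h1.vertex t k
      have g' := fun k => h2 t k
      have m := fun k => coshRadius_sq hε (W.radius hyperbolic u) (W.vertex (t, k))
      have p0 : ∀ k, 0 < p k := fun k => one_pos.trans_le (one_le_coshRadius hε _ _)
      refine hyperbolic_weights_form_pos (hε (W.vertex (t, 0))) (hε (W.vertex (t, 1)))
        (hε (W.vertex (t, 2))) (g 0) (g 1) (g 2) (g' 0) (g' 1) (g' 2)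
        (radius_pos hyperbolic u _) (radius_pos hyperbolic u _) (radius_pos hyperbolic u _)
        (p0 0) (p0 1) (p0 2) (m 0) (m 1) (m 2) (a := X 0) (b := X 1) (c := X 2) rfl rfl rfl
        (hX0 0) (hX0 1) (hX0 2) (hyperbolicGram_pos_of_mem_admissible hε h1 hu t 0) rfl rfl rfl ?_
      by_contra! h
      exact hx (funext fun k => by fin_cases k <;> simp [h])

end WeightedTriangulation

end Angles

/-! ### Gauss–Bonnet, and symmetry and definiteness of the curvature Jacobian. -/

section Curvature

open Topology

namespace ClosedTriangulation

variable {F : Type*} (T : ClosedTriangulation F)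

theorem edge_eq_edge_iff {s s' : F × Fin 3} : T.edge s = T.edge s' ↔ s' = s ∨ s' = T.mate s := by
  constructor
  · intro h
    -- The two-element set `{s, mate s}` is an invariant that descends to the quotient and separates
    -- its classes.
    have key : ∀ s₁ s₂, T.mate s₁ = s₂ → ({s₁, T.mate s₁} : Set (F × Fin 3)) = {s₂, T.mate s₂} := by
      rintro s₁ _ rfl
      rw [T.mate_mate, Set.pair_comm]
    have h' := congrArg (Quot.lift (fun s => ({s, T.mate s} : Set (F × Fin 3))) key) h
    have : s' ∈ ({s, T.mate s} : Set (F × Fin 3)) := by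
      change ({s, T.mate s} : Set (F × Fin 3)) = {s', T.mate s'} at h'
      rw [h']
      exact Set.mem_insert _ _
    simpa using this
  · rintro (rfl | rfl)
    · rfl
    · exact Quot.sound (r := fun s s' => T.mate s = s') rfl

/-- `mate` is an involution without fixed points on the `3 * |F|` sides. -/
theorem two_mul_card_edge [Fintype F] : 2 * Fintype.card T.Edge = 3 * Fintype.card F := by
  classical
  have h := Finset.card_eq_sum_card_fiberwise (f := T.edge) (s := Finset.univ)
    (t := Finset.univ) (fun _ _ => Finset.mem_coe.2 (Finset.mem_univ _))
  have h2 : ∀ e ∈ (Finset.univ : Finset T.Edge),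
      (Finset.univ.filter fun s => T.edge s = e).card = 2 := by
    intro e _
    obtain ⟨s, rfl⟩ := Quot.exists_rep e
    have : (Finset.univ.filter fun s' => T.edge s' = Quot.mk _ s) = {s, T.mate s} := by
      ext s'
      have := T.edge_eq_edge_iff (s := s) (s' := s')
      simp only [Finset.mem_filter, Finset.mem_univ, true_and, Finset.mem_insert,
        Finset.mem_singleton, ← this]
      exact eq_comm
    rw [this, Finset.card_pair (T.mate_ne s).symm]
  rw [Finset.sum_congr rfl h2] at h
  simp only [Finset.card_univ, Fintype.card_prod, Fintype.card_fin, Finset.sum_const,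
    smul_eq_mul] at h
  omega

theorem eulerChar_eq [Fintype F] :
    T.eulerChar = Fintype.card T.Vertex - Fintype.card F / 2 := by
  have h : (2 : ℝ) * Fintype.card T.Edge = 3 * Fintype.card F := by
    exact_mod_cast T.two_mul_card_edge
  unfold eulerChar
  linarith

/-- A function on the vertices that is constant on every triangle is constant. -/
theorem exists_eq_const_of_forall_triangle {α : Type*} {x : T.Vertex → α} [Nonempty F]
    (h : ∀ t k l, x (T.vertex (t, k)) = x (T.vertex (t, l))) : ∃ a, ∀ i, x i = a := by
  obtain ⟨t₀⟩ := ‹Nonempty F›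
  have step : ∀ a b : F, (∃ i j, T.mate (a, i) = (b, j)) →
      x (T.vertex (a, 0)) = x (T.vertex (b, 0)) := by
    rintro a b ⟨i, j, hij⟩
    cases hal : T.aligned (a, i)
    · have : T.vertex (startCorner (a, i)) = T.vertex (endCorner (T.mate (a, i))) :=
        Quot.sound ⟨(a, i), .inr ⟨hal, .inl ⟨rfl, rfl⟩⟩⟩
      rw [hij] at this
      rw [h a 0 (i + 1), h b 0 (j + 2)]
      exact congrArg x this
    · have : T.vertex (startCorner (a, i)) = T.vertex (startCorner (T.mate (a, i))) :=
        Quot.sound ⟨(a, i), .inl ⟨hal, .inl ⟨rfl, rfl⟩⟩⟩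
      rw [hij] at this
      rw [h a 0 (i + 1), h b 0 (j + 1)]
      exact congrArg x this
  have all : ∀ b, x (T.vertex (t₀, 0)) = x (T.vertex (b, 0)) := fun b => by
    induction T.connected t₀ b with
    | refl => rfl
    | tail _ hbc ih => exact ih.trans (step _ _ hbc)
  refine ⟨x (T.vertex (t₀, 0)), fun i => ?_⟩
  obtain ⟨⟨t, k⟩, rfl⟩ := Quot.exists_rep i
  exact (h t k 0).trans (all t).symm

instance [Nonempty F] : Nonempty T.Vertex := ‹Nonempty F›.map fun t => T.vertex (t, 0)

end ClosedTriangulation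

/-- With `S` equal to four times the area, the sines are `S / (2 * b * c)` and so on. The addition
formulas then compare `α + β` with `π - γ`. -/
theorem arccos_add_arccos_add_arccos_eq_pi {a b c : ℝ} (ha : 0 < a) (hb : 0 < b) (hc : 0 < c)
    (h₁ : a < b + c) (h₂ : b < c + a) (h₃ : c < a + b) :
    Real.arccos ((b ^ 2 + c ^ 2 - a ^ 2) / (2 * b * c))
      + Real.arccos ((c ^ 2 + a ^ 2 - b ^ 2) / (2 * c * a))
      + Real.arccos ((a ^ 2 + b ^ 2 - c ^ 2) / (2 * a * b)) = Real.pi := by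
  have hS : 0 < (a + b + c) * (b + c - a) * ((c + a - b) * (a + b - c)) := by
    have m₁ : 0 < b + c - a := by linarith
    have m₂ : 0 < c + a - b := by linarith
    have m₃ : 0 < a + b - c := by linarith
    positivity
  set S := √((a + b + c) * (b + c - a) * ((c + a - b) * (a + b - c))) with hSdef
  have S0 : 0 < S := Real.sqrt_pos.2 hS
  have Ssq : S ^ 2 = (a + b + c) * (b + c - a) * ((c + a - b) * (a + b - c)) := Real.sq_sqrt hS.le
  have key : ∀ x y z : ℝ, 0 < y → 0 < z →
      S ^ 2 = (x + y + z) * (y + z - x) * ((z + x - y) * (x + y - z)) →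
      ((y ^ 2 + z ^ 2 - x ^ 2) / (2 * y * z)) ^ 2 < 1 ∧
        √(1 - ((y ^ 2 + z ^ 2 - x ^ 2) / (2 * y * z)) ^ 2) = S / (2 * y * z) := by
    intro x y z hy hz h
    have e : 1 - ((y ^ 2 + z ^ 2 - x ^ 2) / (2 * y * z)) ^ 2 = (S / (2 * y * z)) ^ 2 := by
      rw [div_pow, div_pow, h]
      field_simp
      ring
    have p : 0 < S / (2 * y * z) := by positivity
    refine ⟨?_, by rw [e, Real.sqrt_sq p.le]⟩
    have := pow_pos p 2
    linarith
  obtain ⟨l₁, s₁⟩ := key a b c hb hc Ssq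
  obtain ⟨l₂, s₂⟩ := key b c a hc ha (by rw [Ssq]; ring)
  obtain ⟨l₃, s₃⟩ := key c a b ha hb (by rw [Ssq]; ring)
  rw [sq_lt_one_iff_abs_lt_one, abs_lt] at l₁ l₂ l₃
  set α := Real.arccos ((b ^ 2 + c ^ 2 - a ^ 2) / (2 * b * c)) with hα
  set β := Real.arccos ((c ^ 2 + a ^ 2 - b ^ 2) / (2 * c * a)) with hβ
  set γ := Real.arccos ((a ^ 2 + b ^ 2 - c ^ 2) / (2 * a * b)) with hγ
  have cα : Real.cos α = (b ^ 2 + c ^ 2 - a ^ 2) / (2 * b * c) := Real.cos_arccos l₁.1.le l₁.2.le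
  have cβ : Real.cos β = (c ^ 2 + a ^ 2 - b ^ 2) / (2 * c * a) := Real.cos_arccos l₂.1.le l₂.2.le
  have cγ : Real.cos γ = (a ^ 2 + b ^ 2 - c ^ 2) / (2 * a * b) := Real.cos_arccos l₃.1.le l₃.2.le
  have sα : Real.sin α = S / (2 * b * c) := by rw [hα, Real.sin_arccos, s₁]
  have sβ : Real.sin β = S / (2 * c * a) := by rw [hβ, Real.sin_arccos, s₂]
  have hsin : 0 < Real.sin (α + β) := by
    have : Real.sin (α + β) = S / (2 * a * b) := by
      rw [Real.sin_add, sα, sβ, cα, cβ]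
      field_simp
      ring
    rw [this]
    positivity
  have hcos : Real.cos (α + β) = Real.cos (Real.pi - γ) := by
    rw [Real.cos_pi_sub, cγ, Real.cos_add, sα, sβ, cα, cβ]
    have : S / (2 * b * c) * (S / (2 * c * a)) = S ^ 2 / (2 * b * c * (2 * c * a)) := by
      field_simp
    rw [this, Ssq]
    field_simp
    ring
  -- Between `π` and `2π` the sine of `α + β` would be nonpositive; the bound is needed for
  -- injectivity of the cosine on `[0, π]`.
  have hαβ : α + β ≤ Real.pi := by
    by_contra! h
    have h' : Real.sin (α + β - 2 * Real.pi) ≤ 0 :=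
      Real.sin_nonpos_of_nonpos_of_neg_pi_le
        (by linarith [Real.arccos_le_pi ((b ^ 2 + c ^ 2 - a ^ 2) / (2 * b * c)),
          Real.arccos_le_pi ((c ^ 2 + a ^ 2 - b ^ 2) / (2 * c * a))]) (by linarith)
    rw [Real.sin_sub_two_pi] at h'
    linarith
  have := Real.injOn_cos ⟨add_nonneg (Real.arccos_nonneg _) (Real.arccos_nonneg _), hαβ⟩
    ⟨by linarith [Real.arccos_le_pi ((a ^ 2 + b ^ 2 - c ^ 2) / (2 * a * b))],
      by linarith [Real.arccos_nonneg ((a ^ 2 + b ^ 2 - c ^ 2) / (2 * a * b))]⟩ hcos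
  linarith

namespace WeightedTriangulation

open Background

variable {F : Type*} {W : WeightedTriangulation F}

theorem length_euclidean_add_const (f : W.V → ℝ) (a : ℝ) (s : F × Fin 3) :
    W.length euclidean (fun i => f i + a) s = Real.exp a * W.length euclidean f s := by
  have e : ∀ x : ℝ, Real.exp (2 * (x + a)) = Real.exp a ^ 2 * Real.exp (2 * x) := fun x => by
    rw [← Real.exp_nat_mul, ← Real.exp_add]
    congr 1
    push_cast
    ring
  have e' : ∀ x y : ℝ, Real.exp (x + a + (y + a)) = Real.exp a ^ 2 * Real.exp (x + y) :=
    fun x y => by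
      rw [← Real.exp_nat_mul, ← Real.exp_add]
      congr 1
      push_cast
      ring
  simp only [length, edgeLength, e, e']
  rw [← Real.sqrt_sq (Real.exp_pos a).le, ← Real.sqrt_mul (sq_nonneg _),
    Real.sqrt_sq (Real.exp_pos a).le]
  congr 1
  ring

theorem add_const_mem_admissible {u : W.V → ℝ} (hu : u ∈ W.admissible euclidean) (a : ℝ) :
    (fun i => u i + a) ∈ W.admissible euclidean := by
  obtain ⟨f, ⟨hf, hf'⟩, rfl⟩ := hu
  refine ⟨fun i => f i + a, ⟨fun s => ?_, fun t k => ?_⟩, rfl⟩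
  · rw [length_euclidean_add_const]
    exact mul_pos (Real.exp_pos a) (hf s)
  · simp only [length_euclidean_add_const, ← mul_add]
    exact mul_lt_mul_of_pos_left (hf' t k) (Real.exp_pos a)

variable [Fintype F]

theorem curvature_euclidean_add_const (u : W.V → ℝ) (a : ℝ) :
    W.curvature euclidean (fun i => u i + a) = W.curvature euclidean u := by
  have h : ∀ c, W.cornerAngle euclidean (fun i => u i + a) c = W.cornerAngle euclidean u c := by
    intro c
    simp only [cornerAngle, angle, length_euclidean_add_const]
    congr 1
    have := (Real.exp_pos a).ne'
    rw [show ∀ x y z E : ℝ, ((E * y) ^ 2 + (E * z) ^ 2 - (E * x) ^ 2) / (2 * (E * y) * (E * z))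
      = (E ^ 2 * (y ^ 2 + z ^ 2 - x ^ 2)) / (E ^ 2 * (2 * y * z)) from
        fun x y z E => by ring_nf, mul_div_mul_left _ _ (pow_ne_zero 2 this)]
  funext i
  simp only [curvature, factorCurvature, factor, h]

/-- The Gauss–Bonnet formula. -/
theorem sum_curvature_euclidean {u : W.V → ℝ} (hu : u ∈ W.admissible euclidean) :
    ∑ i, W.curvature euclidean u i = 2 * Real.pi * W.eulerChar := by
  obtain ⟨f, ⟨hf, hf'⟩, rfl⟩ := hu
  have htri : ∀ t : F, ∑ k, W.cornerAngle euclidean f (t, k) = Real.pi := by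
    intro t
    have t₁ : W.length euclidean f (t, 0) < W.length euclidean f (t, 1)
      + W.length euclidean f (t, 2) := hf' t 0
    have t₂ : W.length euclidean f (t, 1) < W.length euclidean f (t, 2)
      + W.length euclidean f (t, 0) := hf' t 1
    have t₃ : W.length euclidean f (t, 2) < W.length euclidean f (t, 0)
      + W.length euclidean f (t, 1) := hf' t 2
    rw [Fin.sum_univ_three]
    exact arccos_add_arccos_add_arccos_eq_pi (hf _) (hf _) (hf _) t₁ t₂ t₃
  change ∑ i, W.factorCurvature euclidean f i = _
  simp only [factorCurvature, Finset.sum_sub_distrib, Finset.sum_const, Finset.card_univ,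
    nsmul_eq_mul]
  -- Summing over vertices counts every corner once, so the total is `2π |V| - π |F|`.
  rw [Finset.sum_fiberwise Finset.univ W.vertex (W.cornerAngle euclidean f),
    Fintype.sum_prod_type, Finset.sum_congr rfl fun t _ => htri t, W.eulerChar_eq]
  simp only [Finset.sum_const, Finset.card_univ, nsmul_eq_mul]
  ring

theorem contDiffAt_curvature (hε : ∀ i, W.ε i = 0 ∨ W.ε i = 1) (h1 : W.StructureCondition1)
    {G : Background} {u : W.V → ℝ} (hu : u ∈ W.admissible G) {n : WithTop ℕ∞} :
    ContDiffAt ℝ n (W.curvature G) u := by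
  refine contDiffAt_pi.2 fun i => ?_
  exact contDiffAt_const.sub (ContDiffAt.sum fun c _ => contDiffAt_cornerAngle hε h1 hu c)

theorem differentiableAt_curvature (hε : ∀ i, W.ε i = 0 ∨ W.ε i = 1) (h1 : W.StructureCondition1)
    {G : Background} {u : W.V → ℝ} (hu : u ∈ W.admissible G) :
    DifferentiableAt ℝ (W.curvature G) u :=
  (contDiffAt_curvature hε h1 hu (n := 1)).differentiableAt one_ne_zero

theorem fderiv_curvature_apply (hε : ∀ i, W.ε i = 0 ∨ W.ε i = 1) (h1 : W.StructureCondition1)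
    {G : Background} {u : W.V → ℝ} (hu : u ∈ W.admissible G) (y : W.V → ℝ) (i : W.V) :
    fderiv ℝ (W.curvature G) u y i = -∑ c : F × Fin 3 with W.vertex c = i,
      fderiv ℝ (fun v : W.V → ℝ => W.cornerAngle G (fun i => G.factor (W.ε i) (v i)) c) u y := by
  have h := hasFDerivAt_pi'.1 (differentiableAt_curvature hε h1 hu).hasFDerivAt i
  have hsum : HasFDerivAt (fun v => W.curvature G v i) _ u :=
    (HasFDerivAt.fun_sum (u := Finset.univ.filter fun c : F × Fin 3 => W.vertex c = i)
      fun c _ => ((contDiffAt_cornerAngle hε h1 hu (n := 1) c).differentiableAt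
        one_ne_zero).hasFDerivAt).const_sub (2 * Real.pi)
  have := congrArg (fun L : (W.V → ℝ) →L[ℝ] ℝ => L y) (h.unique hsum)
  simpa using this

/-- The quadratic form of the Jacobian of the curvature is a sum over the triangles. -/
theorem sum_mul_fderiv_curvature (hε : ∀ i, W.ε i = 0 ∨ W.ε i = 1) (h1 : W.StructureCondition1)
    {G : Background} {u : W.V → ℝ} (hu : u ∈ W.admissible G) (x y : W.V → ℝ) :
    ∑ i, x i * fderiv ℝ (W.curvature G) u y i = ∑ t : F, ∑ k : Fin 3, -(x (W.vertex (t, k)) *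
      fderiv ℝ (fun v : W.V → ℝ => W.cornerAngle G (fun i => G.factor (W.ε i) (v i)) (t, k)) u y)
    := by
  rw [← Fintype.sum_prod_type (f := fun c : F × Fin 3 => -(x (W.vertex c) *
    fderiv ℝ (fun v : W.V → ℝ => W.cornerAngle G (fun i => G.factor (W.ε i) (v i)) c) u y)),
    ← Finset.sum_fiberwise Finset.univ W.vertex]
  refine Finset.sum_congr rfl fun i _ => ?_
  rw [fderiv_curvature_apply hε h1 hu, mul_neg, Finset.mul_sum, ← Finset.sum_neg_distrib]
  refine Finset.sum_congr rfl fun c hc => ?_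
  rw [(Finset.mem_filter.1 hc).2]

/-- The contribution of a triangle to the Jacobian of the curvature. -/
def triangleForm (c w x y : Fin 3 → ℝ) : ℝ :=
  ∑ k, -(x k * (w (k + 2) * (y (k + 1) - c (k + 2) * y k)
    + w (k + 1) * (y (k + 2) - c (k + 1) * y k)))

theorem triangleForm_eq (c w x y : Fin 3 → ℝ) : triangleForm c w x y =
    w 0 * (c 0 * (x 1 * y 1 + x 2 * y 2) - (x 1 * y 2 + x 2 * y 1))
    + w 1 * (c 1 * (x 2 * y 2 + x 0 * y 0) - (x 2 * y 0 + x 0 * y 2))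
    + w 2 * (c 2 * (x 0 * y 0 + x 1 * y 1) - (x 0 * y 1 + x 1 * y 0)) := by
  unfold triangleForm
  rw [Fin.sum_univ_three]
  simp only [show (0 : Fin 3) + 1 = 1 from rfl, show (0 : Fin 3) + 2 = 2 from rfl,
    show (1 : Fin 3) + 1 = 2 from rfl, show (1 : Fin 3) + 2 = 0 from rfl,
    show (2 : Fin 3) + 1 = 0 from rfl, show (2 : Fin 3) + 2 = 1 from rfl]
  ring

theorem triangleForm_comm (c w x y : Fin 3 → ℝ) : triangleForm c w x y = triangleForm c w y x := by
  rw [triangleForm_eq, triangleForm_eq]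
  ring

theorem triangleForm_self (c w x : Fin 3 → ℝ) : triangleForm c w x x =
    hyperbolicForm (c 0) (c 1) (c 2) (w 0) (w 1) (w 2) (x 0) (x 1) (x 2) := by
  rw [triangleForm_eq]
  unfold hyperbolicForm
  ring

theorem exists_sum_triangleForm (hε : ∀ i, W.ε i = 0 ∨ W.ε i = 1) (h1 : W.StructureCondition1)
    (h2 : W.StructureCondition2) {G : Background} {u : W.V → ℝ} (hu : u ∈ W.admissible G) :
    ∃ c w : F → Fin 3 → ℝ,
      (∀ x y : W.V → ℝ, ∑ i, x i * fderiv ℝ (W.curvature G) u y i =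
        ∑ t, triangleForm (c t) (w t) (fun k => x (W.vertex (t, k)))
          (fun k => y (W.vertex (t, k)))) ∧
      (G = euclidean → ∀ t, (∀ k, c t k = 1) ∧ ∀ x : Fin 3 → ℝ,
        0 ≤ triangleForm (c t) (w t) x x ∧
        (triangleForm (c t) (w t) x x = 0 → x 0 = x 1 ∧ x 1 = x 2)) ∧
      (G = hyperbolic → ∀ t, ∀ x : Fin 3 → ℝ, x ≠ 0 → 0 < triangleForm (c t) (w t) x x) := by
  choose c w hd he hh using exists_angle_weights hε h1 h2 hu
  refine ⟨c, w, fun x y => ?_, fun hG t => ?_, fun hG t => ?_⟩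
  · rw [sum_mul_fderiv_curvature hε h1 hu]
    refine Finset.sum_congr rfl fun t _ => Finset.sum_congr rfl fun k _ => ?_
    rw [(hd t k).fderiv]
    rfl
  · simp only [triangleForm_self]
    exact he t hG
  · simp only [triangleForm_self]
    exact hh t hG

/-- Symmetry of the Jacobian holds already for the contribution of each triangle. -/
theorem sum_mul_fderiv_curvature_comm (hε : ∀ i, W.ε i = 0 ∨ W.ε i = 1)
    (h1 : W.StructureCondition1) (h2 : W.StructureCondition2) {G : Background} {u : W.V → ℝ}
    (hu : u ∈ W.admissible G) (x y : W.V → ℝ) :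
    ∑ i, x i * fderiv ℝ (W.curvature G) u y i = ∑ i, y i * fderiv ℝ (W.curvature G) u x i := by
  obtain ⟨c, w, h, -, -⟩ := exists_sum_triangleForm hε h1 h2 hu
  rw [h, h]
  exact Finset.sum_congr rfl fun t _ => triangleForm_comm _ _ _ _

theorem sum_mul_fderiv_curvature_pos_hyperbolic [Nonempty F] (hε : ∀ i, W.ε i = 0 ∨ W.ε i = 1)
    (h1 : W.StructureCondition1) (h2 : W.StructureCondition2) {u : W.V → ℝ}
    (hu : u ∈ W.admissible hyperbolic) {x : W.V → ℝ} (hx : x ≠ 0) :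
    0 < ∑ i, x i * fderiv ℝ (W.curvature hyperbolic) u x i := by
  obtain ⟨c, w, h, -, hpos⟩ := exists_sum_triangleForm hε h1 h2 hu
  rw [h]
  have hpos := hpos rfl
  obtain ⟨i, hi⟩ := Function.ne_iff.1 hx
  obtain ⟨⟨t, k⟩, rfl⟩ := Quot.exists_rep i
  refine Finset.sum_pos' (fun t _ => ?_) ⟨t, Finset.mem_univ _, hpos t _ fun h0 => ?_⟩
  · by_cases h0 : (fun k => x (W.vertex (t, k))) = 0
    · rw [h0, triangleForm_eq]
      simp
    · exact (hpos t _ h0).le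
  · exact hi (congrFun h0 k)

theorem sum_mul_fderiv_curvature_nonneg_euclidean (hε : ∀ i, W.ε i = 0 ∨ W.ε i = 1)
    (h1 : W.StructureCondition1) (h2 : W.StructureCondition2) {u : W.V → ℝ}
    (hu : u ∈ W.admissible euclidean) (x : W.V → ℝ) :
    0 ≤ ∑ i, x i * fderiv ℝ (W.curvature euclidean) u x i := by
  obtain ⟨c, w, h, hpos, -⟩ := exists_sum_triangleForm hε h1 h2 hu
  rw [h]
  exact Finset.sum_nonneg fun t _ => ((hpos rfl t).2 _).1

/-- All triangle contributions are nonnegative, so each vanishes and `x` is constant on every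
triangle; connectedness does the rest. -/
theorem exists_eq_const_of_sum_mul_fderiv_curvature_eq_zero [Nonempty F]
    (hε : ∀ i, W.ε i = 0 ∨ W.ε i = 1)
    (h1 : W.StructureCondition1) (h2 : W.StructureCondition2) {u : W.V → ℝ}
    (hu : u ∈ W.admissible euclidean) {x : W.V → ℝ}
    (hx : ∑ i, x i * fderiv ℝ (W.curvature euclidean) u x i = 0) : ∃ a, ∀ i, x i = a := by
  obtain ⟨c, w, h, hpos, -⟩ := exists_sum_triangleForm hε h1 h2 hu
  have hpos := hpos rfl
  rw [h, Finset.sum_eq_zero_iff_of_nonneg fun t _ => ((hpos t).2 _).1] at hx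
  refine W.exists_eq_const_of_forall_triangle fun t => ?_
  obtain ⟨e₀, e₁⟩ := ((hpos t).2 _).2 (hx t (Finset.mem_univ _))
  have : ∀ k, x (W.vertex (t, k)) = x (W.vertex (t, 0)) := by
    intro k
    fin_cases k
    · rfl
    · exact e₀.symm
    · exact (e₀.trans e₁).symm
  exact fun k l => (this k).trans (this l).symm

theorem sum_mul_fderiv_curvature_const_euclidean (hε : ∀ i, W.ε i = 0 ∨ W.ε i = 1)
    (h1 : W.StructureCondition1) (h2 : W.StructureCondition2) {u : W.V → ℝ}
    (hu : u ∈ W.admissible euclidean) (x : W.V → ℝ) (a : ℝ) :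
    ∑ i, x i * fderiv ℝ (W.curvature euclidean) u (fun _ => a) i = 0 := by
  obtain ⟨c, w, h, hpos, -⟩ := exists_sum_triangleForm hε h1 h2 hu
  rw [h]
  refine Finset.sum_eq_zero fun t _ => ?_
  have hc := (hpos rfl t).1
  rw [triangleForm_eq, hc, hc, hc]
  ring

theorem fderiv_curvature_const_euclidean (hε : ∀ i, W.ε i = 0 ∨ W.ε i = 1)
    (h1 : W.StructureCondition1) (h2 : W.StructureCondition2) {u : W.V → ℝ}
    (hu : u ∈ W.admissible euclidean) (a : ℝ) :
    fderiv ℝ (W.curvature euclidean) u (fun _ => a) = 0 := by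
  -- Testing against the vector itself turns the vanishing of the bilinear form into the vanishing
  -- of a sum of squares.
  have h := sum_mul_fderiv_curvature_const_euclidean hε h1 h2 hu
    (fderiv ℝ (W.curvature euclidean) u (fun _ => a)) a
  rw [Finset.sum_eq_zero_iff_of_nonneg fun i _ => mul_self_nonneg _] at h
  exact funext fun i => mul_self_eq_zero.1 (h i (Finset.mem_univ i))

theorem sum_fderiv_curvature_euclidean (hε : ∀ i, W.ε i = 0 ∨ W.ε i = 1)
    (h1 : W.StructureCondition1) (h2 : W.StructureCondition2) {u : W.V → ℝ}
    (hu : u ∈ W.admissible euclidean) (y : W.V → ℝ) :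
    ∑ i, fderiv ℝ (W.curvature euclidean) u y i = 0 := by
  have h := sum_mul_fderiv_curvature_comm hε h1 h2 hu (fun _ => 1) y
  rw [sum_mul_fderiv_curvature_const_euclidean hε h1 h2 hu] at h
  simpa using h

theorem laplacian_eq (hε : ∀ i, W.ε i = 0 ∨ W.ε i = 1) (h1 : W.StructureCondition1)
    {G : Background} {u : W.V → ℝ} (hu : u ∈ W.admissible G) (g : W.V → ℝ) :
    W.laplacian G u g = -fderiv ℝ (W.curvature G) u g := by
  funext i
  have h := hasFDerivAt_pi'.1 (differentiableAt_curvature hε h1 hu).hasFDerivAt i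
  have e : ∀ y, fderiv ℝ (fun v => W.curvature G v i) u y = fderiv ℝ (W.curvature G) u y i :=
    fun y => by rw [h.fderiv]; rfl
  have hg : g = ∑ j, g j • Pi.single (M := fun _ => ℝ) j 1 := by
    conv_lhs => rw [← Finset.univ_sum_single g]
    exact Finset.sum_congr rfl fun j _ => by rw [← Pi.single_smul, smul_eq_mul, mul_one]
  rw [laplacian, Matrix.neg_mulVec, Pi.neg_apply, Pi.neg_apply, neg_inj]
  conv_rhs => rw [hg, map_sum, Finset.sum_apply]
  refine Finset.sum_congr rfl fun j _ => ?_
  rw [map_smul, Pi.smul_apply, smul_eq_mul, mul_comm, ← e]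
  rfl

end WeightedTriangulation

end Curvature

/-! ### The Ricci and Calabi flows. -/

section Flows

open Topology

namespace WeightedTriangulation

open Background

variable {F : Type*} [Fintype F] {W : WeightedTriangulation F}

/-- The linear functional that is preserved by the flows. -/
noncomputable def invariantForm (W : WeightedTriangulation F) : Background → (W.V → ℝ) →L[ℝ] ℝ
  | .euclidean => ∑ i, evalAt i
  | .hyperbolic => 0

theorem invariantForm_euclidean (x : W.V → ℝ) : W.invariantForm euclidean x = ∑ i, x i := by
  simp [invariantForm]

theorem sum_mul_fderiv_curvature_nonneg [Nonempty F] (hε : ∀ i, W.ε i = 0 ∨ W.ε i = 1)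
    (h1 : W.StructureCondition1) (h2 : W.StructureCondition2) {G : Background} {u : W.V → ℝ}
    (hu : u ∈ W.admissible G) (w : W.V → ℝ) :
    0 ≤ ∑ i, w i * fderiv ℝ (W.curvature G) u w i := by
  cases G
  · exact sum_mul_fderiv_curvature_nonneg_euclidean hε h1 h2 hu w
  · by_cases hw : w = 0
    · simp [hw]
    · exact (sum_mul_fderiv_curvature_pos_hyperbolic hε h1 h2 hu hw).le

theorem eq_zero_of_sum_mul_fderiv_curvature_eq_zero [Nonempty F]
    (hε : ∀ i, W.ε i = 0 ∨ W.ε i = 1) (h1 : W.StructureCondition1) (h2 : W.StructureCondition2)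
    {G : Background} {u : W.V → ℝ} (hu : u ∈ W.admissible G) {w : W.V → ℝ}
    (hw : W.invariantForm G w = 0) (h : ∑ i, w i * fderiv ℝ (W.curvature G) u w i = 0) :
    w = 0 := by
  cases G
  · obtain ⟨a, hwa⟩ := exists_eq_const_of_sum_mul_fderiv_curvature_eq_zero hε h1 h2 hu h
    rw [invariantForm_euclidean] at hw
    have ha : a = 0 := by simpa [hwa] using hw
    exact funext fun i => (hwa i).trans ha
  · by_contra hw0
    exact (sum_mul_fderiv_curvature_pos_hyperbolic hε h1 h2 hu hw0).ne' h

theorem invariantForm_fderiv_curvature (hε : ∀ i, W.ε i = 0 ∨ W.ε i = 1)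
    (h1 : W.StructureCondition1) (h2 : W.StructureCondition2) {G : Background} {u : W.V → ℝ}
    (hu : u ∈ W.admissible G) (y : W.V → ℝ) :
    W.invariantForm G (fderiv ℝ (W.curvature G) u y) = 0 := by
  cases G
  · rw [invariantForm_euclidean]
    exact sum_fderiv_curvature_euclidean hε h1 h2 hu y
  · rfl

theorem invariantForm_curvature_sub {G : Background} {u Kbar : W.V → ℝ} (hu : u ∈ W.admissible G)
    (hK : G = euclidean → ∑ i, Kbar i = 2 * Real.pi * W.eulerChar) :
    W.invariantForm G (W.curvature G u - Kbar) = 0 := by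
  cases G
  · rw [map_sub, invariantForm_euclidean, invariantForm_euclidean, hK rfl,
      sum_curvature_euclidean hu, sub_self]
  · rfl

theorem modifiedCalabi_eq (hε : ∀ i, W.ε i = 0 ∨ W.ε i = 1) (h1 : W.StructureCondition1)
    {G : Background} {u : W.V → ℝ} (hu : u ∈ W.admissible G) (Kbar : W.V → ℝ) :
    W.modifiedCalabi G Kbar u = -fderiv ℝ (W.curvature G) u (W.curvature G u - Kbar) :=
  laplacian_eq hε h1 hu _

theorem contDiffAt_modifiedRicci (hε : ∀ i, W.ε i = 0 ∨ W.ε i = 1) (h1 : W.StructureCondition1)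
    {G : Background} {u : W.V → ℝ} (hu : u ∈ W.admissible G) (Kbar : W.V → ℝ) :
    ContDiffAt ℝ 1 (W.modifiedRicci G Kbar) u :=
  contDiffAt_const.sub (contDiffAt_curvature hε h1 hu)

theorem fderiv_modifiedRicci (G : Background) (Kbar u : W.V → ℝ) :
    fderiv ℝ (W.modifiedRicci G Kbar) u = -fderiv ℝ (W.curvature G) u :=
  fderiv_const_sub Kbar

theorem contDiffAt_fderiv_curvature (hε : ∀ i, W.ε i = 0 ∨ W.ε i = 1)
    (h1 : W.StructureCondition1) {G : Background} {u : W.V → ℝ} (hu : u ∈ W.admissible G) :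
    ContDiffAt ℝ 1 (fderiv ℝ (W.curvature G)) u :=
  (contDiffAt_curvature (n := 2) hε h1 hu).fderiv_right (by norm_num)

theorem modifiedCalabi_eventuallyEq [Nonempty F] (hε : ∀ i, W.ε i = 0 ∨ W.ε i = 1)
    (h1 : W.StructureCondition1) {G : Background} {u : W.V → ℝ} (hu : u ∈ W.admissible G)
    (Kbar : W.V → ℝ) :
    W.modifiedCalabi G Kbar =ᶠ[𝓝 u]
      fun v => -fderiv ℝ (W.curvature G) v (W.curvature G v - Kbar) := by
  filter_upwards [isOpen_admissible hε h1 hu] with v hv using modifiedCalabi_eq hε h1 hv Kbar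

theorem contDiffAt_modifiedCalabi [Nonempty F] (hε : ∀ i, W.ε i = 0 ∨ W.ε i = 1)
    (h1 : W.StructureCondition1) {G : Background} {u : W.V → ℝ} (hu : u ∈ W.admissible G)
    (Kbar : W.V → ℝ) : ContDiffAt ℝ 1 (W.modifiedCalabi G Kbar) u :=
  (((contDiffAt_fderiv_curvature hε h1 hu).clm_apply
    ((contDiffAt_curvature hε h1 hu).sub contDiffAt_const)).neg).congr_of_eventuallyEq
      (modifiedCalabi_eventuallyEq hε h1 hu Kbar)

/-- In the product rule the derivative of the Jacobian is applied to the curvature minus `Kbar`,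
which is zero here; this leaves minus the square of the Jacobian. -/
theorem fderiv_modifiedCalabi [Nonempty F] (hε : ∀ i, W.ε i = 0 ∨ W.ε i = 1)
    (h1 : W.StructureCondition1) {G : Background} {u Kbar : W.V → ℝ} (hu : u ∈ W.admissible G)
    (hK : W.curvature G u = Kbar) (w : W.V → ℝ) :
    fderiv ℝ (W.modifiedCalabi G Kbar) u w =
      -fderiv ℝ (W.curvature G) u (fderiv ℝ (W.curvature G) u w) := by
  have h := (((contDiffAt_fderiv_curvature hε h1 hu).differentiableAt
    one_ne_zero).hasFDerivAt.clm_apply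
      ((differentiableAt_curvature hε h1 hu).hasFDerivAt.sub_const Kbar)).neg
  rw [(modifiedCalabi_eventuallyEq hε h1 hu Kbar).fderiv_eq]
  refine (DFunLike.congr_fun h.fderiv w).trans ?_
  simp [hK]

/-- The difference lies in the kernel of the Jacobian and, by Gauss–Bonnet in the Euclidean case,
sums to zero, whereas that kernel consists of constants. -/
theorem curvature_eq_of_fderiv_curvature_eq_zero [Nonempty F] (hε : ∀ i, W.ε i = 0 ∨ W.ε i = 1)
    (h1 : W.StructureCondition1) (h2 : W.StructureCondition2) {G : Background} {u Kbar : W.V → ℝ}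
    (hu : u ∈ W.admissible G) (hK : G = euclidean → ∑ i, Kbar i = 2 * Real.pi * W.eulerChar)
    (h : fderiv ℝ (W.curvature G) u (W.curvature G u - Kbar) = 0) : W.curvature G u = Kbar :=
  sub_eq_zero.1 <| eq_zero_of_sum_mul_fderiv_curvature_eq_zero hε h1 h2 hu
    (invariantForm_curvature_sub hu hK) (by simp [h])

theorem limitsHaveCurvature_modifiedRicci (hε : ∀ i, W.ε i = 0 ∨ W.ε i = 1)
    (h1 : W.StructureCondition1) (G : Background) (Kbar : W.V → ℝ) :
    W.LimitsHaveCurvature G (W.modifiedRicci G Kbar) Kbar := by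
  intro u ubar hu hubar hlim
  have h := eq_zero_of_tendsto_of_isIntegralCurveOn
    (contDiffAt_modifiedRicci hε h1 hubar Kbar).continuousAt hu.2 hlim
  exact (sub_eq_zero.1 h).symm

theorem limitsHaveCurvature_modifiedCalabi [Nonempty F] (hε : ∀ i, W.ε i = 0 ∨ W.ε i = 1)
    (h1 : W.StructureCondition1) (h2 : W.StructureCondition2) {G : Background} {Kbar : W.V → ℝ}
    (hK : G = euclidean → ∑ i, Kbar i = 2 * Real.pi * W.eulerChar) :
    W.LimitsHaveCurvature G (W.modifiedCalabi G Kbar) Kbar := by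
  intro u ubar hu hubar hlim
  have h := eq_zero_of_tendsto_of_isIntegralCurveOn
    (contDiffAt_modifiedCalabi hε h1 hubar Kbar).continuousAt hu.2 hlim
  rw [modifiedCalabi_eq hε h1 hubar, neg_eq_zero] at h
  exact curvature_eq_of_fderiv_curvature_eq_zero hε h1 h2 hubar hK h

theorem IsSolution.add_const {X : (W.V → ℝ) → W.V → ℝ}
    (hX : ∀ u a, X (fun i => u i + a) = X u) {I : Set ℝ} {u : ℝ → W.V → ℝ}
    (hu : W.IsSolution euclidean X I u) (a : ℝ) :
    W.IsSolution euclidean X I fun t i => u t i + a := by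
  refine ⟨fun t ht => add_const_mem_admissible (hu.1 t ht) a, fun t ht => ?_⟩
  have h := (hu.2 t ht).add_const (fun _ => a : W.V → ℝ)
  change HasDerivWithinAt _ (X fun i => u t i + a) I t
  rw [hX]
  exact h

/-- A flow on the discrete conformal structures converges exponentially near an equilibrium at which
its linearization is negative definite on the kernel of `invariantForm`. -/
theorem convergesNear_of_negDef [Nonempty F] (hε : ∀ i, W.ε i = 0 ∨ W.ε i = 1)
    (h1 : W.StructureCondition1) {G : Background} {X : (W.V → ℝ) → W.V → ℝ} {p : W.V → ℝ}
    (hp : p ∈ W.admissible G) (hX : ContDiffAt ℝ 1 X p) (hXp : X p = 0)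
    (hinv : G = euclidean → ∀ u a, X (fun i => u i + a) = X u)
    (hφ : ∀ u ∈ W.admissible G, W.invariantForm G (X u) = 0)
    (hneg : ∀ w, W.invariantForm G w = 0 → w ≠ 0 → ∑ i, w i * fderiv ℝ X p w i < 0) :
    W.ConvergesNear G X p := by
  obtain ⟨δ, hδ, C, hC, a, ha, H⟩ := exponential_stability (W.invariantForm G)
    (isOpen_admissible hε h1 hp) hX hXp hφ hneg
  cases G
  · have hcard : (0 : ℝ) < Fintype.card W.V := by exact_mod_cast Fintype.card_pos
    -- Translating by the mean deviation `c`, with `|c| ≤ ‖u₀ - p‖`, moves `u₀` into the hyperplane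
    -- through `p` and at most doubles the distance to `p`.
    refine ⟨δ / 2, by positivity, C, hC, a, ha, fun u₀ hu₀ => ?_⟩
    set c := (∑ j, (u₀ j - p j)) / Fintype.card W.V with hc
    have hcle : |c| ≤ ‖u₀ - p‖ := by
      rw [hc, abs_div, abs_of_pos hcard, div_le_iff₀ hcard]
      calc |∑ j, (u₀ j - p j)| ≤ ∑ j, |u₀ j - p j| := Finset.abs_sum_le_sum_abs _ _
        _ ≤ ∑ _j : W.V, ‖u₀ - p‖ := Finset.sum_le_sum fun j _ => norm_le_pi_norm (u₀ - p) j
        _ = _ := by simp [mul_comm]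
    have hφ₀ : W.invariantForm euclidean (fun i => u₀ i + -c)
        = W.invariantForm euclidean p := by
      rw [invariantForm_euclidean, invariantForm_euclidean, Finset.sum_add_distrib]
      have : ∑ j, (u₀ j - p j) = Fintype.card W.V * c := by rw [hc]; field_simp
      rw [Finset.sum_sub_distrib] at this
      simp only [Finset.sum_const, Finset.card_univ, nsmul_eq_mul]
      linarith
    have hnorm : ‖(fun i => u₀ i + -c) - p‖ < δ := by
      have e : (fun i => u₀ i + -c) - p = (u₀ - p) + fun _ => -c := by
        funext i; simp only [Pi.sub_apply, Pi.add_apply]; ring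
      have hconst : ‖(fun _ => -c : W.V → ℝ)‖ ≤ |c| := by
        rw [pi_norm_le_iff_of_nonneg (abs_nonneg _)]
        intro; simp
      rw [e]
      linarith [norm_add_le (u₀ - p) (fun _ => -c)]
    obtain ⟨u, hu0, huΩ, hu, huniq, hbound⟩ := H _ hφ₀ hnorm
    refine ⟨fun t i => u t i + c, ?_, IsSolution.add_const (hinv rfl) ⟨huΩ, hu⟩ c, ?_, ?_⟩
    · funext i; simp [hu0]
    · intro T v hv0 hv t ht
      have hv' := IsSolution.add_const (hinv rfl) hv (-c)
      have h := huniq T (fun t i => v t i + -c) (by simp [hv0]) hv'.1 hv'.2 t ht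
      funext i
      simp only [← h]
      ring
    · intro t ht
      have e : (fun i => u t i + c) - W.flowLimit p u₀ euclidean = u t - p := by
        funext i
        simp only [flowLimit, Pi.sub_apply, ← hc]
        ring
      simp only [e]
      exact hbound t ht
  · refine ⟨δ, hδ, C, hC, a, ha, fun u₀ hu₀ => ?_⟩
    obtain ⟨u, hu0, huΩ, hu, huniq, hbound⟩ := H u₀ rfl hu₀
    exact ⟨u, hu0, ⟨huΩ, hu⟩, fun T v hv0 hv => huniq T v hv0 hv.1 hv.2, hbound⟩

theorem modifiedRicci_add_const (Kbar u : W.V → ℝ) (a : ℝ) :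
    W.modifiedRicci euclidean Kbar (fun i => u i + a) = W.modifiedRicci euclidean Kbar u := by
  rw [modifiedRicci, modifiedRicci, curvature_euclidean_add_const]

theorem curvatureJacobian_add_const (u : W.V → ℝ) (a : ℝ) :
    W.curvatureJacobian euclidean (fun i => u i + a) = W.curvatureJacobian euclidean u := by
  ext i j
  have h := fderiv_comp_add_right (𝕜 := ℝ) (f := fun v => W.curvature euclidean v i) (x := u)
    (fun _ => a)
  have e : (fun v : W.V → ℝ => W.curvature euclidean (v + fun _ => a) i) =
      fun v => W.curvature euclidean v i :=
    funext fun v => congrFun (curvature_euclidean_add_const v a) i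
  rw [e] at h
  exact (DFunLike.congr_fun h (Pi.single j 1)).symm

theorem modifiedCalabi_add_const (Kbar u : W.V → ℝ) (a : ℝ) :
    W.modifiedCalabi euclidean Kbar (fun i => u i + a) = W.modifiedCalabi euclidean Kbar u := by
  rw [modifiedCalabi, modifiedCalabi, laplacian, laplacian, curvature_euclidean_add_const,
    curvatureJacobian_add_const]

theorem convergesNear_modifiedRicci [Nonempty F] (hε : ∀ i, W.ε i = 0 ∨ W.ε i = 1)
    (h1 : W.StructureCondition1) (h2 : W.StructureCondition2) {G : Background} {ubar : W.V → ℝ}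
    (hubar : ubar ∈ W.admissible G) :
    W.ConvergesNear G (W.modifiedRicci G (W.curvature G ubar)) ubar := by
  refine convergesNear_of_negDef hε h1 hubar (contDiffAt_modifiedRicci hε h1 hubar _) (sub_self _)
    ?_ (fun u hu => ?_) fun w hw hw0 => ?_
  · rintro rfl
    exact modifiedRicci_add_const _
  · rw [modifiedRicci, ← neg_sub, map_neg, invariantForm_curvature_sub hu, neg_zero]
    rintro rfl
    exact sum_curvature_euclidean hubar
  · rw [fderiv_modifiedRicci]
    have h := (sum_mul_fderiv_curvature_nonneg hε h1 h2 hubar w).lt_of_ne' fun h =>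
      hw0 (eq_zero_of_sum_mul_fderiv_curvature_eq_zero hε h1 h2 hubar hw h)
    simpa using h

theorem convergesNear_modifiedCalabi [Nonempty F] (hε : ∀ i, W.ε i = 0 ∨ W.ε i = 1)
    (h1 : W.StructureCondition1) (h2 : W.StructureCondition2) {G : Background} {ubar : W.V → ℝ}
    (hubar : ubar ∈ W.admissible G) :
    W.ConvergesNear G (W.modifiedCalabi G (W.curvature G ubar)) ubar := by
  refine convergesNear_of_negDef hε h1 hubar (contDiffAt_modifiedCalabi hε h1 hubar _) ?_
    ?_ (fun u hu => ?_) fun w hw hw0 => ?_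
  · rw [modifiedCalabi_eq hε h1 hubar, sub_self, map_zero, neg_zero]
  · rintro rfl
    exact modifiedCalabi_add_const _
  · rw [modifiedCalabi_eq hε h1 hu, map_neg, invariantForm_fderiv_curvature hε h1 h2 hu, neg_zero]
  · simp only [fderiv_modifiedCalabi hε h1 hubar rfl, Pi.neg_apply, mul_neg,
      Finset.sum_neg_distrib, neg_lt_zero]
    -- By symmetry the form of the squared Jacobian at `w` is the squared length of the Jacobian
    -- applied to `w`.
    rw [sum_mul_fderiv_curvature_comm hε h1 h2 hubar]
    refine (Finset.sum_nonneg fun i _ => mul_self_nonneg _).lt_of_ne' fun h => hw0 ?_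
    rw [Finset.sum_eq_zero_iff_of_nonneg fun i _ => mul_self_nonneg _] at h
    refine eq_zero_of_sum_mul_fderiv_curvature_eq_zero hε h1 h2 hubar hw
      (Finset.sum_eq_zero fun i hi => ?_)
    rw [mul_self_eq_zero.1 (h i hi), mul_zero]

theorem IsSolution.congr {G : Background} {X Y : (W.V → ℝ) → W.V → ℝ}
    (h : Set.EqOn X Y (W.admissible G)) {I : Set ℝ} {u : ℝ → W.V → ℝ}
    (hu : W.IsSolution G X I u) : W.IsSolution G Y I u :=
  ⟨hu.1, fun t ht => by
    change HasDerivWithinAt u (Y (u t)) I t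
    rw [← h (hu.1 t ht)]
    exact hu.2 t ht⟩

theorem ConvergesNear.congr {G : Background} {X Y : (W.V → ℝ) → W.V → ℝ}
    (h : Set.EqOn X Y (W.admissible G)) {p : W.V → ℝ} (hp : W.ConvergesNear G X p) :
    W.ConvergesNear G Y p := by
  obtain ⟨δ, hδ, C, hC, a, ha, H⟩ := hp
  refine ⟨δ, hδ, C, hC, a, ha, fun u₀ hu₀ => ?_⟩
  obtain ⟨u, hu0, hu, huniq, hb⟩ := H u₀ hu₀
  exact ⟨u, hu0, hu.congr h, fun T v hv0 hv => huniq T v hv0 (hv.congr h.symm), hb⟩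

/-- The constant target is annihilated by the Jacobian in the Euclidean case and is zero in the
hyperbolic one, so the Calabi flow is a case of the modified flow. -/
theorem modifiedCalabi_constCurvature_eqOn (hε : ∀ i, W.ε i = 0 ∨ W.ε i = 1)
    (h1 : W.StructureCondition1) (h2 : W.StructureCondition2) (G : Background) :
    Set.EqOn (W.modifiedCalabi G fun _ => W.constCurvature G) (W.calabi G) (W.admissible G) := by
  intro u hu
  rw [modifiedCalabi_eq hε h1 hu, calabi, laplacian_eq hε h1 hu, map_sub]
  cases G
  · rw [fderiv_curvature_const_euclidean hε h1 h2 hu, sub_zero]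
  · rw [show (fun _ : W.V => W.constCurvature hyperbolic) = 0 from rfl, map_zero, sub_zero]

theorem sum_constCurvature_euclidean [Nonempty F] :
    ∑ _i : W.V, W.constCurvature euclidean = 2 * Real.pi * W.eulerChar := by
  rw [Finset.sum_const, Finset.card_univ, nsmul_eq_mul, constCurvature,
    mul_div_cancel₀ _ (Nat.cast_ne_zero.2 Fintype.card_ne_zero)]

end WeightedTriangulation

end Flows

theorem theorem1p3 {F : Type*} [Fintype F] [Nonempty F] (W : WeightedTriangulation F)
    (hε : ∀ i, W.ε i = 0 ∨ W.ε i = 1)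
    (h1 : W.StructureCondition1) (h2 : W.StructureCondition2) (G : Background) :
    -- combinatorial Calabi flow
    (W.LimitsHaveCurvature G (W.calabi G) (fun _ => W.constCurvature G) ∧
      ∀ ustar ∈ W.admissible G, (∀ i, W.curvature G ustar i = W.constCurvature G) →
        W.ConvergesNear G (W.calabi G) ustar) ∧
    -- modified combinatorial Ricci and Calabi flows
    ∀ Kbar : W.V → ℝ,
      (G = Background.euclidean → ∑ i, Kbar i = 2 * Real.pi * W.eulerChar) →
      (W.LimitsHaveCurvature G (W.modifiedRicci G Kbar) Kbar ∧
        W.LimitsHaveCurvature G (W.modifiedCalabi G Kbar) Kbar) ∧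
      ∀ ubar ∈ W.admissible G, W.curvature G ubar = Kbar →
        W.ConvergesNear G (W.modifiedRicci G Kbar) ubar ∧
          W.ConvergesNear G (W.modifiedCalabi G Kbar) ubar := by
  have hcalabi := WeightedTriangulation.modifiedCalabi_constCurvature_eqOn hε h1 h2 G
  refine ⟨⟨fun u ubar hu => ?_, fun ustar hustar hK => ?_⟩, fun Kbar hKbar =>
    ⟨⟨WeightedTriangulation.limitsHaveCurvature_modifiedRicci hε h1 G Kbar,
      WeightedTriangulation.limitsHaveCurvature_modifiedCalabi hε h1 h2 hKbar⟩, ?_⟩⟩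
  · refine WeightedTriangulation.limitsHaveCurvature_modifiedCalabi hε h1 h2 ?_ u ubar
      (hu.congr hcalabi.symm)
    rintro rfl
    exact WeightedTriangulation.sum_constCurvature_euclidean
  · have h := WeightedTriangulation.convergesNear_modifiedCalabi hε h1 h2 hustar
    rw [funext hK] at h
    exact h.congr hcalabi
  · rintro ubar hubar rfl
    exact ⟨WeightedTriangulation.convergesNear_modifiedRicci hε h1 h2 hubar,
      WeightedTriangulation.convergesNear_modifiedCalabi hε h1 h2 hubar⟩
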